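/- Let $(M,g)$ be a smooth Riemannian manifold of dimension $n\ge 3$, with Levi-Civita connection $\nabla_a$ and Schouten tensor $\mathrm P_{ab}=\frac1{n-2}\big(R_{ab}-\frac{R}{2(n-1)}g_{ab}\big)$, where $R_{ab}$ is the Ricci tensor and $R$ the scalar curvature. Let $\gamma\hookrightarrow M$ be a smooth oriented embedded curve, $U^a$ its unit tangent field, $\partial=U^a\nabla_a$, and $C^a=\partial U^a$. Let $\mathcal T=\{(\sigma,\mu_b,\rho)\}=\mathbb R\oplus T^*M\oplus\mathbb R$ be the standard conformal tractor bundle in the presence of $g$, with inner product $\langle(\sigma,\mu,\rho),(\tilde\sigma,\tilde\mu,\tilde\rho)\rangle=\sigma\tilde\rho+\mu^b\tilde\mu_b+\rho\tilde\sigma$ and connection $$\nabla_a(\sigma,\mu_b,\rho)=(\nabla_a\sigma-\mu_a,\ \nabla_a\mu_b+g_{ab}\rho+\mathrm P_{ab}\sigma,\ \nabla_a\rho-\mathrm P_a{}^b\mu_b),$$ and let $\mathcal A\subset\mathrm{End}(\mathcal T)$ be the bundle of skew endomorphisms, with the induced connection. Let $\mathfrak g=\mathfrak{so}(n+1,1)$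 be the corresponding algebra of skew endomorphisms of $\mathbb R\oplus\mathbb R^n\oplus\mathbb R$. Its elements are $$(\sigma,\mu_b,\rho)\mapsto(X^b\mu_b-\lambda\sigma,\ Y_b\sigma+F_b{}^c\mu_c-X_b\rho,\ \lambda\rho-Y^b\mu_b)$$ with $F_{bc}$ skew, and they are identified with the conformal Killing fields $\big(X^b-F^b{}_cx^c+\lambda x^b-Y_cx^cx^b+\frac12x_cx^cY^b\big)\partial/\partial x^b$ on $\mathbb R^n$. For a curve $L\subset\mathbb R^n$ through $0$, let $\mathrm{Sym}\,L\subset\mathfrak g$ be the subalgebra of the fields that are tangent to $L$ at all points of $L$. Say that $\gamma$ is \emph{distinguished, modelled on} $L$, if there is a smooth subbundle $\mathcal S\subset\mathcal A|_\gamma$ that is preserved by the tractor connection along $\gamma$ and whose fibre at each $p\in\gamma$ is conjugate to $\mathrm{Sym}\,L$, i.e. equals $u\,(\mathrm{Sym}\,L)\,u^{-1}$ for some linear isometry $u:\mathbb R\oplus\mathbb R^n\oplus\mathbb R\to\mathcal T_p$ that maps the null line $\{(0,0,*)\}$ to the null line $\{(0,0,*)\}$ (a frame in the Cartan bundle). \textbf{Theorem.}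 Let $L$ be any circle through $0\in\mathbb R^n$, that is, the curve $t\mapsto\frac{2}{1+t^2|C_0|^2}(tU_0+t^2C_0)$ with $|U_0|=1$ and $U_0\cdot C_0=0$ (a straight line if $C_0=0$). Then $\gamma$ is distinguished, modelled on $L$, if and only if $$\partial C_a=\mathrm P_{ab}U^b-(C^bC_b+\mathrm P_{bc}U^bU^c)\,U_a$$ along $\gamma$. -/

import Mathlib

open scoped Manifold ContDiff Topology

noncomputable section

namespace ConformalCircles

/-- The model space `ℝⁿ` with its Euclidean inner product. -/
abbrev Euc (n : ℕ) : Type := EuclideanSpace ℝ (Fin n)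

/-- Smooth Riemannian metrics on a smooth `n`-manifold `M`. -/
abbrev RMetric (n : ℕ) (M : Type*) [TopologicalSpace M] [ChartedSpace (Euc n) M]
    [IsManifold (𝓡 n) ∞ M] : Type _ :=
  Bundle.ContMDiffRiemannianMetric (𝓡 n) ∞ (Euc n) (fun x : M ↦ TangentSpace (𝓡 n) x)

section LocalGeometry

/-! ### Levi-Civita connection and Schouten tensor in charts

`p : M` labels the preferred chart of `M` at `p`; a point `y : Euc n` is a point of the target of
this chart, and Latin indices refer to its coordinate frame. -/

variable {n : ℕ} {M : Type*} [TopologicalSpace M] [ChartedSpace (Euc n) M]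
  [IsManifold (𝓡 n) ∞ M]

/-- The components of a tangent vector at `x` in the coordinate frame of the chart at `p`
(that is, the derivative at `x` of the chart at `p`). -/
def chartCoord (p x : M) : TangentSpace (𝓡 n) x →L[ℝ] Euc n :=
  (trivializationAt (Euc n) (TangentSpace (𝓡 n)) p).continuousLinearMapAt ℝ x

/-- The tangent vector at `x` with given components in the coordinate frame of the chart at `p`;
the inverse of `chartCoord p x` for `x` in the domain of the chart. -/
def chartFrame (p x : M) : Euc n →L[ℝ] TangentSpace (𝓡 n) x :=
  (trivializationAt (Euc n) (TangentSpace (𝓡 n)) p).symmL ℝ x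

/-- The `i`-th partial derivative of a function of `n` real variables. -/
def pd (i : Fin n) (f : Euc n → ℝ) (y : Euc n) : ℝ :=
  fderiv ℝ f y (EuclideanSpace.single i 1)

/-- The metric coefficients `g_{ij}` in the chart at `p`. -/
def metricCoeff (g : RMetric n M) (p : M) (y : Euc n) : Matrix (Fin n) (Fin n) ℝ :=
  Matrix.of fun i j ↦
    g.inner ((extChartAt (𝓡 n) p).symm y)
      (chartFrame p ((extChartAt (𝓡 n) p).symm y) (EuclideanSpace.single i 1))
      (chartFrame p ((extChartAt (𝓡 n) p).symm y) (EuclideanSpace.single j 1))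

/-- The Christoffel symbols `Γ^k_{ij} = ½ g^{kl} (∂_i g_{jl} + ∂_j g_{il} - ∂_l g_{ij})`. -/
def christoffel (g : RMetric n M) (p : M) (k i j : Fin n) (y : Euc n) : ℝ :=
  (1 / 2) * ∑ l, (metricCoeff g p y)⁻¹ k l *
    (pd i (fun z ↦ metricCoeff g p z j l) y + pd j (fun z ↦ metricCoeff g p z i l) y
      - pd l (fun z ↦ metricCoeff g p z i j) y)

/-- The Riemann tensor `R_{ab}{}^c{}_d`, characterised by
`(∇_a ∇_b - ∇_b ∇_a) X^c = R_{ab}{}^c{}_d X^d`. -/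
def riemann (g : RMetric n M) (p : M) (a b c d : Fin n) (y : Euc n) : ℝ :=
  pd a (christoffel g p c b d) y - pd b (christoffel g p c a d) y
    + ∑ e, (christoffel g p c a e y * christoffel g p e b d y
      - christoffel g p c b e y * christoffel g p e a d y)

/-- The Ricci tensor `R_{bd} = R_{ab}{}^a{}_d`. -/
def ricci (g : RMetric n M) (p : M) (y : Euc n) : Matrix (Fin n) (Fin n) ℝ :=
  Matrix.of fun b d ↦ ∑ a, riemann g p a b a d y

/-- The scalar curvature `g^{bd} R_{bd}`. -/
def scalarCurv (g : RMetric n M) (p : M) (y : Euc n) : ℝ :=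
  ∑ b, ∑ d, (metricCoeff g p y)⁻¹ b d * ricci g p y b d

/-- The Schouten tensor `P_{ab} = (R_{ab} - R g_{ab} / (2 (n - 1))) / (n - 2)`, the solution of
`R_{abcd} = W_{abcd} + P_{ac} g_{bd} - P_{bc} g_{ad} - P_{ad} g_{bc} + P_{bd} g_{ac}` with
`W_{ab}{}^a{}_d = 0`. -/
def schoutenCoeff (g : RMetric n M) (p : M) (y : Euc n) : Matrix (Fin n) (Fin n) ℝ :=
  ((n : ℝ) - 2)⁻¹ •
    (ricci g p y - (scalarCurv g p y / (2 * ((n : ℝ) - 1))) • metricCoeff g p y)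

/-- The Schouten tensor at `x`, evaluated on two tangent vectors: `P_{ab} v^a w^b`. -/
def schouten (g : RMetric n M) (x : M) (v w : TangentSpace (𝓡 n) x) : ℝ :=
  ∑ a, ∑ b, schoutenCoeff g x (extChartAt (𝓡 n) x x) a b
    * chartCoord x x v a * chartCoord x x w b

/-- The tangent vector `v^a P_a{}^b = v^a P_{ac} g^{cb}`. -/
def schoutenSharp (g : RMetric n M) (x : M) (v : TangentSpace (𝓡 n) x) : TangentSpace (𝓡 n) x :=
  chartFrame x x (WithLp.toLp 2 fun b ↦
    ∑ a, ∑ c, chartCoord x x v a * schoutenCoeff g x (extChartAt (𝓡 n) x x) a c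
      * (metricCoeff g x (extChartAt (𝓡 n) x x))⁻¹ c b)

end LocalGeometry

section Tractors

/-! ### Standard tractors in the presence of a metric -/

/-- The fibre `(σ, μ, ρ)` of the standard tractor bundle, in the presence of a metric, over a point
with tangent space `V`; the metric is used to trivialise the weights and to regard the `1`-form
`μ_b` as the vector `μ^b`. -/
abbrev Tractor (V : Type*) : Type _ := ℝ × V × ℝ

/-- The tractor inner product `σ σ' ↦ σ ρ' + μ^b μ'_b + ρ σ'`, for the inner product `B` on `V`. -/
def tractorForm {V : Type*} (B : V → V → ℝ) (a b : Tractor V) : ℝ :=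
  a.1 * b.2.2 + B a.2.1 b.2.1 + a.2.2 * b.1

variable {n : ℕ} {M : Type*} [TopologicalSpace M] [ChartedSpace (Euc n) M]
  [IsManifold (𝓡 n) ∞ M]
  {N : Type*} [TopologicalSpace N] [ChartedSpace ℝ N] [IsManifold 𝓘(ℝ, ℝ) ∞ N]

/-- A vector field of `M` along `γ : N → M` is smooth at `s`. -/
def SmoothFieldAt (γ : N → M) (μ : ∀ s, TangentSpace (𝓡 n) (γ s)) (s : N) : Prop :=
  ContMDiffAt 𝓘(ℝ, ℝ) (𝓡 n).tangent ∞ (fun s' ↦ (⟨γ s', μ s'⟩ : TangentBundle (𝓡 n) M)) s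

/-- A section of the standard tractor bundle along `γ` is smooth at `s`. -/
def SmoothTractorAt (γ : N → M) (τ : ∀ s, Tractor (TangentSpace (𝓡 n) (γ s))) (s : N) : Prop :=
  ContMDiffAt 𝓘(ℝ, ℝ) 𝓘(ℝ, ℝ) ∞ (fun s' ↦ (τ s').1) s ∧
  SmoothFieldAt γ (fun s' ↦ (τ s').2.1) s ∧
  ContMDiffAt 𝓘(ℝ, ℝ) 𝓘(ℝ, ℝ) ∞ (fun s' ↦ (τ s').2.2) s

/-- A field of endomorphisms of the standard tractor bundle along `γ` is smooth at `s`. -/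
def SmoothEndAt (γ : N → M) (Φ : ∀ s, Module.End ℝ (Tractor (TangentSpace (𝓡 n) (γ s))))
    (s : N) : Prop :=
  ∀ τ, SmoothTractorAt γ τ s → SmoothTractorAt γ (fun s' ↦ Φ s' (τ s')) s

/-- The velocity `dγ(v)` of `γ` in the direction `v` tangent to the parameter manifold. -/
def velocity (γ : N → M) (s : N) (v : TangentSpace 𝓘(ℝ, ℝ) s) : TangentSpace (𝓡 n) (γ s) :=
  mfderiv 𝓘(ℝ, ℝ) (𝓡 n) γ s v

/-- The derivative of a real function on the parameter manifold in the direction `v`. -/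
def dirDeriv (f : N → ℝ) (s : N) (v : TangentSpace 𝓘(ℝ, ℝ) s) : ℝ :=
  mfderiv 𝓘(ℝ, ℝ) 𝓘(ℝ, ℝ) f s v

/-- The Levi-Civita directional derivative along `γ`, in the direction `v`, of a vector field `μ`
along `γ`: in the chart at `γ s` it is `v(μ^k) + Γ^k_{ij} dγ(v)^i μ^j`. -/
def covDeriv (g : RMetric n M) (γ : N → M) (μ : ∀ s, TangentSpace (𝓡 n) (γ s)) (s : N)
    (v : TangentSpace 𝓘(ℝ, ℝ) s) : TangentSpace (𝓡 n) (γ s) :=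
  chartFrame (γ s) (γ s) (WithLp.toLp 2 fun k ↦
    dirDeriv (fun s' ↦ chartCoord (γ s) (γ s') (μ s') k) s v
      + ∑ i, ∑ j, christoffel g (γ s) k i j (extChartAt (𝓡 n) (γ s) (γ s))
        * chartCoord (γ s) (γ s) (velocity γ s v) i * chartCoord (γ s) (γ s) (μ s) j)

/-- The standard tractor connection along `γ`: with `U = dγ(v)`,
`∂ (σ, μ, ρ) = (∂σ - U^a μ_a, ∂μ_b + U_b ρ + U^a P_{ab} σ, ∂ρ - U^a P_a{}^b μ_b)`. -/
def tractorDeriv (g : RMetric n M) (γ : N → M) (τ : ∀ s, Tractor (TangentSpace (𝓡 n) (γ s)))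
    (s : N) (v : TangentSpace 𝓘(ℝ, ℝ) s) : Tractor (TangentSpace (𝓡 n) (γ s)) :=
  (dirDeriv (fun s' ↦ (τ s').1) s v - g.inner (γ s) (velocity γ s v) (τ s).2.1,
    covDeriv g γ (fun s' ↦ (τ s').2.1) s v + (τ s).2.2 • velocity γ s v
      + (τ s).1 • schoutenSharp g (γ s) (velocity γ s v),
    dirDeriv (fun s' ↦ (τ s').2.2) s v - schouten g (γ s) (velocity γ s v) (τ s).2.1)

/-- `Ψ` is the derivative in the direction `v`, for the tractor connection, of the field `Φ` of
tractor endomorphisms along `γ`: the Leibniz rule `∂(Φ τ) = (∂Φ) τ + Φ (∂τ)` holds with `∂Φ = Ψ`. -/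
def IsTractorEndDeriv (g : RMetric n M) (γ : N → M)
    (Φ : ∀ s, Module.End ℝ (Tractor (TangentSpace (𝓡 n) (γ s)))) (s : N)
    (v : TangentSpace 𝓘(ℝ, ℝ) s) (Ψ : Module.End ℝ (Tractor (TangentSpace (𝓡 n) (γ s)))) : Prop :=
  ∀ τ, SmoothTractorAt γ τ s →
    tractorDeriv g γ (fun s' ↦ Φ s' (τ s')) s v = Ψ (τ s) + Φ s (tractorDeriv g γ τ s v)

/-- `S` is a smooth subbundle of the bundle of tractor endomorphisms along `γ`: it has a smooth
local frame near every point. -/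
def IsSmoothSubbundle (γ : N → M)
    (S : ∀ s, Submodule ℝ (Module.End ℝ (Tractor (TangentSpace (𝓡 n) (γ s))))) : Prop :=
  ∀ s₀ : N, ∃ (k : ℕ)
    (Φ : Fin k → ∀ s, Module.End ℝ (Tractor (TangentSpace (𝓡 n) (γ s)))),
    ∀ᶠ s in 𝓝 s₀, (∀ i, SmoothEndAt γ (Φ i) s) ∧
      LinearIndependent ℝ (fun i ↦ Φ i s) ∧
      Submodule.span ℝ (Set.range fun i ↦ Φ i s) = S s

/-- `S` is preserved by the tractor connection along `γ`: the derivatives of smooth local sections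
of `S` are in `S`. -/
def IsTractorParallel (g : RMetric n M) (γ : N → M)
    (S : ∀ s, Submodule ℝ (Module.End ℝ (Tractor (TangentSpace (𝓡 n) (γ s))))) : Prop :=
  ∀ (s : N) (Φ : ∀ s, Module.End ℝ (Tractor (TangentSpace (𝓡 n) (γ s)))),
    (∀ᶠ s' in 𝓝 s, SmoothEndAt γ Φ s' ∧ Φ s' ∈ S s') →
    ∀ v : TangentSpace 𝓘(ℝ, ℝ) s, ∃ Ψ ∈ S s, IsTractorEndDeriv g γ Φ s v Ψ

end Tractors

section FlatModel

/-! ### The flat model and symmetry algebras -/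

variable {n : ℕ}

/-- The tractor form on the model `ℝ ⊕ ℝⁿ ⊕ ℝ`, of signature `(n + 1, 1)`. -/
def modelForm (a b : Tractor (Euc n)) : ℝ := tractorForm (fun v w : Euc n ↦ inner ℝ v w) a b

/-- The conformal Killing field on `ℝⁿ` of an element `A` of the Lie algebra `𝔰𝔬(n + 1, 1)` of
skew endomorphisms of the model. Such an `A` is
`(σ, μ, ρ) ↦ (X^b μ_b - λ σ, Y_b σ + F_b{}^c μ_c - X_b ρ, λ ρ - Y^b μ_b)` with `F` skew, and the
field is `X^b - F^b{}_c x^c + λ x^b - Y_c x^c x^b + ½ x_c x^c Y^b`. -/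
def killingField (A : Module.End ℝ (Tractor (Euc n))) (x : Euc n) : Euc n :=
  let X : Euc n := -(A (0, 0, 1)).2.1
  let F : Euc n → Euc n := fun z ↦ (A (0, z, 0)).2.1
  let lam : ℝ := (A (0, 0, 1)).2.2
  let Y : Euc n := (A (1, 0, 0)).2.1
  X - F x + lam • x - (inner ℝ Y x : ℝ) • x + ((1 / 2 : ℝ) * inner ℝ x x) • Y

theorem killingField_zero (x : Euc n) : killingField 0 x = 0 := by
  simp [killingField]

theorem killingField_add (A B : Module.End ℝ (Tractor (Euc n))) (x : Euc n) :
    killingField (A + B) x = killingField A x + killingField B x := by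
  simp only [killingField, LinearMap.add_apply, Prod.snd_add, Prod.fst_add, inner_add_left]
  module

theorem killingField_smul (r : ℝ) (A : Module.End ℝ (Tractor (Euc n))) (x : Euc n) :
    killingField (r • A) x = r • killingField A x := by
  simp only [killingField, LinearMap.smul_apply, Prod.smul_snd, Prod.smul_fst,
    real_inner_smul_left, smul_eq_mul]
  module

/-- The symmetry algebra in `𝔰𝔬(n + 1, 1)` of a regular parametrised curve `c` in
`ℝⁿ ⊂ Sⁿ = G/P`: the elements whose conformal Killing field is everywhere tangent to `c`. -/
def symAlgebra (c : ℝ → Euc n) : Submodule ℝ (Module.End ℝ (Tractor (Euc n))) where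
  carrier := {A | (∀ a b, modelForm (A a) b + modelForm a (A b) = 0) ∧
    ∀ t, killingField A (c t) ∈ Submodule.span ℝ {deriv c t}}
  zero_mem' := by
    refine ⟨fun a b ↦ by simp [modelForm, tractorForm], fun t ↦ ?_⟩
    rw [killingField_zero]
    exact Submodule.zero_mem _
  add_mem' := by
    rintro A B ⟨hA, hA'⟩ ⟨hB, hB'⟩
    refine ⟨fun a b ↦ ?_, fun t ↦ ?_⟩
    · have h1 := hA a b
      have h2 := hB a b
      simp only [modelForm, tractorForm, LinearMap.add_apply, Prod.snd_add, Prod.fst_add,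
        inner_add_left, inner_add_right] at h1 h2 ⊢
      linarith
    · rw [killingField_add]
      exact Submodule.add_mem _ (hA' t) (hB' t)
  smul_mem' := by
    rintro r A ⟨hA, hA'⟩
    refine ⟨fun a b ↦ ?_, fun t ↦ ?_⟩
    · have h1 := hA a b
      simp only [modelForm, tractorForm, LinearMap.smul_apply, Prod.smul_snd, Prod.smul_fst,
        real_inner_smul_left, real_inner_smul_right, smul_eq_mul] at h1 ⊢
      linear_combination r * h1
    · rw [killingField_smul]
      exact Submodule.smul_mem _ _ (hA' t)

/-- For `U` of unit length and `C` orthogonal to `U`, the circle through the origin of `ℝⁿ` with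
velocity `U` and acceleration `C` there (a straight line if `C = 0`). -/
def circle (U C : Euc n) (t : ℝ) : Euc n :=
  (2 / (1 + t ^ 2 * inner ℝ C C)) • (t • U + t ^ 2 • C)

end FlatModel

section Distinguished

variable {n : ℕ} {M : Type*} [TopologicalSpace M] [ChartedSpace (Euc n) M]
  [IsManifold (𝓡 n) ∞ M]
  {N : Type*} [TopologicalSpace N] [ChartedSpace ℝ N] [IsManifold 𝓘(ℝ, ℝ) ∞ N]

/-- The fibre of the Cartan bundle at `x`: the isometries from the model to the tractor fibre at
`x` that map the model null line `(0, 0, *)`, whose stabiliser is the parabolic subgroup `P` and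
which represents the origin `0 ∈ ℝⁿ ⊂ G/P`, to the canonical null line. -/
def IsCartanFrame (g : RMetric n M) (x : M)
    (u : Tractor (Euc n) ≃ₗ[ℝ] Tractor (TangentSpace (𝓡 n) x)) : Prop :=
  (∀ a b, tractorForm (fun v w ↦ g.inner x v w) (u a) (u b) = modelForm a b) ∧
  ∃ r : ℝ, u (0, 0, 1) = (0, 0, r)

/-- `γ` is an unparameterised distinguished curve modelled on the curve `c` through the origin of
`ℝⁿ ⊂ G/P`: along `γ` there is a smooth subbundle `S` of the adjoint tractor bundle whose fibres
are conjugate to the symmetry algebra of `c` (they correspond to it in some frame of the Cartan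
bundle), and which is preserved by the tractor connection along `γ`. -/
def IsDistinguished (g : RMetric n M) (c : ℝ → Euc n) (γ : N → M) : Prop :=
  ∃ S : ∀ s, Submodule ℝ (Module.End ℝ (Tractor (TangentSpace (𝓡 n) (γ s)))),
    IsSmoothSubbundle γ S ∧
    (∀ s, ∃ u, IsCartanFrame g (γ s) u ∧
      S s = (symAlgebra c).map (LinearEquiv.conj u).toLinearMap) ∧
    IsTractorParallel g γ S

/-- The conformal circle equation `∂C_a = P_{ab} U^b - (C^b C_b + P_{bc} U^b U^c) U_a` along `γ`,
where `U = dγ(e)` is the velocity, `C = ∂U` the acceleration and `∂ = U^a ∇_a`; the field `e` on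
the parameter manifold is the one for which `U` is the unit tangent field of the oriented curve.
The equation between `1`-forms is evaluated on tangent vectors `w`. -/
def ConformalCircleEq (g : RMetric n M) (γ : N → M) (e : ∀ s : N, TangentSpace 𝓘(ℝ, ℝ) s) :
    Prop :=
  let U : ∀ s, TangentSpace (𝓡 n) (γ s) := fun s ↦ velocity γ s (e s)
  let C : ∀ s, TangentSpace (𝓡 n) (γ s) := fun s ↦ covDeriv g γ U s (e s)
  ∀ (s : N) (w : TangentSpace (𝓡 n) (γ s)),
    g.inner (γ s) (covDeriv g γ C s (e s)) w
      = schouten g (γ s) (U s) w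
        - (g.inner (γ s) (C s) (C s) + schouten g (γ s) (U s) (U s)) * g.inner (γ s) (U s) w

end Distinguished

end ConformalCircles

end

/-! The subalgebra is traded for a subspace. The null vectors that represent the points of a circle
span a three-dimensional space `circleSpace U₀ (-C₀)` in the model, and a skew endomorphism has
Killing field tangent to the circle exactly when it preserves this space (`symAlgebra_circle`).
Cartan frames carry it to spaces `circleSpace a b` with `a ≠ 0` (`exists_map_circleSpace`);
conversely every `circleSpace a (-c)` with `a` of unit length is such an image, whichever circle or
line is the model (`exists_frame_circleSpace`). So a candidate subbundle is fibrewise the skew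
stabiliser of a rank-three space `W` that contains the canonical tractor `X = (0, 0, 1)`.

Along the curve `∂X = (0, U, 0)` and `∂(0, U, 0) = (-1, C, -P(U, U))`, while `∂(-1, C, 0)` has first
slot `-⟨U, C⟩ = 0` and middle slot `∂C - P♯U`. A parallel `W` through `X` must therefore be spanned
by `X`, `(0, U, 0)` and `(-1, C, 0)`, and this span is parallel exactly when `∂C - P♯U` is a
multiple of `U`. Since `⟨U, U⟩ = 1` forces `⟨∂C, U⟩ = -⟨C, C⟩`, pairing with `U` determines the
multiple, and the condition becomes the conformal circle equation.

For necessity only the stabiliser is known to be parallel, with no smoothness of `W` at hand.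
`mem_of_wedge_mem` applies the Leibniz rule to sections `X ∧ Y` of the stabiliser to extract
membership of derivatives in `W`; three applications produce `U`, then `C`, then `∂C`. For
sufficiency, `tractorDeriv_mem_circleSpace` shows that `W` is parallel, `isTractorParallel_skewStab`
passes to its stabiliser, and a smooth self-adjoint projection onto `W` gives smooth sections that
span the stabiliser (`skewStab_le_span`, `isSmoothSubbundle_of_span`).

The groundwork is chart independence. The covariant derivative at a point uses the chart preferred
at that point, so iterating it requires the transition law of the Christoffel symbols
(`chartChristoffel_transition`, `chartCoord_covDeriv`). Metric compatibility then yields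
`dirDeriv_inner` and `dirDeriv_tractorBilin`. -/

noncomputable section

namespace ConformalCircles

section TractorAlgebra

/-! ### Linear algebra of the tractor form -/

variable {V : Type*} [AddCommGroup V] [Module ℝ V]

/-- The tractor form as a bilinear form. -/
def tractorBilin (B : LinearMap.BilinForm ℝ V) : LinearMap.BilinForm ℝ (Tractor V) :=
  LinearMap.mk₂ ℝ (tractorForm fun v w ↦ B v w)
    (fun a b c ↦ by simp [tractorForm]; ring)
    (fun r a b ↦ by simp [tractorForm]; ring)
    (fun a b c ↦ by simp [tractorForm]; ring)
    (fun r a b ↦ by simp [tractorForm]; ring)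

theorem tractorBilin_apply (B : LinearMap.BilinForm ℝ V) (a b : Tractor V) :
    tractorBilin B a b = a.1 * b.2.2 + B a.2.1 b.2.1 + a.2.2 * b.1 := rfl

theorem tractorBilin_comm {B : LinearMap.BilinForm ℝ V} (hB : ∀ v w, B v w = B w v)
    (a b : Tractor V) : tractorBilin B a b = tractorBilin B b a := by
  simp only [tractorBilin_apply, hB a.2.1 b.2.1]; ring

/-- The tractor endomorphism `τ ↦ ⟨b, τ⟩ a - ⟨a, τ⟩ b`. -/
def wedge (B : LinearMap.BilinForm ℝ V) (a b : Tractor V) : Module.End ℝ (Tractor V) :=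
  (tractorBilin B b).smulRight a - (tractorBilin B a).smulRight b

theorem wedge_apply (B : LinearMap.BilinForm ℝ V) (a b τ : Tractor V) :
    wedge B a b τ = tractorBilin B b τ • a - tractorBilin B a τ • b := rfl

/-- The tractors `(σ, μ, ρ)` with `μ - σ b` a multiple of `a`. -/
def circleSpace (a b : V) : Submodule ℝ (Tractor V) where
  carrier := {w | ∃ r : ℝ, w.2.1 = r • a + w.1 • b}
  zero_mem' := ⟨0, by simp⟩
  add_mem' := by
    rintro w w' ⟨r, hr⟩ ⟨r', hr'⟩
    refine ⟨r + r', ?_⟩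
    simp only [Prod.snd_add, Prod.fst_add, hr, hr']
    module
  smul_mem' := by
    rintro c w ⟨r, hr⟩
    refine ⟨c * r, ?_⟩
    simp only [Prod.smul_snd, Prod.smul_fst, hr, smul_eq_mul]
    module

theorem mem_circleSpace {a b : V} {w : Tractor V} :
    w ∈ circleSpace a b ↔ ∃ r : ℝ, w.2.1 = r • a + w.1 • b := Iff.rfl

/-- The skew tractor endomorphisms that preserve a subspace `W`. -/
def skewStab (B : LinearMap.BilinForm ℝ V) (W : Submodule ℝ (Tractor V)) :
    Submodule ℝ (Module.End ℝ (Tractor V)) where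
  carrier := {A | (∀ a b, tractorBilin B (A a) b + tractorBilin B a (A b) = 0) ∧ ∀ w ∈ W, A w ∈ W}
  zero_mem' := ⟨fun a b ↦ by simp, fun w _ ↦ by simp⟩
  add_mem' := by
    rintro A A' ⟨hA, hW⟩ ⟨hA', hW'⟩
    refine ⟨fun a b ↦ ?_, fun w hw ↦ W.add_mem (hW w hw) (hW' w hw)⟩
    simp only [LinearMap.add_apply, map_add]
    linear_combination hA a b + hA' a b
  smul_mem' := by
    rintro r A ⟨hA, hW⟩
    refine ⟨fun a b ↦ ?_, fun w hw ↦ W.smul_mem r (hW w hw)⟩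
    simp only [LinearMap.smul_apply, map_smul, smul_eq_mul]
    linear_combination r * hA a b

theorem mem_skewStab {B : LinearMap.BilinForm ℝ V} {W : Submodule ℝ (Tractor V)}
    {A : Module.End ℝ (Tractor V)} : A ∈ skewStab B W ↔
      (∀ a b, tractorBilin B (A a) b + tractorBilin B a (A b) = 0) ∧ ∀ w ∈ W, A w ∈ W := Iff.rfl

theorem wedge_skew {B : LinearMap.BilinForm ℝ V} (hB : ∀ v w, B v w = B w v) (a b c d : Tractor V) :
    tractorBilin B (wedge B a b c) d + tractorBilin B c (wedge B a b d) = 0 := by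
  simp only [wedge_apply, map_sub, map_smul, LinearMap.sub_apply, LinearMap.smul_apply,
    smul_eq_mul, tractorBilin_comm hB c]
  ring

theorem wedge_mem_skewStab {B : LinearMap.BilinForm ℝ V} (hB : ∀ v w, B v w = B w v)
    {W : Submodule ℝ (Tractor V)} {a b : Tractor V} (ha : a ∈ W) (hb : b ∈ W) :
    wedge B a b ∈ skewStab B W :=
  ⟨wedge_skew hB a b, fun _ _ ↦ W.sub_mem (W.smul_mem _ ha) (W.smul_mem _ hb)⟩

/-- Such a `wedge` annihilates `W`. Together with the wedges of elements of `W`, these are the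
generators used in `skewStab_le_span`. -/
theorem wedge_mem_skewStab_of_orthogonal {B : LinearMap.BilinForm ℝ V}
    (hB : ∀ v w, B v w = B w v) {W : Submodule ℝ (Tractor V)} {a b : Tractor V}
    (ha : ∀ w ∈ W, tractorBilin B a w = 0) (hb : ∀ w ∈ W, tractorBilin B b w = 0) :
    wedge B a b ∈ skewStab B W :=
  ⟨wedge_skew hB a b, fun w hw ↦ by simp [wedge_apply, ha w hw, hb w hw]⟩

/-- Pairing with `(0, 0, 1)` and `(1, 0, 0)` reads off the outer slots, and positivity of `B`
handles the middle one. -/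
theorem tractorBilin_nondegenerate [FiniteDimensional ℝ V] {B : LinearMap.BilinForm ℝ V}
    (hB : ∀ v w, B v w = B w v) (hpos : ∀ v, v ≠ 0 → 0 < B v v) :
    (tractorBilin B).Nondegenerate := by
  have key : ∀ m : Tractor V, (∀ n, tractorBilin B m n = 0) → m = 0 := by
    intro m hm
    have h1 := hm (0, 0, 1)
    have h2 := hm (1, 0, 0)
    have h3 := hm (0, m.2.1, 0)
    simp only [tractorBilin_apply, map_zero, mul_zero, mul_one, add_zero, zero_add] at h1 h2 h3
    have h4 : m.2.1 = 0 := by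
      by_contra h
      exact (hpos _ h).ne' h3
    exact Prod.ext h1 (Prod.ext h4 h2)
  refine ⟨key, fun m hm ↦ key m fun n ↦ ?_⟩
  rw [tractorBilin_comm hB]
  exact hm n

/-- A skew endomorphism is a combination of the `wedge`s of the elements of a basis. -/
theorem mem_span_wedge [FiniteDimensional ℝ V] {ι : Type*} [Fintype ι]
    {B : LinearMap.BilinForm ℝ V}
    (hB : ∀ v w, B v w = B w v) (hpos : ∀ v, v ≠ 0 → 0 < B v v)
    (f : Module.Basis ι ℝ (Tractor V)) {A : Module.End ℝ (Tractor V)}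
    (hA : ∀ a b, tractorBilin B (A a) b + tractorBilin B a (A b) = 0) :
    A ∈ Submodule.span ℝ (Set.range fun i : ι × ι ↦ wedge B (f i.1) (f i.2)) := by
  classical
  set d := (tractorBilin B).dualBasis (tractorBilin_nondegenerate hB hpos) f
  have hexp : ∀ τ, τ = ∑ j, tractorBilin B (d j) τ • f j := by
    intro τ
    have h : ∀ j, tractorBilin B (d j) τ = f.repr τ j := by
      intro j
      conv_lhs => rw [← f.sum_repr τ]
      simp only [map_sum, map_smul, d, LinearMap.BilinForm.apply_dualBasis_left, smul_eq_mul]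
      simp
    simp_rw [h]
    exact (f.sum_repr τ).symm
  have hexp' : ∀ τ, τ = ∑ j, tractorBilin B (f j) τ • d j := by
    intro τ
    rw [← sub_eq_zero]
    apply (tractorBilin_nondegenerate hB hpos).1
    intro τ'
    rw [hexp τ']
    simp only [map_sum, map_smul, map_sub, LinearMap.sub_apply, smul_eq_mul, LinearMap.sum_apply,
      LinearMap.smul_apply, d, LinearMap.BilinForm.apply_dualBasis_left]
    refine Finset.sum_eq_zero fun i _ ↦ ?_
    simp [tractorBilin_comm hB (f i) τ]
  -- Expanding `τ` in the basis, or `A τ` in the dual basis and using skewness, gives `A τ` each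
  -- time; the two halves of the wedges add up to `2 A τ`, hence the factor `1 / 2`.
  have hsum : A = (1 / 2 : ℝ) • ∑ j, wedge B (A (f j)) (d j) := by
    refine LinearMap.ext fun τ ↦ ?_
    have e1 : A τ = ∑ j, tractorBilin B (d j) τ • A (f j) := by
      conv_lhs => rw [hexp τ]
      simp
    have e2 : A τ = - ∑ j, tractorBilin B (A (f j)) τ • d j := by
      conv_lhs => rw [hexp' (A τ)]
      rw [← Finset.sum_neg_distrib]
      refine Finset.sum_congr rfl fun j _ ↦ ?_
      rw [← neg_smul]
      congr 1
      linear_combination hA (f j) τ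
    simp only [LinearMap.smul_apply, LinearMap.sum_apply, wedge_apply, Finset.sum_sub_distrib]
    rw [← e1, sub_eq_add_neg, ← e2]
    module
  have hmem : ∀ a b, wedge B a b ∈
      Submodule.span ℝ (Set.range fun i : ι × ι ↦ wedge B (f i.1) (f i.2)) := by
    intro a b
    have : wedge B a b = ∑ i, ∑ j, (f.repr a i * f.repr b j) • wedge B (f i) (f j) := by
      have key : ∀ (x y : ι → ℝ), wedge B (∑ i, x i • f i) (∑ j, y j • f j) =
          ∑ i, ∑ j, (x i * y j) • wedge B (f i) (f j) := by
        intro x y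
        refine LinearMap.ext fun τ ↦ ?_
        simp only [wedge_apply, map_sum, map_smul, LinearMap.sum_apply, LinearMap.smul_apply,
          Finset.smul_sum, Finset.sum_smul, smul_sub, Finset.sum_sub_distrib, smul_eq_mul]
        congr 1
        · refine Finset.sum_congr rfl fun i _ ↦ Finset.sum_congr rfl fun j _ ↦ ?_
          module
        · rw [Finset.sum_comm]
          refine Finset.sum_congr rfl fun i _ ↦ Finset.sum_congr rfl fun j _ ↦ ?_
          module
      rw [← key, f.sum_repr, f.sum_repr]
    rw [this]
    exact Submodule.sum_mem _ fun i _ ↦ Submodule.sum_mem _ fun j _ ↦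
      Submodule.smul_mem _ _ (Submodule.subset_span ⟨(i, j), rfl⟩)
  rw [hsum]
  exact Submodule.smul_mem _ _ (Submodule.sum_mem _ fun j _ ↦ hmem _ _)

/-- The elements of `skewStab B W` are combinations of `wedge`s of projections of the elements of a
basis, for a self-adjoint projection `Π` onto `W`. -/
theorem skewStab_le_span [FiniteDimensional ℝ V] {ι : Type*} [Fintype ι]
    {B : LinearMap.BilinForm ℝ V}
    (hB : ∀ v w, B v w = B w v) (hpos : ∀ v, v ≠ 0 → 0 < B v v)
    (f : Module.Basis ι ℝ (Tractor V)) {W : Submodule ℝ (Tractor V)}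
    (Q : Module.End ℝ (Tractor V)) (hQ : ∀ τ, Q τ ∈ W) (hQW : ∀ w ∈ W, Q w = w)
    (hadj : ∀ a b, tractorBilin B (Q a) b = tractorBilin B a (Q b)) :
    skewStab B W ≤ Submodule.span ℝ (Set.range fun i : ι × ι ↦
      wedge B (Q (f i.1)) (Q (f i.2)) +
        wedge B (f i.1 - Q (f i.1)) (f i.2 - Q (f i.2))) := by
  intro A hA
  obtain ⟨hsk, hW⟩ := hA
  -- Block-diagonal compression for the splitting into the range and the kernel of `Q`. It fixes the
  -- elements of `skewStab B W` and sends each `wedge` to a listed generator, so applying it to a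
  -- spanning family of the skew endomorphisms gives the claim.
  let R : Module.End ℝ (Module.End ℝ (Tractor V)) :=
    { toFun := fun A ↦ Q * A * Q + (1 - Q) * A * (1 - Q)
      map_add' := fun A A' ↦ by noncomm_ring
      map_smul' := fun r A ↦ by
        simp only [mul_smul_comm, smul_mul_assoc, RingHom.id_apply, smul_add] }
  have hRA : R A = A := by
    refine LinearMap.ext fun τ ↦ ?_
    have h1 : Q (A (Q τ)) = A (Q τ) := hQW _ (hW _ (hQ τ))
    -- A skew map that preserves `W` also preserves its orthogonal complement, where `Q` vanishes.
    have h2 : Q (A (τ - Q τ)) = 0 := by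
      apply (tractorBilin_nondegenerate hB hpos).1
      intro n
      rw [hadj]
      have h3 := hsk (τ - Q τ) (Q n)
      have h4 : tractorBilin B (τ - Q τ) (A (Q n)) = 0 := by
        rw [← hQW _ (hW _ (hQ n)), ← hadj, map_sub, hQW _ (hQ τ), sub_self, map_zero,
          LinearMap.zero_apply]
      linarith
    change Q (A (Q τ)) + (A (τ - Q τ) - Q (A (τ - Q τ))) = A τ
    rw [h1, h2, sub_zero, map_sub]
    abel
  have hRw : ∀ a b, R (wedge B a b) = wedge B (Q a) (Q b) + wedge B (a - Q a) (b - Q b) := by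
    intro a b
    refine LinearMap.ext fun τ ↦ ?_
    change Q (wedge B a b (Q τ)) + (wedge B a b (τ - Q τ) - Q (wedge B a b (τ - Q τ))) = _
    simp only [LinearMap.add_apply, wedge_apply, map_sub, map_smul, LinearMap.sub_apply, hadj]
    module
  have := Submodule.mem_map_of_mem (f := R) (mem_span_wedge hB hpos f hsk)
  rw [hRA, Submodule.map_span, ← Set.range_comp] at this
  simpa only [Function.comp_def, hRw] using this

end TractorAlgebra

section Model

/-! ### The symmetry algebra of a circle -/

variable {n : ℕ}

theorem tractorBilin_innerₗ (a b : Tractor (Euc n)) :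
    tractorBilin (innerₗ (Euc n)) a b = modelForm a b := rfl

/-- The null vector of the model that represents `x ∈ ℝⁿ`. -/
def nullLift (x : Euc n) : Tractor (Euc n) := (-(1 / 2) * inner ℝ x x, x, 1)

/-- Skewness against `(0, 0, 1)` and `(1, 0, 0)` determines the outer slots of `A w`. This recovers
the block form with `X`, `F`, `λ`, `Y` that `killingField` presupposes. -/
theorem skew_apply {A : Module.End ℝ (Tractor (Euc n))}
    (hA : ∀ a b, modelForm (A a) b + modelForm a (A b) = 0) (w : Tractor (Euc n)) :
    A w = (-inner ℝ (A (0, 0, 1)).2.1 w.2.1 - (A (0, 0, 1)).2.2 * w.1,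
      w.1 • (A (1, 0, 0)).2.1 + (A (0, w.2.1, 0)).2.1 + w.2.2 • (A (0, 0, 1)).2.1,
      (A (0, 0, 1)).2.2 * w.2.2 - inner ℝ (A (1, 0, 0)).2.1 w.2.1) := by
  have hw : w = w.1 • ((1, 0, 0) : Tractor (Euc n)) + (0, w.2.1, 0) +
      w.2.2 • ((0, 0, 1) : Tractor (Euc n)) := by
    ext <;> simp
  have hAw : A w = w.1 • A (1, 0, 0) + A (0, w.2.1, 0) + w.2.2 • A (0, 0, 1) := by
    rw [← map_smul, ← map_smul, ← map_add, ← map_add, ← hw]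
  have h1 := hA w (0, 0, 1)
  have h2 := hA w (1, 0, 0)
  have h3 := hA (0, 0, 1) (0, 0, 1)
  have h4 := hA (1, 0, 0) (1, 0, 0)
  have h5 := hA (0, 0, 1) (1, 0, 0)
  simp only [modelForm, tractorForm, inner_zero_right, inner_zero_left, mul_zero, mul_one, zero_mul,
    one_mul, add_zero, zero_add] at h1 h2 h3 h4 h5
  have e3 : (A (0, 0, 1)).1 = 0 := by linarith
  have e4 : (A (1, 0, 0)).2.2 = 0 := by linarith
  rw [e3] at h1
  rw [e4] at h2
  refine Prod.ext ?_ (Prod.ext ?_ ?_)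
  · rw [real_inner_comm]
    linear_combination h1
  · rw [hAw]
    rfl
  · have : (A (1, 0, 0)).1 = -(A (0, 0, 1)).2.2 := by linarith
    rw [this] at h2
    change (A w).2.2 = _
    linear_combination h2 + real_inner_comm w.2.1 (A (1, 0, 0)).2.1

/-- The action on null vectors of a skew endomorphism in terms of its conformal Killing field. -/
theorem skew_apply_nullLift {A : Module.End ℝ (Tractor (Euc n))}
    (hA : ∀ a b, modelForm (A a) b + modelForm a (A b) = 0) (x : Euc n) :
    A (nullLift x) = ((A (0, 0, 1)).2.2 - inner ℝ (A (1, 0, 0)).2.1 x) • nullLift x -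
      (-inner ℝ x (killingField A x), killingField A x, 0) := by
  have hF : inner ℝ x (A (0, x, 0)).2.1 = 0 := by
    have h := hA (0, x, 0) (0, x, 0)
    simp only [modelForm, tractorForm, zero_mul, mul_zero, add_zero, zero_add] at h
    rw [real_inner_comm] at h
    linarith
  rw [skew_apply hA]
  refine Prod.ext ?_ (Prod.ext ?_ ?_)
  · simp only [nullLift, killingField, Prod.fst_sub, Prod.smul_fst, smul_eq_mul, inner_add_right,
      inner_sub_right, inner_neg_right, inner_smul_right, hF]
    rw [real_inner_comm (A (0, 0, 1)).2.1 x, real_inner_comm (A (1, 0, 0)).2.1 x]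
    ring
  · simp only [nullLift, killingField, Prod.fst_sub, Prod.snd_sub, Prod.smul_fst, Prod.smul_snd]
    module
  · simp [nullLift]

/-! ### Null lifts of the points of a circle -/

variable (U C : Euc n)

/-- The null vectors of the points of a circle, scaled to be quadratic in the parameter. -/
def circleLift (t : ℝ) : Tractor (Euc n) :=
  (-2 * t ^ 2, (2 * t) • U + (2 * t ^ 2) • C, 1 + t ^ 2 * inner ℝ C C)

/-- The derivative of `circleLift`. -/
def circleLift' (t : ℝ) : Tractor (Euc n) :=
  (-4 * t, (2 : ℝ) • U + (4 * t) • C, 2 * t * inner ℝ C C)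

variable {U C}

theorem circle_den_pos (C : Euc n) (t : ℝ) : 0 < 1 + t ^ 2 * inner ℝ C C := by
  have := real_inner_self_nonneg (x := C)
  positivity

theorem circleLift_eq (hU : ‖U‖ = 1) (hUC : inner ℝ U C = (0 : ℝ)) (t : ℝ) :
    circleLift U C t = (1 + t ^ 2 * inner ℝ C C) • nullLift (circle U C t) := by
  have hq := (circle_den_pos C t).ne'
  have hUU : inner ℝ U U = (1 : ℝ) := by rw [real_inner_self_eq_norm_sq, hU]; norm_num
  have hCU : inner ℝ C U = (0 : ℝ) := by rw [real_inner_comm, hUC]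
  refine Prod.ext ?_ (Prod.ext ?_ ?_)
  · simp only [circleLift, nullLift, circle, Prod.smul_fst, smul_eq_mul, inner_add_left,
      inner_add_right, real_inner_smul_left, inner_smul_right, hUU, hUC, hCU]
    field_simp
    ring
  · simp only [circleLift, nullLift, circle, Prod.smul_fst, Prod.smul_snd, smul_smul, smul_add]
    congr 2 <;> field_simp
  · simp [circleLift, nullLift]

/-- Product rule for the circle multiplied by its denominator, which is a quadratic polynomial in
`t`. No quotient has to be differentiated explicitly. -/
theorem deriv_circle (U C : Euc n) (t : ℝ) :
    (1 + t ^ 2 * inner ℝ C C) • deriv (circle U C) t + (2 * t * inner ℝ C C) • circle U C t =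
      (2 : ℝ) • U + (4 * t) • C := by
  have hq := (circle_den_pos C t).ne'
  have h1 : HasDerivAt (fun t : ℝ ↦ 1 + t ^ 2 * inner ℝ C C) (2 * t * inner ℝ C C) t := by
    have := ((hasDerivAt_pow 2 t).mul_const (inner ℝ C C)).const_add 1
    simpa using this
  have h2 : HasDerivAt (fun t : ℝ ↦ (2 * t) • U + (2 * t ^ 2) • C)
      ((2 : ℝ) • U + (4 * t) • C) t := by
    have h3 : HasDerivAt (fun t : ℝ ↦ 2 * t) 2 t := by
      simpa using (hasDerivAt_id t).const_mul 2
    have h4 : HasDerivAt (fun t : ℝ ↦ 2 * t ^ 2) (4 * t) t := by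
      have := (hasDerivAt_pow 2 t).const_mul 2
      refine this.congr_deriv ?_
      norm_num
      ring
    exact (h3.smul_const U).add (h4.smul_const C)
  have h5 : DifferentiableAt ℝ (circle U C) t := by
    unfold circle
    have : DifferentiableAt ℝ (fun t : ℝ ↦ t • U + t ^ 2 • C) t := by fun_prop
    exact ((differentiableAt_const 2).div h1.differentiableAt hq).smul this
  have h6 := h1.smul h5.hasDerivAt
  have h7 : (fun t : ℝ ↦ (1 + t ^ 2 * inner ℝ C C) • circle U C t) =
      fun t : ℝ ↦ (2 * t) • U + (2 * t ^ 2) • C := by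
    funext s
    have hq := (circle_den_pos C s).ne'
    simp only [circle, smul_smul, smul_add]
    congr 2 <;> field_simp
  have h8 := h6.unique (h7 ▸ h2 : HasDerivAt (fun t : ℝ ↦ (1 + t ^ 2 * inner ℝ C C) •
    circle U C t) _ t)
  exact h8

/-- The product rule applied to `circleLift_eq`: it shows that, modulo the null lift itself,
`circleLift'` is the tangent direction of the circle in the form in which a Killing field occurs in
`skew_apply_nullLift`. -/
theorem circleLift'_eq (hU : ‖U‖ = 1) (hUC : inner ℝ U C = (0 : ℝ)) (t : ℝ) :
    circleLift' U C t = (2 * t * inner ℝ C C) • nullLift (circle U C t) +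
      (1 + t ^ 2 * inner ℝ C C) •
        (-inner ℝ (circle U C t) (deriv (circle U C) t), deriv (circle U C) t, (0 : ℝ)) := by
  have hq := (circle_den_pos C t).ne'
  have hUU : inner ℝ U U = (1 : ℝ) := by rw [real_inner_self_eq_norm_sq, hU]; norm_num
  have hCU : inner ℝ C U = (0 : ℝ) := by rw [real_inner_comm, hUC]
  have hd := deriv_circle U C t
  refine Prod.ext ?_ (Prod.ext ?_ ?_)
  · have h1 := congrArg (fun z ↦ (inner ℝ (circle U C t) z : ℝ)) hd
    have h2 : (inner ℝ (circle U C t) (circle U C t) : ℝ) =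
        4 * t ^ 2 / (1 + t ^ 2 * inner ℝ C C) := by
      simp only [circle, inner_add_left, inner_add_right, real_inner_smul_left, inner_smul_right,
        hUU, hUC, hCU]
      field_simp
      ring
    have h3 : (inner ℝ (circle U C t) ((2 : ℝ) • U + (4 * t) • C) : ℝ) =
        4 * t * (1 + 2 * t ^ 2 * inner ℝ C C) / (1 + t ^ 2 * inner ℝ C C) := by
      simp only [circle, inner_add_left, inner_add_right, real_inner_smul_left, inner_smul_right,
        hUU, hUC, hCU]
      field_simp
      ring
    simp only [inner_add_right, inner_smul_right] at h1 h3
    simp only [circleLift', nullLift, Prod.fst_add, Prod.smul_fst, smul_eq_mul]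
    rw [h3, h2] at h1
    have h4 : (1 + t ^ 2 * inner ℝ C C) * inner ℝ (circle U C t) (deriv (circle U C) t) =
      4 * t * (1 + 2 * t ^ 2 * inner ℝ C C) / (1 + t ^ 2 * inner ℝ C C) -
        2 * t * inner ℝ C C * (4 * t ^ 2 / (1 + t ^ 2 * inner ℝ C C)) := by linarith
    rw [h2, mul_neg, h4]
    field_simp
    ring
  · simp only [circleLift', nullLift, Prod.fst_add, Prod.snd_add, Prod.smul_fst, Prod.smul_snd]
    rw [← hd]
    abel
  · simp [circleLift', nullLift]

/-- Tangency at the parameter `t` means that `A` maps the null lift `ℓ(t)` into the span of `ℓ(t)`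
and `ℓ'(t)`. This plane is the part of `circleSpace U (-C)` orthogonal to `ℓ(t)`, and the `ℓ(t)`
span the whole space. One inclusion uses the spanning, the other that `A ℓ(t)` is orthogonal to
`ℓ(t)` by skewness. -/
theorem symAlgebra_circle (hU : ‖U‖ = 1) (hUC : inner ℝ U C = (0 : ℝ)) :
    symAlgebra (circle U C) = skewStab (innerₗ (Euc n)) (circleSpace U (-C)) := by
  have hUU : inner ℝ U U = (1 : ℝ) := by rw [real_inner_self_eq_norm_sq, hU]; norm_num
  have hCU : inner ℝ C U = (0 : ℝ) := by rw [real_inner_comm, hUC]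
  have hl : ∀ t, circleLift U C t ∈ circleSpace U (-C) := fun t ↦ by
    rw [mem_circleSpace]
    exact ⟨2 * t, by simp only [circleLift]; module⟩
  have hl' : ∀ t, circleLift' U C t ∈ circleSpace U (-C) := fun t ↦ by
    rw [mem_circleSpace]
    exact ⟨2, by simp only [circleLift']; module⟩
  ext A
  rw [mem_skewStab]
  refine and_congr_right fun hA ↦ ⟨fun h ↦ ?_, fun h t ↦ ?_⟩
  · have key : ∀ t, A (circleLift U C t) ∈ circleSpace U (-C) := by
      intro t
      have hq := (circle_den_pos C t).ne'
      obtain ⟨k, hk⟩ := Submodule.mem_span_singleton.1 (h t)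
      rw [circleLift_eq hU hUC, map_smul, skew_apply_nullLift hA, ← hk]
      have e1 := circleLift_eq hU hUC t
      have e2 := circleLift'_eq hU hUC t
      set q := 1 + t ^ 2 * inner ℝ C C with hqdef
      set q' := 2 * t * inner ℝ C C
      set m := (A (0, 0, 1)).2.2 - inner ℝ (A (1, 0, 0)).2.1 (circle U C t)
      have e3 : nullLift (circle U C t) = q⁻¹ • circleLift U C t := by
        rw [e1, smul_smul, inv_mul_cancel₀ hq, one_smul]
      have e4 : q • ((-inner ℝ (circle U C t) (k • deriv (circle U C) t),
          k • deriv (circle U C) t, 0) : Tractor (Euc n)) =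
          k • (circleLift' U C t - q' • nullLift (circle U C t)) := by
        rw [e2, add_sub_cancel_left, smul_comm]
        simp [inner_smul_right]
      rw [smul_sub, e4, e3]
      refine Submodule.sub_mem _ ?_ ?_
      · exact Submodule.smul_mem _ _ (Submodule.smul_mem _ _ (Submodule.smul_mem _ _ (hl t)))
      · exact Submodule.smul_mem _ _ (Submodule.sub_mem _ (hl' t)
          (Submodule.smul_mem _ _ (Submodule.smul_mem _ _ (hl t))))
    intro w hw
    obtain ⟨r, hr⟩ := mem_circleSpace.1 hw
    -- The lift is quadratic in `t`, so its value and its first and second differences at `0`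
    -- recover its coefficients: `ℓ(0) = (0, 0, 1)`, `ℓ(1) - ℓ(-1) = (0, 4U, 0)`, and the second
    -- difference is `(-4, 4C, 2⟨C, C⟩)`.
    have hdec : w = (w.2.2 + w.1 * inner ℝ C C / 2) • circleLift U C 0 +
        (r / 4) • (circleLift U C 1 - circleLift U C (-1)) +
        (-(w.1 / 4)) • (circleLift U C 1 + circleLift U C (-1) - (2 : ℝ) • circleLift U C 0) := by
      refine Prod.ext ?_ (Prod.ext ?_ ?_)
      · simp only [circleLift, Prod.fst_add, Prod.fst_sub, Prod.smul_fst, smul_eq_mul]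
        ring
      · simp only [circleLift, Prod.fst_add, Prod.fst_sub, Prod.smul_fst, Prod.snd_add,
          Prod.snd_sub, Prod.smul_snd]
        rw [hr]
        module
      · simp only [circleLift, Prod.snd_add, Prod.snd_sub, Prod.smul_snd,
          smul_eq_mul]
        ring
    rw [hdec]
    simp only [map_add, map_sub, map_smul]
    exact Submodule.add_mem _ (Submodule.add_mem _ (Submodule.smul_mem _ _ (key _))
      (Submodule.smul_mem _ _ (Submodule.sub_mem _ (key _) (key _)))) (Submodule.smul_mem _ _
      (Submodule.sub_mem _ (Submodule.add_mem _ (key _) (key _)) (Submodule.smul_mem _ _ (key _))))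
  · have hq := (circle_den_pos C t).ne'
    have hmem := h _ (hl t)
    have horth := hA (circleLift U C t) (circleLift U C t)
    rw [← tractorBilin_innerₗ, ← tractorBilin_innerₗ,
      tractorBilin_comm (fun v w ↦ real_inner_comm w v)] at horth
    obtain ⟨r, hr⟩ := mem_circleSpace.1 hmem
    have e1 := circleLift_eq hU hUC t
    have e2 := circleLift'_eq hU hUC t
    have e5 := skew_apply_nullLift hA (circle U C t)
    have e6 : A (circleLift U C t) = (1 + t ^ 2 * inner ℝ C C) • A (nullLift (circle U C t)) := by
      rw [e1, map_smul]
    rw [e5] at e6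
    have horth' : tractorBilin (innerₗ (Euc n)) (circleLift U C t) (A (circleLift U C t)) = 0 := by
      linarith
    generalize A (circleLift U C t) = w at *
    generalize (A (0, 0, 1)).2.2 - inner ℝ (A (1, 0, 0)).2.1 (circle U C t) = m at *
    generalize killingField A (circle U C t) = k at *
    simp only [tractorBilin_apply, circleLift, innerₗ_apply_apply, hr, inner_add_left,
      inner_add_right, real_inner_smul_left, inner_smul_right, inner_neg_right, hUU, hUC, hCU]
      at horth'
    -- This functional takes the values `1` on `ℓ(t)` and `0` on `ℓ'(t)`, so it is the first
    -- coefficient; the coefficient `r` of `U` then gives `β`. The one remaining equation is the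
    -- orthogonality `horth'`.
    set α := w.2.2 + w.1 * inner ℝ C C / 2 with hα
    set β := (r - 2 * t * α) / 2 with hβ
    have hw : w = α • circleLift U C t + β • circleLift' U C t := by
      refine Prod.ext ?_ (Prod.ext ?_ ?_)
      · simp only [circleLift, circleLift', Prod.fst_add, Prod.smul_fst, smul_eq_mul]
        rw [hβ, hα]
        linear_combination horth'
      · have : w.1 = -4 * t * β - 2 * t ^ 2 * α := by
          rw [hβ, hα]
          linear_combination horth'
        simp only [circleLift, circleLift', Prod.snd_add, Prod.fst_add, Prod.smul_fst,
          Prod.smul_snd]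
        have h2 : r = 2 * β + 2 * t * α := by rw [hβ]; ring
        rw [hr, this, h2]
        module
      · simp only [circleLift, circleLift', Prod.snd_add, Prod.smul_snd, smul_eq_mul]
        rw [hβ, hα]
        linear_combination (-inner ℝ C C / 2) * horth'
    rw [hw, e1, e2] at e6
    have h1 := congrArg (fun z : Tractor (Euc n) ↦ z.2.1) e6
    have h2 := congrArg (fun z : Tractor (Euc n) ↦ z.2.2) e6
    simp only [nullLift, Prod.snd_add, Prod.fst_add, Prod.smul_snd, Prod.smul_fst, Prod.snd_sub,
      Prod.fst_sub, smul_eq_mul] at h1 h2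
    refine Submodule.mem_span_singleton.2 ⟨-β, ?_⟩
    have h3 : (1 + t ^ 2 * inner ℝ C C) • (-β • deriv (circle U C) t) =
        (1 + t ^ 2 * inner ℝ C C) • k := by
      have h4 : (1 + t ^ 2 * inner ℝ C C) * m = α * (1 + t ^ 2 * inner ℝ C C) +
        β * (2 * t * inner ℝ C C) := by linarith
      have h5 : (1 + t ^ 2 * inner ℝ C C) • k =
        ((1 + t ^ 2 * inner ℝ C C) * m) • circle U C t -
          (1 + t ^ 2 * inner ℝ C C) • (m • circle U C t - k) := by module
      rw [h5, ← h1, h4]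
      module
    exact smul_right_injective _ hq h3

end Model

section Frames

/-! ### Isometries from the model -/

variable {n : ℕ} {V : Type*} [AddCommGroup V] [Module ℝ V] {B : LinearMap.BilinForm ℝ V}
  {U C : Euc n}

/-- Conjugation by an isometry preserves skewness and moves the stabilised subspace along with it.
-/
theorem map_conj_skewStab (u : Tractor (Euc n) ≃ₗ[ℝ] Tractor V)
    (hu : ∀ a b, tractorBilin B (u a) (u b) = modelForm a b) (W : Submodule ℝ (Tractor (Euc n))) :
    (skewStab (innerₗ (Euc n)) W).map (LinearEquiv.conj u).toLinearMap =
      skewStab B (W.map u.toLinearMap) := by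
  ext A
  rw [Submodule.mem_map_equiv, mem_skewStab, mem_skewStab]
  have hs : ∀ a, (LinearEquiv.conj u).symm A a = u.symm (A (u a)) := fun a ↦ rfl
  refine and_congr ⟨fun h a b ↦ ?_, fun h a b ↦ ?_⟩ ⟨fun h w hw ↦ ?_, fun h w hw ↦ ?_⟩
  · have := h (u.symm a) (u.symm b)
    simpa only [tractorBilin_innerₗ, ← hu, hs, LinearEquiv.apply_symm_apply] using this
  · have := h (u a) (u b)
    simpa only [tractorBilin_innerₗ, ← hu, hs, LinearEquiv.apply_symm_apply] using this
  · obtain ⟨w, hw, rfl⟩ := hw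
    exact ⟨_, h w hw, by simp [hs]⟩
  · obtain ⟨w', hw', h'⟩ := h (u w) ⟨w, hw, rfl⟩
    rw [hs, ← h']
    simpa using hw'

/-- The space is spanned by `(0, U, 0)`, `(1, -C, 0)` and `(0, 0, 1)`. As `u` preserves the null
line, pairing with `(0, 0, 1)` shows that the image of the first has zero first slot and that of the
second does not; the middle slots, the second one rescaled, serve as `a` and `b`. -/
theorem exists_map_circleSpace (hU : ‖U‖ = 1) (u : Tractor (Euc n) ≃ₗ[ℝ] Tractor V)
    (hu : ∀ a b, tractorBilin B (u a) (u b) = modelForm a b) {r : ℝ}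
    (hr : u (0, 0, 1) = (0, 0, r)) :
    ∃ a b, a ≠ 0 ∧ (circleSpace U (-C)).map u.toLinearMap = circleSpace a b := by
  have hUU : inner ℝ U U = (1 : ℝ) := by rw [real_inner_self_eq_norm_sq, hU]; norm_num
  have h1 := hu (0, U, 0) (0, 0, 1)
  have h2 := hu (0, U, 0) (0, U, 0)
  have h3 := hu (1, -C, 0) (0, 0, 1)
  simp only [hr, tractorBilin_apply, modelForm, tractorForm, map_zero, inner_zero_right, mul_zero,
    add_zero, zero_add, mul_one, hUU] at h1 h2 h3
  have hr0 : r ≠ 0 := by rintro rfl; simp at h3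
  have h1' : (u (0, U, 0)).1 = 0 := by simpa [hr0] using h1
  have hσ : (u (1, -C, 0)).1 ≠ 0 := by intro h; simp [h] at h3
  rw [h1'] at h2
  set a := (u (0, U, 0)).2.1 with ha
  set σ := (u (1, -C, 0)).1 with hσ'
  refine ⟨a, σ⁻¹ • (u (1, -C, 0)).2.1, ?_, ?_⟩
  · intro h
    simp [h] at h2
  · ext w
    constructor
    · rintro ⟨w, ⟨t, ht⟩, rfl⟩
      have hw : w = t • ((0, U, 0) : Tractor (Euc n)) + w.1 • ((1, -C, 0) : Tractor (Euc n)) +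
          w.2.2 • ((0, 0, 1) : Tractor (Euc n)) := by
        refine Prod.ext ?_ (Prod.ext ?_ ?_) <;> simp [ht]
      have huw : u w = t • u (0, U, 0) + w.1 • u (1, -C, 0) + w.2.2 • u (0, 0, 1) := by
        rw [← map_smul, ← map_smul, ← map_smul, ← map_add, ← map_add, ← hw]
      refine ⟨t, ?_⟩
      change (u w).2.1 = t • a + (u w).1 • σ⁻¹ • (u (1, -C, 0)).2.1
      rw [huw, hr]
      simp only [Prod.snd_add, Prod.fst_add, Prod.smul_snd, Prod.smul_fst, ← ha, ← hσ', h1',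
        smul_smul, smul_eq_mul, mul_zero, zero_add, add_zero]
      rw [mul_assoc, mul_inv_cancel₀ hσ, mul_one]
      simp
    · rintro ⟨t, ht⟩
      have : ∃ z, w - (t • u (0, U, 0) + (w.1 * σ⁻¹) • u (1, -C, 0)) = (0, 0, z) := by
        refine ⟨_, Prod.ext ?_ (Prod.ext ?_ rfl)⟩
        · simp only [Prod.fst_sub, Prod.fst_add, Prod.smul_fst, h1', ← hσ', smul_eq_mul]
          rw [mul_assoc, inv_mul_cancel₀ hσ]
          ring
        · simp only [Prod.snd_sub, Prod.fst_sub, Prod.snd_add, Prod.fst_add, Prod.smul_snd,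
            Prod.smul_fst, ht, ← ha]
          module
      obtain ⟨z, hz⟩ := this
      have hw : w = u (t • ((0, U, 0) : Tractor (Euc n)) +
          (w.1 * σ⁻¹) • ((1, -C, 0) : Tractor (Euc n)) +
          (z * r⁻¹) • ((0, 0, 1) : Tractor (Euc n))) := by
        rw [map_add, map_add, map_smul, map_smul, map_smul, hr]
        rw [sub_eq_iff_eq_add] at hz
        conv_lhs => rw [hz]
        rw [add_comm]
        congr 1
        simp [hr0]
      rw [hw]
      refine ⟨_, ⟨t, ?_⟩, rfl⟩
      simp

theorem exists_orthonormalBasis_apply_eq {E : Type*} [NormedAddCommGroup E]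
    [InnerProductSpace ℝ E] [FiniteDimensional ℝ E] (i : Fin n) (hE : Module.finrank ℝ E = n)
    {x : E} (hx : ‖x‖ = 1) : ∃ b : OrthonormalBasis (Fin n) ℝ E, b i = x := by
  have hv : Orthonormal ℝ (({i} : Set (Fin n)).domRestrict fun _ ↦ x) :=
    ⟨fun _ ↦ hx, fun i j hij ↦ absurd (Subsingleton.elim i j) hij⟩
  obtain ⟨b, hb⟩ := hv.exists_orthonormalBasis_extension_of_card_eq (by simpa using hE)
  exact ⟨b, hb i rfl⟩

/-- For unit vectors `U`, `a` there is an isometry from the Euclidean space that maps `U` to `a`. -/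
theorem exists_isometry [FiniteDimensional ℝ V] (hdim : Module.finrank ℝ V = n)
    (hB : ∀ v w, B v w = B w v)
    (hpos : ∀ v, v ≠ 0 → 0 < B v v) (hU : ‖U‖ = 1) {a : V} (ha : B a a = 1) :
    ∃ o : Euc n ≃ₗ[ℝ] V, (∀ v w, B (o v) (o w) = inner ℝ v w) ∧ o U = a := by
  -- A local Euclidean structure on `V` given by `B`, so that orthonormal bases whose element of
  -- index `i₀` is `U`, respectively `a`, can be matched.
  let core : InnerProductSpace.Core ℝ V :=
    { inner := fun v w ↦ B v w
      conj_inner_symm := fun v w ↦ by simpa using hB w v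
      re_inner_nonneg := fun v ↦ by
        by_cases h : v = 0
        · simp [h]
        · exact (hpos v h).le
      add_left := fun x y z ↦ by simp
      smul_left := fun x y r ↦ by simp
      definite := fun v h ↦ by
        by_contra h'
        exact (hpos v h').ne' h }
  let : NormedAddCommGroup V := core.toNormedAddCommGroup
  let : InnerProductSpace ℝ V := InnerProductSpace.ofCore core.toCore
  have hin : ∀ v w : V, inner ℝ v w = B v w := fun v w ↦ rfl
  have hna : ‖a‖ = 1 := by
    have : ‖a‖ ^ 2 = 1 := by rw [← real_inner_self_eq_norm_sq, hin, ha]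
    have h0 := norm_nonneg a
    nlinarith
  have hn : 0 < n := by
    rcases Nat.eq_zero_or_pos n with rfl | h
    · have : U = 0 := Subsingleton.elim _ _
      simp [this] at hU
    · exact h
  let i₀ : Fin n := ⟨0, hn⟩
  obtain ⟨b, hb⟩ := exists_orthonormalBasis_apply_eq i₀ (by simp) hU
  obtain ⟨b', hb'⟩ := exists_orthonormalBasis_apply_eq i₀ hdim hna
  refine ⟨(b.equiv b' (Equiv.refl _)).toLinearEquiv, fun v w ↦ ?_, ?_⟩
  · rw [← hin]
    exact (b.equiv b' (Equiv.refl _)).inner_map_map v w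
  · change b.equiv b' (Equiv.refl _) U = a
    rw [← hb, OrthonormalBasis.equiv_apply_basis, Equiv.refl_apply, hb']

/-- The parabolic subgroup acts transitively on circles and lines through the origin: an orthogonal
map turns `U` into `a`, and a unipotent element that fixes the canonical null vector shifts the
acceleration arbitrarily. This is why the condition on the curve does not depend on the model
circle. -/
theorem exists_frame_circleSpace [FiniteDimensional ℝ V] (hdim : Module.finrank ℝ V = n)
    (hB : ∀ v w, B v w = B w v) (hpos : ∀ v, v ≠ 0 → 0 < B v v) (hU : ‖U‖ = 1) {a c : V}
    (ha : B a a = 1) :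
    ∃ u : Tractor (Euc n) ≃ₗ[ℝ] Tractor V,
      (∀ a b, tractorBilin B (u a) (u b) = modelForm a b) ∧ u (0, 0, 1) = (0, 0, 1) ∧
      (circleSpace U (-C)).map u.toLinearMap = circleSpace a (-c) := by
  obtain ⟨o, ho, hoU⟩ := exists_isometry hdim hB hpos hU ha
  have ho' : ∀ v w, inner ℝ v (o.symm w) = B (o v) w := fun v w ↦ by
    rw [← ho, o.apply_symm_apply]
  let d : V := o C - c
  let f : Tractor (Euc n) →ₗ[ℝ] Tractor V :=
    { toFun := fun w ↦ (w.1, o w.2.1 + w.1 • d, w.2.2 - B d (o w.2.1) - (1 / 2) * B d d * w.1)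
      map_add' := fun x y ↦ by
        refine Prod.ext rfl (Prod.ext ?_ ?_)
        · simp only [Prod.snd_add, Prod.fst_add, map_add]; module
        · simp only [Prod.snd_add, Prod.fst_add, map_add]; ring
      map_smul' := fun r x ↦ by
        refine Prod.ext rfl (Prod.ext ?_ ?_)
        · simp only [Prod.smul_snd, Prod.smul_fst, map_smul, RingHom.id_apply, smul_eq_mul]; module
        · simp only [Prod.smul_snd, Prod.smul_fst, map_smul, RingHom.id_apply, smul_eq_mul]; ring }
  let f' : Tractor V →ₗ[ℝ] Tractor (Euc n) :=
    { toFun := fun w ↦ (w.1, o.symm (w.2.1 - w.1 • d), w.2.2 + B d w.2.1 - (1 / 2) * B d d * w.1)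
      map_add' := fun x y ↦ by
        refine Prod.ext rfl (Prod.ext ?_ ?_)
        · simp only [Prod.snd_add, Prod.fst_add, ← map_add]; congr 1; module
        · simp only [Prod.snd_add, Prod.fst_add, map_add]; ring
      map_smul' := fun r x ↦ by
        refine Prod.ext rfl (Prod.ext ?_ ?_)
        · simp only [Prod.smul_snd, Prod.smul_fst, ← map_smul, RingHom.id_apply, smul_eq_mul]
          congr 1; module
        · simp only [Prod.smul_snd, Prod.smul_fst, map_smul, RingHom.id_apply, smul_eq_mul]; ring }
  let u : Tractor (Euc n) ≃ₗ[ℝ] Tractor V := LinearEquiv.ofLinearMap f f'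
    (by
      refine LinearMap.ext fun w ↦ Prod.ext rfl (Prod.ext ?_ ?_)
      · simp [f, f']
      · simp [f, f']; ring)
    (by
      refine LinearMap.ext fun w ↦ Prod.ext rfl (Prod.ext ?_ ?_)
      · simp [f, f']
      · simp [f, f']; ring)
  have hu : ∀ w, u w =
    (w.1, o w.2.1 + w.1 • d, w.2.2 - B d (o w.2.1) - (1 / 2) * B d d * w.1) := fun w ↦ rfl
  refine ⟨u, fun x y ↦ ?_, ?_, ?_⟩
  · simp only [hu, tractorBilin_apply, modelForm, tractorForm, map_add, map_smul,
      LinearMap.add_apply, LinearMap.smul_apply, smul_eq_mul, ho, hB (o x.2.1) d]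
    ring
  · simp [hu]
  · ext w
    rw [Submodule.mem_map_equiv, mem_circleSpace, mem_circleSpace]
    refine exists_congr fun r ↦ ?_
    change o.symm (w.2.1 - w.1 • d) = r • U + w.1 • -C ↔ _
    rw [LinearEquiv.symm_apply_eq, map_add, map_smul, map_smul, map_neg, hoU, sub_eq_iff_eq_add]
    have : r • a + w.1 • -(o C) + w.1 • d = r • a + w.1 • -c := by
      simp only [d]; module
    rw [this]

end Frames

section ChartFrames

set_option linter.unusedSectionVars false

variable {n : ℕ} {M : Type*} [TopologicalSpace M] [ChartedSpace (Euc n) M]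
  [IsManifold (𝓡 n) ∞ M]

/-! ### The metric and the Christoffel symbols in a chart -/

/-- The metric on a tangent space as a bilinear form. -/
def metricForm (g : RMetric n M) (x : M) : LinearMap.BilinForm ℝ (TangentSpace (𝓡 n) x) :=
  LinearMap.mk₂ ℝ (fun v w ↦ g.inner x v w) (fun a b c ↦ by simp) (fun r a b ↦ by simp)
    (fun a b c ↦ by simp) (fun r a b ↦ by simp)

theorem metricForm_apply (g : RMetric n M) (x : M) (v w : TangentSpace (𝓡 n) x) :
    metricForm g x v w = g.inner x v w := rfl

theorem chartCoord_chartFrame {p x : M} (hx : x ∈ (chartAt (Euc n) p).source) (v : Euc n) :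
    chartCoord p x (chartFrame p x v) = v :=
  Bundle.Trivialization.continuousLinearMapAt_symmL _ (by simpa using hx) v

theorem chartFrame_chartCoord {p x : M} (hx : x ∈ (chartAt (Euc n) p).source)
    (v : TangentSpace (𝓡 n) x) : chartFrame p x (chartCoord p x v) = v :=
  Bundle.Trivialization.symmL_continuousLinearMapAt _ (by simpa using hx) v

theorem chartCoord_eq_mfderiv {p x : M} (hx : x ∈ (chartAt (Euc n) p).source) :
    chartCoord p x = mfderiv (𝓡 n) 𝓘(ℝ, Euc n) (extChartAt (𝓡 n) p) x :=
  TangentBundle.continuousLinearMapAt_trivializationAt hx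

theorem symm_mem_chart_source {p : M} {y : Euc n} (hy : y ∈ (extChartAt (𝓡 n) p).target) :
    (extChartAt (𝓡 n) p).symm y ∈ (chartAt (Euc n) p).source := by
  have := (extChartAt (𝓡 n) p).map_target hy
  rwa [extChartAt_source] at this

/-- The metric in the chart at `p`, as a bilinear function. -/
def chartMetric (g : RMetric n M) (p : M) (y a b : Euc n) : ℝ :=
  ∑ i, ∑ j, metricCoeff g p y i j * a i * b j

theorem sum_single_smul (a : Euc n) : ∑ i, a i • EuclideanSpace.single i (1 : ℝ) = a := by
  ext k
  simp [Pi.single_apply]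

theorem chartMetric_eq (g : RMetric n M) (p : M) (y a b : Euc n) :
    chartMetric g p y a b = g.inner ((extChartAt (𝓡 n) p).symm y)
      (chartFrame p ((extChartAt (𝓡 n) p).symm y) a)
      (chartFrame p ((extChartAt (𝓡 n) p).symm y) b) := by
  conv_rhs => rw [← sum_single_smul a, ← sum_single_smul b]
  simp only [chartMetric, metricCoeff, Matrix.of_apply, map_sum, map_smul,
    sum_apply, smul_apply, smul_eq_mul, Finset.mul_sum]
  rw [Finset.sum_comm]
  refine Finset.sum_congr rfl fun i _ ↦ Finset.sum_congr rfl fun j _ ↦ ?_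
  ring

theorem metricCoeff_symm (g : RMetric n M) (p : M) (y : Euc n) (i j : Fin n) :
    metricCoeff g p y i j = metricCoeff g p y j i := by
  simp only [metricCoeff, Matrix.of_apply, g.symm]

/-- A kernel vector has zero length, so it vanishes by positivity of the metric. -/
theorem isUnit_det_metricCoeff (g : RMetric n M) {p : M} {y : Euc n}
    (hy : y ∈ (extChartAt (𝓡 n) p).target) : IsUnit (metricCoeff g p y).det := by
  rw [← Matrix.isUnit_iff_isUnit_det, ← Matrix.mulVec_injective_iff_isUnit]
  refine (injective_iff_map_eq_zero (metricCoeff g p y).mulVecLin).2 fun a ha ↦ ?_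
  have h1 : chartMetric g p y (WithLp.toLp 2 a) (WithLp.toLp 2 a) = 0 := by
    have : chartMetric g p y (WithLp.toLp 2 a) (WithLp.toLp 2 a) =
        ∑ i, a i * (metricCoeff g p y).mulVec a i := by
      simp only [chartMetric, Matrix.mulVec, dotProduct, Finset.mul_sum]
      refine Finset.sum_congr rfl fun i _ ↦ Finset.sum_congr rfl fun j _ ↦ ?_
      ring
    rw [this]
    refine Finset.sum_eq_zero fun i _ ↦ ?_
    rw [show (metricCoeff g p y).mulVec a = 0 from ha]
    simp
  rw [chartMetric_eq] at h1
  have h2 : chartFrame p ((extChartAt (𝓡 n) p).symm y) (WithLp.toLp 2 a) = 0 := by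
    by_contra h
    exact (g.pos _ _ h).ne' h1
  have h3 := chartCoord_chartFrame (symm_mem_chart_source hy) (WithLp.toLp 2 a)
  rw [h2, map_zero] at h3
  funext i
  exact (congrArg (fun z : Euc n ↦ z i) h3).symm

/-- Lowering the upper index cancels the inverse metric and leaves the Christoffel symbols of the
first kind. -/
theorem sum_metricCoeff_christoffel (g : RMetric n M) {p : M} {y : Euc n}
    (hy : y ∈ (extChartAt (𝓡 n) p).target) (i j m : Fin n) :
    ∑ l, metricCoeff g p y m l * christoffel g p l i j y = (1 / 2) *
      (pd i (fun z ↦ metricCoeff g p z j m) y + pd j (fun z ↦ metricCoeff g p z i m) y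
        - pd m (fun z ↦ metricCoeff g p z i j) y) := by
  set w : Fin n → ℝ := fun m ↦ pd i (fun z ↦ metricCoeff g p z j m) y +
    pd j (fun z ↦ metricCoeff g p z i m) y - pd m (fun z ↦ metricCoeff g p z i j) y
  have h : ∀ l, christoffel g p l i j y = (1 / 2) * (metricCoeff g p y)⁻¹.mulVec w l := fun l ↦ rfl
  have h2 := congrFun (congrArg (fun A : Matrix (Fin n) (Fin n) ℝ ↦ A.mulVec w)
    (Matrix.mul_nonsing_inv _ (isUnit_det_metricCoeff g hy))) m
  simp only [Matrix.one_mulVec, ← Matrix.mulVec_mulVec] at h2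
  change _ = (1 / 2) * w m
  rw [← h2]
  simp only [h, Matrix.mulVec, dotProduct, Finset.mul_sum]
  refine Finset.sum_congr rfl fun l _ ↦ Finset.sum_congr rfl fun k _ ↦ ?_
  ring

theorem christoffel_symm (g : RMetric n M) (p : M) (y : Euc n) (k i j : Fin n) :
    christoffel g p k i j y = christoffel g p k j i y := by
  simp only [christoffel]
  congr 1
  refine Finset.sum_congr rfl fun l _ ↦ ?_
  have : (fun z ↦ metricCoeff g p z i j) = fun z ↦ metricCoeff g p z j i := by
    funext z
    exact metricCoeff_symm ..
  rw [this]
  ring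

/-- The Christoffel symbols in the chart at `p`, as a bilinear function with values in `ℝⁿ`. -/
def chartChristoffel (g : RMetric n M) (p : M) (y a b : Euc n) : Euc n :=
  WithLp.toLp 2 fun k ↦ ∑ i, ∑ j, christoffel g p k i j y * a i * b j

theorem chartChristoffel_symm (g : RMetric n M) (p : M) (y a b : Euc n) :
    chartChristoffel g p y a b = chartChristoffel g p y b a := by
  ext k
  simp only [chartChristoffel]
  rw [Finset.sum_comm]
  refine Finset.sum_congr rfl fun l _ ↦ Finset.sum_congr rfl fun m _ ↦ ?_
  rw [christoffel_symm]
  ring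

theorem chartChristoffel_add_right (g : RMetric n M) (p : M) (y a b c : Euc n) :
    chartChristoffel g p y a (b + c) = chartChristoffel g p y a b + chartChristoffel g p y a c := by
  ext k
  simp [chartChristoffel, mul_add, Finset.sum_add_distrib]

theorem chartChristoffel_smul_right (g : RMetric n M) (p : M) (y a b : Euc n) (r : ℝ) :
    chartChristoffel g p y a (r • b) = r • chartChristoffel g p y a b := by
  ext k
  simp only [chartChristoffel, PiLp.smul_apply, smul_eq_mul, Finset.mul_sum]
  refine Finset.sum_congr rfl fun l _ ↦ Finset.sum_congr rfl fun m _ ↦ ?_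
  ring

theorem contMDiffAt_inner {E' : Type*} [NormedAddCommGroup E'] [NormedSpace ℝ E']
    {H' : Type*} [TopologicalSpace H'] {I' : ModelWithCorners ℝ E' H'}
    {N : Type*} [TopologicalSpace N] [ChartedSpace H' N] (g : RMetric n M) {b : N → M}
    {v w : ∀ s, TangentSpace (𝓡 n) (b s)} {s : N}
    (hv : ContMDiffAt I' (𝓡 n).tangent ∞ (fun s' ↦ (⟨b s', v s'⟩ : TangentBundle (𝓡 n) M)) s)
    (hw : ContMDiffAt I' (𝓡 n).tangent ∞ (fun s' ↦ (⟨b s', w s'⟩ : TangentBundle (𝓡 n) M)) s) :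
    ContMDiffAt I' 𝓘(ℝ, ℝ) ∞ (fun s' ↦ g.inner (b s') (v s') (w s')) s := by
  have hb : ContMDiffAt I' (𝓡 n) ∞ b s := (Bundle.contMDiffAt_totalSpace.1 hv).1
  have : ContMDiffAt I' ((𝓡 n).prod 𝓘(ℝ)) ∞
      (fun m ↦ Bundle.TotalSpace.mk' ℝ (E := Bundle.Trivial M ℝ) (b m)
        (g.inner (b m) (v m) (w m))) s := by
    apply ContMDiffAt.clm_bundle_apply₂ (F₁ := Euc n) (F₂ := Euc n)
    · exact (g.contMDiff.contMDiffAt).comp s hb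
    · exact hv
    · exact hw
  exact (Bundle.contMDiffAt_totalSpace.1 this).2

theorem contDiffAt_metricCoeff (g : RMetric n M) {p : M} {y : Euc n}
    (hy : y ∈ (extChartAt (𝓡 n) p).target) (i j : Fin n) :
    ContDiffAt ℝ ∞ (fun z ↦ metricCoeff g p z i j) y := by
  rw [← contMDiffAt_iff_contDiffAt]
  have hx := symm_mem_chart_source hy
  have hb : ContMDiffAt 𝓘(ℝ, Euc n) (𝓡 n) ∞ (extChartAt (𝓡 n) p).symm y :=
    contMDiffOn_extChartAt_symm p |>.contMDiffAt ((isOpen_extChartAt_target p).mem_nhds hy)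
  have hfr : ∀ v : Euc n, ContMDiffAt 𝓘(ℝ, Euc n) (𝓡 n).tangent ∞
      (fun z ↦ (⟨(extChartAt (𝓡 n) p).symm z, chartFrame p ((extChartAt (𝓡 n) p).symm z) v⟩ :
        TangentBundle (𝓡 n) M)) y := by
    intro v
    rw [(trivializationAt (Euc n) (TangentSpace (𝓡 n)) p).contMDiffAt_iff
      (by rw [Bundle.Trivialization.mem_source]; simpa using hx)]
    refine ⟨hb, ?_⟩
    refine contMDiffAt_const (c := v) |>.congr_of_eventuallyEq ?_
    filter_upwards [(isOpen_extChartAt_target p).mem_nhds hy] with z hz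
    have := chartCoord_chartFrame (symm_mem_chart_source hz) v
    rw [chartCoord, Bundle.Trivialization.continuousLinearMapAt_apply,
      Bundle.Trivialization.linearMapAt_apply, if_pos] at this
    · exact this
    · simpa using symm_mem_chart_source hz
  exact contMDiffAt_inner g (hfr _) (hfr _)

theorem contDiffAt_det {F : Type*} [NormedAddCommGroup F] [NormedSpace ℝ F] {m : ℕ∞ω}
    {ι : Type*} [Fintype ι] [DecidableEq ι] {A : F → Matrix ι ι ℝ} {y : F}
    (hA : ∀ i j, ContDiffAt ℝ m (fun z ↦ A z i j) y) : ContDiffAt ℝ m (fun z ↦ (A z).det) y := by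
  simp only [Matrix.det_apply']
  exact ContDiffAt.sum fun σ _ ↦ contDiffAt_const.mul (contDiffAt_prod fun i _ ↦ hA _ _)

theorem contDiffAt_matrix_inv {F : Type*} [NormedAddCommGroup F] [NormedSpace ℝ F] {m : ℕ∞ω}
    {ι : Type*} [Fintype ι] [DecidableEq ι] {A : F → Matrix ι ι ℝ} {y : F}
    (hA : ∀ i j, ContDiffAt ℝ m (fun z ↦ A z i j) y) (hy : IsUnit (A y).det) (i j : ι) :
    ContDiffAt ℝ m (fun z ↦ (A z)⁻¹ i j) y := by
  simp only [Matrix.inv_def, Matrix.smul_apply, Ring.inverse_eq_inv', smul_eq_mul,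
    Matrix.adjugate_apply]
  refine ((contDiffAt_det hA).inv hy.ne_zero).mul (contDiffAt_det fun k l ↦ ?_)
  simp only [Matrix.updateRow_apply]
  split_ifs
  · exact contDiffAt_const
  · exact hA _ _

theorem contDiffAt_christoffel (g : RMetric n M) {p : M} {y : Euc n}
    (hy : y ∈ (extChartAt (𝓡 n) p).target) (k i j : Fin n) :
    ContDiffAt ℝ ∞ (christoffel g p k i j) y := by
  have hpd : ∀ a b c, ContDiffAt ℝ ∞ (pd a fun z ↦ metricCoeff g p z b c) y := fun a b c ↦
    ((contDiffAt_metricCoeff g hy b c).fderiv_right (m := ∞) (by simp)).clm_apply contDiffAt_const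
  refine contDiffAt_const.mul (ContDiffAt.sum fun l _ ↦ ContDiffAt.mul ?_ ?_)
  · exact contDiffAt_matrix_inv (contDiffAt_metricCoeff g hy) (isUnit_det_metricCoeff g hy) k l
  · exact ((hpd _ _ _).add (hpd _ _ _)).sub (hpd _ _ _)

theorem fderiv_apply_eq_sum_pd (f : Euc n → ℝ) (y u : Euc n) :
    fderiv ℝ f y u = ∑ k, u k * pd k f y := by
  conv_lhs => rw [← sum_single_smul u]
  simp [pd]

/-- The Christoffel symbols are compatible with the metric. -/
theorem fderiv_metricCoeff (g : RMetric n M) {p : M} {y : Euc n}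
    (hy : y ∈ (extChartAt (𝓡 n) p).target) (u a b : Euc n) :
    ∑ i, ∑ j, fderiv ℝ (fun z ↦ metricCoeff g p z i j) y u * a i * b j =
      chartMetric g p y (chartChristoffel g p y u a) b +
        chartMetric g p y a (chartChristoffel g p y u b) := by
  -- Of the two first-kind symbols, the terms not differentiated in direction `k` cancel in the sum,
  -- which leaves `∂_k g_ij`.
  have key : ∀ k i j, pd k (fun z ↦ metricCoeff g p z i j) y =
      ∑ l, metricCoeff g p y l j * christoffel g p l k i y +
        ∑ l, metricCoeff g p y i l * christoffel g p l k j y := by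
    intro k i j
    have h1 := sum_metricCoeff_christoffel g hy k i j
    have h2 := sum_metricCoeff_christoffel g hy k j i
    have e1 : (fun z ↦ metricCoeff g p z j i) = fun z ↦ metricCoeff g p z i j := by
      funext z
      exact metricCoeff_symm ..
    rw [e1] at h2
    have h3 : ∑ l, metricCoeff g p y l j * christoffel g p l k i y =
        ∑ l, metricCoeff g p y j l * christoffel g p l k i y :=
      Finset.sum_congr rfl fun l _ ↦ by rw [metricCoeff_symm]
    rw [h3, h1, h2]
    ring
  have sum_rev : ∀ F : Fin n → Fin n → Fin n → ℝ,
      ∑ i, ∑ j, ∑ k, F i j k = ∑ k, ∑ j, ∑ i, F i j k := fun F ↦ by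
    rw [Finset.sum_comm]
    conv_rhs => rw [Finset.sum_comm]
    exact Finset.sum_congr rfl fun j _ ↦ Finset.sum_comm
  have hA : chartMetric g p y (chartChristoffel g p y u a) b =
      ∑ i, ∑ j, ∑ k, u k * (∑ l, metricCoeff g p y l j * christoffel g p l k i y) * a i * b j := by
    simp only [chartMetric, chartChristoffel, Finset.mul_sum, Finset.sum_mul]
    rw [Finset.sum_comm]
    conv_rhs => rw [Finset.sum_comm]
    refine Finset.sum_congr rfl fun j _ ↦ ?_
    rw [sum_rev]
    refine Finset.sum_congr rfl fun i _ ↦ Finset.sum_congr rfl fun k _ ↦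
      Finset.sum_congr rfl fun l _ ↦ ?_
    ring
  have hB : chartMetric g p y a (chartChristoffel g p y u b) =
      ∑ i, ∑ j, ∑ k, u k * (∑ l, metricCoeff g p y i l * christoffel g p l k j y) * a i * b j := by
    simp only [chartMetric, chartChristoffel, Finset.mul_sum, Finset.sum_mul]
    refine Finset.sum_congr rfl fun i _ ↦ ?_
    rw [sum_rev]
    refine Finset.sum_congr rfl fun i _ ↦ Finset.sum_congr rfl fun k _ ↦
      Finset.sum_congr rfl fun l _ ↦ ?_
    ring
  rw [hA, hB, ← Finset.sum_add_distrib]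
  refine Finset.sum_congr rfl fun i _ ↦ ?_
  rw [← Finset.sum_add_distrib]
  refine Finset.sum_congr rfl fun j _ ↦ ?_
  rw [fderiv_apply_eq_sum_pd, ← Finset.sum_add_distrib, Finset.sum_mul, Finset.sum_mul]
  refine Finset.sum_congr rfl fun k _ ↦ ?_
  rw [key]
  ring

end ChartFrames

section Transition

set_option linter.unusedSectionVars false

variable {n : ℕ} {M : Type*} [TopologicalSpace M] [ChartedSpace (Euc n) M]
  [IsManifold (𝓡 n) ∞ M]

/-! ### Transformation law of the Christoffel symbols -/

theorem chartMetric_symm (g : RMetric n M) (p : M) (y a b : Euc n) :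
    chartMetric g p y a b = chartMetric g p y b a := by
  rw [chartMetric_eq, chartMetric_eq, g.symm]

theorem chartMetric_add_left (g : RMetric n M) (p : M) (y a a' b : Euc n) :
    chartMetric g p y (a + a') b = chartMetric g p y a b + chartMetric g p y a' b := by
  simp only [chartMetric_eq, map_add, add_apply]

theorem chartMetric_sub_left (g : RMetric n M) (p : M) (y a a' b : Euc n) :
    chartMetric g p y (a - a') b = chartMetric g p y a b - chartMetric g p y a' b := by
  simp only [chartMetric_eq, map_sub, sub_apply]

/-- Metric compatibility in the form needed for the chain rule, with base point and both vectors
varying. It yields both the transition law of the Christoffel symbols and the product rule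
`dirDeriv_inner`. -/
theorem hasFDerivAt_chartMetric (g : RMetric n M) {p : M} {y : Euc n}
    (hy : y ∈ (extChartAt (𝓡 n) p).target) (a b : Euc n) :
    ∃ L : Euc n × Euc n × Euc n →L[ℝ] ℝ,
      HasFDerivAt (fun q : Euc n × Euc n × Euc n ↦ chartMetric g p q.1 q.2.1 q.2.2) L (y, a, b) ∧
      ∀ u α β, L (u, α, β) = chartMetric g p y (α + chartChristoffel g p y u a) b +
        chartMetric g p y a (β + chartChristoffel g p y u b) := by
  have h : ∀ i j, HasFDerivAt
      (fun q : Euc n × Euc n × Euc n ↦ metricCoeff g p q.1 i j * q.2.1 i * q.2.2 j) _ (y, a, b) :=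
    fun i j ↦ ((((contDiffAt_metricCoeff g hy i j).differentiableAt (by simp)).hasFDerivAt.comp
      (y, a, b) hasFDerivAt_fst).mul
      (((EuclideanSpace.proj i).hasFDerivAt (𝕜 := ℝ)).comp (y, a, b)
        (hasFDerivAt_fst.comp (y, a, b) hasFDerivAt_snd))).mul
      (((EuclideanSpace.proj j).hasFDerivAt (𝕜 := ℝ)).comp (y, a, b)
        (hasFDerivAt_snd.comp (y, a, b) hasFDerivAt_snd))
  refine ⟨_, HasFDerivAt.fun_sum fun i _ ↦ HasFDerivAt.fun_sum fun j _ ↦ h i j, fun u α β ↦ ?_⟩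
  have h2 := fderiv_metricCoeff g hy u a b
  rw [chartMetric_add_left, chartMetric_symm g p y a, chartMetric_add_left, chartMetric_symm g p y β,
    chartMetric_symm g p y _ a]
  have h3 : ∀ x y z w : ℝ, x + y + (z + w) = (y + w) + x + z := by intros; ring
  rw [h3, ← h2]
  simp only [chartMetric, sum_apply, ← Finset.sum_add_distrib]
  refine Finset.sum_congr rfl fun i _ ↦ Finset.sum_congr rfl fun j _ ↦ ?_
  simp
  ring

/-- The change of coordinates from the chart at `p` to the chart at `q`. -/
def transition (n : ℕ) {M : Type*} [TopologicalSpace M] [ChartedSpace (Euc n) M] (p q : M) :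
    Euc n → Euc n := extChartAt (𝓡 n) q ∘ (extChartAt (𝓡 n) p).symm

variable {p q x : M}

theorem extChartAt_mem_target (hp : x ∈ (chartAt (Euc n) p).source) :
    extChartAt (𝓡 n) p x ∈ (extChartAt (𝓡 n) p).target :=
  (extChartAt (𝓡 n) p).map_source (by rwa [extChartAt_source])

theorem extChartAt_symm_apply (hp : x ∈ (chartAt (Euc n) p).source) :
    (extChartAt (𝓡 n) p).symm (extChartAt (𝓡 n) p x) = x :=
  (extChartAt (𝓡 n) p).left_inv (by rwa [extChartAt_source])

theorem transition_apply (hp : x ∈ (chartAt (Euc n) p).source) :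
    transition n p q (extChartAt (𝓡 n) p x) = extChartAt (𝓡 n) q x := by
  simp only [transition, Function.comp_apply, extChartAt_symm_apply hp]

theorem contDiffAt_transition (hp : x ∈ (chartAt (Euc n) p).source)
    (hq : x ∈ (chartAt (Euc n) q).source) :
    ContDiffAt ℝ ∞ (transition n p q) (extChartAt (𝓡 n) p x) := by
  rw [← contMDiffAt_iff_contDiffAt]
  have h1 : ContMDiffAt 𝓘(ℝ, Euc n) (𝓡 n) ∞ (extChartAt (𝓡 n) p).symm (extChartAt (𝓡 n) p x) :=
    (contMDiffOn_extChartAt_symm p).contMDiffAt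
      ((isOpen_extChartAt_target p).mem_nhds (extChartAt_mem_target hp))
  refine ContMDiffAt.comp _ ?_ h1
  rw [extChartAt_symm_apply hp]
  exact contMDiffAt_extChartAt' hq

theorem fderiv_transition (hp : x ∈ (chartAt (Euc n) p).source)
    (hq : x ∈ (chartAt (Euc n) q).source) (v : TangentSpace (𝓡 n) x) :
    fderiv ℝ (transition n p q) (extChartAt (𝓡 n) p x) (chartCoord p x v) = chartCoord q x v := by
  rw [chartCoord_eq_mfderiv hp, chartCoord_eq_mfderiv hq, ← mfderiv_eq_fderiv]
  have h1 : MDifferentiableAt (𝓡 n) 𝓘(ℝ, Euc n) (extChartAt (𝓡 n) p) x :=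
    mdifferentiableAt_extChartAt hp
  have h2 : MDifferentiableAt 𝓘(ℝ, Euc n) 𝓘(ℝ, Euc n) (transition n p q)
      (extChartAt (𝓡 n) p x) :=
    ((contDiffAt_transition hp hq).differentiableAt (by simp)).mdifferentiableAt
  have h3 := mfderiv_comp x h2 h1
  have h4 : transition n p q ∘ extChartAt (𝓡 n) p =ᶠ[𝓝 x] extChartAt (𝓡 n) q := by
    filter_upwards [(chartAt (Euc n) p).open_source.mem_nhds hp] with z hz
    exact transition_apply hz
  rw [h4.mfderiv_eq] at h3
  exact (congrArg (fun L ↦ L v) h3).symm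

theorem chartMetric_chartCoord (g : RMetric n M) (hp : x ∈ (chartAt (Euc n) p).source)
    (v w : TangentSpace (𝓡 n) x) :
    chartMetric g p (extChartAt (𝓡 n) p x) (chartCoord p x v) (chartCoord p x w) =
      g.inner x v w := by
  rw [chartMetric_eq, extChartAt_symm_apply hp, chartFrame_chartCoord hp,
    chartFrame_chartCoord hp]

theorem chartMetric_transition (g : RMetric n M) (hp : x ∈ (chartAt (Euc n) p).source)
    (hq : x ∈ (chartAt (Euc n) q).source) (a b : Euc n) :
    chartMetric g q (transition n p q (extChartAt (𝓡 n) p x))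
      (fderiv ℝ (transition n p q) (extChartAt (𝓡 n) p x) a)
      (fderiv ℝ (transition n p q) (extChartAt (𝓡 n) p x) b) =
      chartMetric g p (extChartAt (𝓡 n) p x) a b := by
  conv_lhs => rw [← chartCoord_chartFrame hp a, ← chartCoord_chartFrame hp b]
  rw [fderiv_transition hp hq, fderiv_transition hp hq, transition_apply hp,
    chartMetric_chartCoord g hq, ← chartMetric_chartCoord g hp, chartCoord_chartFrame hp,
    chartCoord_chartFrame hp]

/-- The argument for uniqueness of the Levi-Civita connection. The defect `T` of the law is
symmetric in its two arguments, and differentiating the isometry relation between the charts makes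
it skew in its last argument and the vector paired with its value. A trilinear form with both
symmetries is zero. -/
theorem chartChristoffel_transition (g : RMetric n M) (hp : x ∈ (chartAt (Euc n) p).source)
    (hq : x ∈ (chartAt (Euc n) q).source) (u a : Euc n) :
    fderiv ℝ (fderiv ℝ (transition n p q)) (extChartAt (𝓡 n) p x) u a +
      chartChristoffel g q (extChartAt (𝓡 n) q x)
        (fderiv ℝ (transition n p q) (extChartAt (𝓡 n) p x) u)
        (fderiv ℝ (transition n p q) (extChartAt (𝓡 n) p x) a) =
      fderiv ℝ (transition n p q) (extChartAt (𝓡 n) p x)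
        (chartChristoffel g p (extChartAt (𝓡 n) p x) u a) := by
  set ψ := transition n p q
  set y := extChartAt (𝓡 n) p x with hy
  have hψy : extChartAt (𝓡 n) q x = ψ y := (transition_apply hp).symm
  rw [hψy]
  have hsm : ContDiffAt ℝ ∞ ψ y := contDiffAt_transition hp hq
  set T : Euc n → Euc n → Euc n := fun u a ↦ fderiv ℝ (fderiv ℝ ψ) y u a +
    chartChristoffel g q (ψ y) (fderiv ℝ ψ y u) (fderiv ℝ ψ y a) -
    fderiv ℝ ψ y (chartChristoffel g p y u a) with hT
  have hTsymm : ∀ u a, T u a = T a u := by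
    intro u a
    have := (hsm.isSymmSndFDerivAt (by
      simpa using! (WithTop.coe_le_coe.2 le_top : ((2 : ℕ∞) : ℕ∞ω) ≤ ∞))).eq u a
    simp only [hT, this, chartChristoffel_symm g q _ (fderiv ℝ ψ y u), chartChristoffel_symm g p y u]
  have hyq : ψ y ∈ (extChartAt (𝓡 n) q).target := by
    rw [← hψy]
    exact extChartAt_mem_target hq
  have hmet : ∀ a b, chartMetric g q (ψ y) (fderiv ℝ ψ y a) (fderiv ℝ ψ y b) =
      chartMetric g p y a b := chartMetric_transition g hp hq
  have hTskew : ∀ u a b, chartMetric g q (ψ y) (T u a) (fderiv ℝ ψ y b) +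
      chartMetric g q (ψ y) (T u b) (fderiv ℝ ψ y a) = 0 := by
    intro u a b
    obtain ⟨L, hL, hLe⟩ := hasFDerivAt_chartMetric g (extChartAt_mem_target hp) a b
    obtain ⟨L', hL', hLe'⟩ := hasFDerivAt_chartMetric g hyq (fderiv ℝ ψ y a) (fderiv ℝ ψ y b)
    have hd1 : HasFDerivAt ψ (fderiv ℝ ψ y) y := (hsm.differentiableAt (by simp)).hasFDerivAt
    have hd2 : HasFDerivAt (fderiv ℝ ψ) (fderiv ℝ (fderiv ℝ ψ) y) y :=
      ((hsm.fderiv_right (m := ∞) (by simp)).differentiableAt (by simp)).hasFDerivAt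
    have hda : ∀ a, HasFDerivAt (fun z ↦ fderiv ℝ ψ z a) _ y := fun a ↦
      hd2.clm_apply (hasFDerivAt_const a y)
    have c1 := HasFDerivAt.comp y (f := fun z ↦ (id z, a, b)) hL ((hasFDerivAt_id y).prodMk
      ((hasFDerivAt_const a y).prodMk (hasFDerivAt_const b y)))
    have c2 := HasFDerivAt.comp y (f := fun z ↦ (ψ z, fderiv ℝ ψ z a, fderiv ℝ ψ z b)) hL'
      (hd1.prodMk ((hda a).prodMk (hda b)))
    -- The isometry relation holds on a neighbourhood, so its two sides have the same derivative at
    -- `y`.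
    have hev : (fun q' : Euc n × Euc n × Euc n ↦ chartMetric g q q'.1 q'.2.1 q'.2.2) ∘
        (fun z ↦ (ψ z, fderiv ℝ ψ z a, fderiv ℝ ψ z b)) =ᶠ[𝓝 y]
        (fun q : Euc n × Euc n × Euc n ↦ chartMetric g p q.1 q.2.1 q.2.2) ∘
          fun z ↦ (id z, a, b) := by
      have hc : ContinuousAt (extChartAt (𝓡 n) p).symm y :=
        continuousAt_extChartAt_symm' (by rwa [extChartAt_source])
      have hnq : ∀ᶠ z in 𝓝 y, (extChartAt (𝓡 n) p).symm z ∈ (chartAt (Euc n) q).source := by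
        refine hc.eventually ((chartAt (Euc n) q).open_source.mem_nhds ?_)
        rwa [hy, extChartAt_symm_apply hp]
      filter_upwards [(isOpen_extChartAt_target p).mem_nhds (extChartAt_mem_target hp), hnq]
        with z hz hzq
      have := chartMetric_transition g (symm_mem_chart_source hz) hzq a b
      rwa [(extChartAt (𝓡 n) p).right_inv hz] at this
    have huniq := (c1.congr_of_eventuallyEq hev).unique c2
    have hu := congrArg (fun L ↦ L u) huniq
    simp only [ContinuousLinearMap.comp_apply, ContinuousLinearMap.prod_apply, hLe, hLe',
      ContinuousLinearMap.flip_apply, ContinuousLinearMap.coe_id', id_eq,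
      add_apply, zero_apply, map_zero, zero_add] at hu
    rw [← hmet, ← hmet, chartMetric_symm g q _ (fderiv ℝ ψ y a), chartMetric_symm g q _
      (fderiv ℝ ψ y a)] at hu
    simp only [hT, chartMetric_sub_left]
    linarith
  -- The cyclic permutations of the skewness relation, rewritten by symmetry, say that three numbers
  -- have pairwise zero sums.
  have hzero : ∀ u a b, chartMetric g q (ψ y) (T u a) (fderiv ℝ ψ y b) = 0 := by
    intro u a b
    have h1 := hTskew u a b
    have h2 := hTskew a b u
    have h3 := hTskew b u a
    rw [hTsymm u b] at h1
    rw [hTsymm a u] at h2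
    rw [hTsymm b a] at h3
    linarith
  have hTz : T u a = 0 := by
    have h1 := hzero u a (chartCoord p x (chartFrame q x (T u a)))
    rw [fderiv_transition hp hq, chartCoord_chartFrame hq] at h1
    rw [← chartCoord_chartFrame hq (T u a), ← hψy, chartMetric_chartCoord g hq] at h1
    have h2 : chartFrame q x (T u a) = 0 := by
      by_contra h
      exact (g.pos _ _ h).ne' h1
    rw [← chartCoord_chartFrame hq (T u a), h2, map_zero]
  exact sub_eq_zero.1 hTz

end Transition

section CurveDeriv

set_option linter.unusedSectionVars false

/-! ### Derivatives along the parameter manifold -/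

variable {N : Type*} [TopologicalSpace N] [ChartedSpace ℝ N] [IsManifold 𝓘(ℝ, ℝ) ∞ N]
  {F : Type*} [NormedAddCommGroup F] [NormedSpace ℝ F]
  {F' : Type*} [NormedAddCommGroup F'] [NormedSpace ℝ F'] {f h : N → F} {s : N}

/-- The derivative of a vector-valued function on the parameter manifold. -/
def curveDeriv (f : N → F) (s : N) (v : TangentSpace 𝓘(ℝ, ℝ) s) : F :=
  mfderiv 𝓘(ℝ, ℝ) 𝓘(ℝ, F) f s v

theorem dirDeriv_eq_curveDeriv (f : N → ℝ) (s : N) (v : TangentSpace 𝓘(ℝ, ℝ) s) :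
    dirDeriv f s v = curveDeriv f s v := rfl

theorem curveDeriv_congr (hfh : f =ᶠ[𝓝 s] h) (v : TangentSpace 𝓘(ℝ, ℝ) s) :
    curveDeriv f s v = curveDeriv h s v := by
  unfold curveDeriv
  rw [hfh.mfderiv_eq]
  rfl

theorem curveDeriv_smul_dir (f : N → F) (s : N) (c : ℝ) (v : TangentSpace 𝓘(ℝ, ℝ) s) :
    curveDeriv f s (c • v) = c • curveDeriv f s v :=
  map_smul (mfderiv 𝓘(ℝ, ℝ) 𝓘(ℝ, F) f s) c v

theorem curveDeriv_const (c : F) (s : N) (v : TangentSpace 𝓘(ℝ, ℝ) s) :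
    curveDeriv (fun _ : N ↦ c) s v = 0 := by
  unfold curveDeriv
  rw [mfderiv_const]
  rfl

theorem curveDeriv_comp {L : F → F'} {L' : F →L[ℝ] F'} (hL : HasFDerivAt L L' (f s))
    (hf : MDifferentiableAt 𝓘(ℝ, ℝ) 𝓘(ℝ, F) f s) (v : TangentSpace 𝓘(ℝ, ℝ) s) :
    curveDeriv (fun s' ↦ L (f s')) s v = L' (curveDeriv f s v) := by
  have h1 := (hL.hasMFDerivAt.comp s hf.hasMFDerivAt).mfderiv
  exact congrArg (fun A ↦ A v) h1

theorem hasMFDerivAt_prodMk_space {k : N → F'} (hf : MDifferentiableAt 𝓘(ℝ, ℝ) 𝓘(ℝ, F) f s)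
    (hk : MDifferentiableAt 𝓘(ℝ, ℝ) 𝓘(ℝ, F') k s) :
    HasMFDerivAt 𝓘(ℝ, ℝ) 𝓘(ℝ, F × F') (fun s' ↦ (f s', k s')) s
      (ContinuousLinearMap.prod (M₂ := F) (M₃ := F') (mfderiv 𝓘(ℝ, ℝ) 𝓘(ℝ, F) f s)
        (mfderiv 𝓘(ℝ, ℝ) 𝓘(ℝ, F') k s)) :=
  ⟨hf.hasMFDerivAt.1.prodMk hk.hasMFDerivAt.1, hf.hasMFDerivAt.2.prodMk hk.hasMFDerivAt.2⟩

theorem curveDeriv_prodMk {k : N → F'} (hf : MDifferentiableAt 𝓘(ℝ, ℝ) 𝓘(ℝ, F) f s)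
    (hk : MDifferentiableAt 𝓘(ℝ, ℝ) 𝓘(ℝ, F') k s) (v : TangentSpace 𝓘(ℝ, ℝ) s) :
    curveDeriv (fun s' ↦ (f s', k s')) s v = (curveDeriv f s v, curveDeriv k s v) := by
  have h1 := (hasMFDerivAt_prodMk_space hf hk).mfderiv
  exact congrArg (fun A ↦ A v) h1

theorem curveDeriv_add (hf : MDifferentiableAt 𝓘(ℝ, ℝ) 𝓘(ℝ, F) f s)
    (hh : MDifferentiableAt 𝓘(ℝ, ℝ) 𝓘(ℝ, F) h s) (v : TangentSpace 𝓘(ℝ, ℝ) s) :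
    curveDeriv (fun s' ↦ f s' + h s') s v = curveDeriv f s v + curveDeriv h s v := by
  have h1 := (hf.hasMFDerivAt.add hh.hasMFDerivAt).mfderiv
  exact congrArg (fun A ↦ A v) h1

theorem curveDeriv_smul {r : N → ℝ} (hr : MDifferentiableAt 𝓘(ℝ, ℝ) 𝓘(ℝ, ℝ) r s)
    (hf : MDifferentiableAt 𝓘(ℝ, ℝ) 𝓘(ℝ, F) f s) (v : TangentSpace 𝓘(ℝ, ℝ) s) :
    curveDeriv (fun s' ↦ r s' • f s') s v = curveDeriv r s v • f s + r s • curveDeriv f s v := by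
  have h1 := curveDeriv_comp (f := fun s' ↦ (r s', f s')) (L := fun q : ℝ × F ↦ q.1 • q.2)
    (hasFDerivAt_fst.smul hasFDerivAt_snd) (hasMFDerivAt_prodMk_space hr hf).mdifferentiableAt v
  rw [h1, curveDeriv_prodMk hr hf]
  simp [add_comm]

/-- In one fixed chart of the parameter manifold, the derivative is the smooth component of `e`
times an ordinary derivative of the smooth coordinate expression of `f`. -/
theorem contMDiffAt_curveDeriv {e : ∀ s : N, TangentSpace 𝓘(ℝ, ℝ) s}
    (he : ContMDiff 𝓘(ℝ, ℝ) 𝓘(ℝ, ℝ).tangent ∞ fun s ↦ (⟨s, e s⟩ : TangentBundle 𝓘(ℝ, ℝ) N))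
    (hf : ContMDiffAt 𝓘(ℝ, ℝ) 𝓘(ℝ, F) ∞ f s) :
    ContMDiffAt 𝓘(ℝ, ℝ) 𝓘(ℝ, F) ∞ (fun s' ↦ curveDeriv f s' (e s')) s := by
  set φ := extChartAt 𝓘(ℝ, ℝ) s
  have hsymm : ContMDiffAt 𝓘(ℝ, ℝ) 𝓘(ℝ, ℝ) ∞ φ.symm (φ s) :=
    (contMDiffOn_extChartAt_symm s).contMDiffAt (extChartAt_target_mem_nhds s)
  have hφs : φ.symm (φ s) = s := extChartAt_to_inv s
  have hft : ContDiffAt ℝ ∞ (f ∘ φ.symm) (φ s) := by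
    rw [← contMDiffAt_iff_contDiffAt]
    refine ContMDiffAt.comp _ ?_ hsymm
    rwa [hφs]
  have hφ : ContMDiffAt 𝓘(ℝ, ℝ) 𝓘(ℝ, ℝ) ∞ φ s := contMDiffAt_extChartAt
  set ε : N → ℝ := fun s' ↦ mfderiv 𝓘(ℝ, ℝ) 𝓘(ℝ, ℝ) φ s' (e s')
  have hnhd : ∀ᶠ s' in 𝓝 s, s' ∈ (chartAt ℝ s).source :=
    (chartAt ℝ s).open_source.mem_nhds (mem_chart_source ℝ s)
  have hε : ContMDiffAt 𝓘(ℝ, ℝ) 𝓘(ℝ, ℝ) ∞ ε s := by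
    have h1 := (Bundle.contMDiffAt_totalSpace.1 (he.contMDiffAt (x := s))).2
    refine h1.congr_of_eventuallyEq ?_
    filter_upwards [hnhd] with s' hs'
    refine Eq.trans (congrArg (fun A ↦ A (e s'))
      (TangentBundle.continuousLinearMapAt_trivializationAt hs')).symm ?_
    change (trivializationAt ℝ (TangentSpace 𝓘(ℝ, ℝ)) s).continuousLinearMapAt ℝ s' (e s') = _
    rw [Bundle.Trivialization.continuousLinearMapAt_apply,
      Bundle.Trivialization.linearMapAt_apply, if_pos]
    simpa using hs'
  have hd : ContDiffAt ℝ ∞ (fun t ↦ fderiv ℝ (f ∘ φ.symm) t 1) (φ s) :=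
    (hft.fderiv_right (m := ∞) (by simp)).clm_apply contDiffAt_const
  have hd' : ContMDiffAt 𝓘(ℝ, ℝ) 𝓘(ℝ, F) ∞ (fun s' ↦ fderiv ℝ (f ∘ φ.symm) (φ s') 1) s :=
    ContMDiffAt.comp (g := fun t ↦ fderiv ℝ (f ∘ φ.symm) t 1) s hd.contMDiffAt hφ
  refine (hε.smul hd').congr_of_eventuallyEq ?_
  have hev : ∀ᶠ s' in 𝓝 s, ContMDiffAt 𝓘(ℝ, ℝ) 𝓘(ℝ, F) 1 f s' :=
    (contMDiffAt_iff_contMDiffAt_nhds (by simp)).1 (hf.of_le (mod_cast le_top))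
  filter_upwards [hnhd, hev] with s' hs' hfs'
  have hs'φ : s' ∈ φ.source := by rwa [extChartAt_source]
  have h1 : MDifferentiableAt 𝓘(ℝ, ℝ) 𝓘(ℝ, ℝ) φ s' := mdifferentiableAt_extChartAt hs'
  have h3 : φ.symm (φ s') = s' := φ.left_inv hs'φ
  have h2 : MDifferentiableAt 𝓘(ℝ, ℝ) 𝓘(ℝ, F) (f ∘ φ.symm) (φ s') := by
    have h4 : ContMDiffAt 𝓘(ℝ, ℝ) 𝓘(ℝ, ℝ) ∞ φ.symm (φ s') :=
      (contMDiffOn_extChartAt_symm s).contMDiffAt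
        ((isOpen_extChartAt_target s).mem_nhds (φ.map_source hs'φ))
    refine MDifferentiableAt.comp _ ?_ (h4.mdifferentiableAt (by simp))
    rw [h3]
    exact hfs'.mdifferentiableAt (by simp)
  have h5 := mfderiv_comp s' h2 h1
  have h6 : (f ∘ φ.symm) ∘ φ =ᶠ[𝓝 s'] f := by
    filter_upwards [(isOpen_extChartAt_source s).mem_nhds hs'φ] with z hz
    simp only [Function.comp_apply]
    rw [φ.left_inv hz]
  rw [h6.mfderiv_eq, mfderiv_eq_fderiv] at h5
  have h7 : curveDeriv f s' (e s') = fderiv ℝ (f ∘ φ.symm) (φ s') (ε s') :=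
    congrArg (fun A ↦ A (e s')) h5
  rw [h7, ← mul_one (ε s'), ← smul_eq_mul, map_smul]
  simp

end CurveDeriv

section FieldsAlong

set_option linter.unusedSectionVars false

/-! ### Vector fields along a curve -/

variable {n : ℕ} {M : Type*} [TopologicalSpace M] [ChartedSpace (Euc n) M]
  [IsManifold (𝓡 n) ∞ M]
  {N : Type*} [TopologicalSpace N] [ChartedSpace ℝ N] [IsManifold 𝓘(ℝ, ℝ) ∞ N]
  {γ : N → M} {μ ν : ∀ s, TangentSpace (𝓡 n) (γ s)} {s : N} {p : M}

theorem eventually_mem_chart_source (hγ : ContMDiff 𝓘(ℝ, ℝ) (𝓡 n) ∞ γ)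
    (hp : γ s ∈ (chartAt (Euc n) p).source) :
    ∀ᶠ s' in 𝓝 s, γ s' ∈ (chartAt (Euc n) p).source :=
  hγ.continuous.continuousAt.eventually ((chartAt (Euc n) p).open_source.mem_nhds hp)

/-- Any chart around the point may be used, which reduces fields along the curve to functions with
values in `ℝⁿ`. -/
theorem smoothFieldAt_iff (hγ : ContMDiff 𝓘(ℝ, ℝ) (𝓡 n) ∞ γ)
    (hp : γ s ∈ (chartAt (Euc n) p).source) :
    SmoothFieldAt γ μ s ↔
      ContMDiffAt 𝓘(ℝ, ℝ) 𝓘(ℝ, Euc n) ∞ (fun s' ↦ chartCoord p (γ s') (μ s')) s := by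
  unfold SmoothFieldAt
  rw [(trivializationAt (Euc n) (TangentSpace (𝓡 n)) p).contMDiffAt_iff
      (by rw [Bundle.Trivialization.mem_source]; simpa using hp)]
  refine (and_iff_right hγ.contMDiffAt).trans (Filter.EventuallyEq.contMDiffAt_iff ?_)
  filter_upwards [eventually_mem_chart_source hγ hp] with s' hs'
  rw [chartCoord, Bundle.Trivialization.continuousLinearMapAt_apply,
      Bundle.Trivialization.linearMapAt_apply, if_pos]
  simpa using hs'

theorem SmoothFieldAt.add (hγ : ContMDiff 𝓘(ℝ, ℝ) (𝓡 n) ∞ γ) (hμ : SmoothFieldAt γ μ s)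
    (hν : SmoothFieldAt γ ν s) : SmoothFieldAt γ (fun s ↦ μ s + ν s) s := by
  rw [smoothFieldAt_iff hγ (mem_chart_source _ _)] at *
  simp only [map_add]
  exact hμ.add hν

theorem SmoothFieldAt.smul (hγ : ContMDiff 𝓘(ℝ, ℝ) (𝓡 n) ∞ γ) {r : N → ℝ}
    (hr : ContMDiffAt 𝓘(ℝ, ℝ) 𝓘(ℝ, ℝ) ∞ r s) (hμ : SmoothFieldAt γ μ s) :
    SmoothFieldAt γ (fun s ↦ r s • μ s) s := by
  rw [smoothFieldAt_iff hγ (mem_chart_source _ _)] at *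
  simp only [map_smul]
  exact hr.smul hμ

theorem smoothFieldAt_zero (hγ : ContMDiff 𝓘(ℝ, ℝ) (𝓡 n) ∞ γ) (s : N) :
    SmoothFieldAt (n := n) γ (fun _ ↦ 0) s := by
  rw [smoothFieldAt_iff hγ (mem_chart_source _ _)]
  simpa only [map_zero] using contMDiffAt_const

theorem smoothFieldAt_chartFrame (hγ : ContMDiff 𝓘(ℝ, ℝ) (𝓡 n) ∞ γ)
    (hp : γ s ∈ (chartAt (Euc n) p).source) (v : Euc n) :
    SmoothFieldAt γ (fun s' ↦ chartFrame p (γ s') v) s := by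
  rw [smoothFieldAt_iff hγ hp]
  refine contMDiffAt_const (c := v) |>.congr_of_eventuallyEq ?_
  filter_upwards [eventually_mem_chart_source hγ hp] with s' hs'
  exact chartCoord_chartFrame hs' v

theorem SmoothFieldAt.inner (g : RMetric n M) (hμ : SmoothFieldAt γ μ s)
    (hν : SmoothFieldAt γ ν s) :
    ContMDiffAt 𝓘(ℝ, ℝ) 𝓘(ℝ, ℝ) ∞ (fun s ↦ g.inner (γ s) (μ s) (ν s)) s :=
  contMDiffAt_inner g hμ hν

theorem SmoothFieldAt.mdifferentiableAt (hγ : ContMDiff 𝓘(ℝ, ℝ) (𝓡 n) ∞ γ)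
    (hμ : SmoothFieldAt γ μ s) (hp : γ s ∈ (chartAt (Euc n) p).source) :
    MDifferentiableAt 𝓘(ℝ, ℝ) 𝓘(ℝ, Euc n) (fun s' ↦ chartCoord p (γ s') (μ s')) s :=
  ((smoothFieldAt_iff hγ hp).1 hμ).mdifferentiableAt (by simp)

theorem contMDiffAt_extChartAt_comp (hγ : ContMDiff 𝓘(ℝ, ℝ) (𝓡 n) ∞ γ)
    (hp : γ s ∈ (chartAt (Euc n) p).source) :
    ContMDiffAt 𝓘(ℝ, ℝ) 𝓘(ℝ, Euc n) ∞ (fun s' ↦ extChartAt (𝓡 n) p (γ s')) s :=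
  ContMDiffAt.comp s (contMDiffAt_extChartAt' hp) hγ.contMDiffAt

theorem chartCoord_velocity (hγ : ContMDiff 𝓘(ℝ, ℝ) (𝓡 n) ∞ γ)
    (hp : γ s ∈ (chartAt (Euc n) p).source) (v : TangentSpace 𝓘(ℝ, ℝ) s) :
    chartCoord p (γ s) (velocity γ s v) =
      curveDeriv (fun s' ↦ extChartAt (𝓡 n) p (γ s')) s v := by
  rw [chartCoord_eq_mfderiv hp]
  have h1 : MDifferentiableAt (𝓡 n) 𝓘(ℝ, Euc n) (extChartAt (𝓡 n) p) (γ s) :=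
    mdifferentiableAt_extChartAt hp
  have h2 := mfderiv_comp s h1 (hγ.mdifferentiableAt (by simp) : MDifferentiableAt _ _ γ s)
  exact (congrArg (fun A ↦ A v) h2).symm

theorem smoothFieldAt_velocity (hγ : ContMDiff 𝓘(ℝ, ℝ) (𝓡 n) ∞ γ)
    {e : ∀ s : N, TangentSpace 𝓘(ℝ, ℝ) s}
    (he : ContMDiff 𝓘(ℝ, ℝ) 𝓘(ℝ, ℝ).tangent ∞ fun s ↦ (⟨s, e s⟩ : TangentBundle 𝓘(ℝ, ℝ) N))
    (s : N) : SmoothFieldAt (n := n) γ (fun s ↦ velocity γ s (e s)) s := by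
  have hp := mem_chart_source (Euc n) (γ s)
  rw [smoothFieldAt_iff hγ hp]
  refine (contMDiffAt_curveDeriv he (contMDiffAt_extChartAt_comp hγ hp)).congr_of_eventuallyEq ?_
  filter_upwards [eventually_mem_chart_source hγ hp] with s' hs'
  exact chartCoord_velocity hγ hs' _

/-- The components in the chart at `p` of the Levi-Civita derivative along `γ`. -/
def chartCov (g : RMetric n M) (γ : N → M) (p : M) (μ : ∀ s, TangentSpace (𝓡 n) (γ s)) (s : N)
    (v : TangentSpace 𝓘(ℝ, ℝ) s) : Euc n :=
  curveDeriv (fun s' ↦ chartCoord p (γ s') (μ s')) s v +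
    chartChristoffel g p (extChartAt (𝓡 n) p (γ s)) (chartCoord p (γ s) (velocity γ s v))
      (chartCoord p (γ s) (μ s))

theorem covDeriv_eq_chartFrame (g : RMetric n M) (hγ : ContMDiff 𝓘(ℝ, ℝ) (𝓡 n) ∞ γ)
    (hμ : SmoothFieldAt γ μ s) (v : TangentSpace 𝓘(ℝ, ℝ) s) :
    covDeriv g γ μ s v = chartFrame (γ s) (γ s) (chartCov g γ (γ s) μ s v) := by
  unfold covDeriv
  congr 1
  ext k
  have hd := hμ.mdifferentiableAt hγ (mem_chart_source (Euc n) (γ s))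
  have h1 := curveDeriv_comp ((EuclideanSpace.proj k).hasFDerivAt (𝕜 := ℝ)) hd v
  simp only [chartCov, chartChristoffel, PiLp.add_apply]
  congr 1

/-- The chain rule for the change of chart produces a second-derivative term that the transition law
of the Christoffel symbols absorbs. Hence `covDeriv`, defined in a chart that moves with the point,
can be computed in a fixed chart. -/
theorem chartCoord_covDeriv (g : RMetric n M) (hγ : ContMDiff 𝓘(ℝ, ℝ) (𝓡 n) ∞ γ)
    (hμ : SmoothFieldAt γ μ s) (hp : γ s ∈ (chartAt (Euc n) p).source)
    (v : TangentSpace 𝓘(ℝ, ℝ) s) :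
    chartCoord p (γ s) (covDeriv g γ μ s v) = chartCov g γ p μ s v := by
  have hs := mem_chart_source (Euc n) (γ s)
  rw [covDeriv_eq_chartFrame g hγ hμ, ← fderiv_transition hs hp, chartCoord_chartFrame hs]
  unfold chartCov
  set ψ := transition n (γ s) p
  have hsm : ContDiffAt ℝ ∞ ψ (extChartAt (𝓡 n) (γ s) (γ s)) := contDiffAt_transition hs hp
  have hd2 : HasFDerivAt (fderiv ℝ ψ) _ (extChartAt (𝓡 n) (γ s) (γ s)) :=
    ((hsm.fderiv_right (m := ∞) (by simp)).differentiableAt (by simp)).hasFDerivAt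
  have hL : HasFDerivAt (fun q : Euc n × Euc n ↦ fderiv ℝ ψ q.1 q.2) _
      (extChartAt (𝓡 n) (γ s) (γ s), chartCoord (γ s) (γ s) (μ s)) :=
    (HasFDerivAt.comp (extChartAt (𝓡 n) (γ s) (γ s), chartCoord (γ s) (γ s) (μ s))
      hd2 hasFDerivAt_fst).clm_apply hasFDerivAt_snd
  have h1 : MDifferentiableAt 𝓘(ℝ, ℝ) 𝓘(ℝ, Euc n) (fun s' ↦ extChartAt (𝓡 n) (γ s) (γ s')) s :=
    (contMDiffAt_extChartAt_comp hγ hs).mdifferentiableAt (by simp)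
  have h2 := hμ.mdifferentiableAt hγ hs
  have h3 := curveDeriv_comp
    (f := fun s' ↦ (extChartAt (𝓡 n) (γ s) (γ s'), chartCoord (γ s) (γ s') (μ s')))
    hL (hasMFDerivAt_prodMk_space h1 h2).mdifferentiableAt v
  rw [curveDeriv_prodMk h1 h2, ← chartCoord_velocity hγ hs] at h3
  have h4 : (fun s' ↦ chartCoord p (γ s') (μ s')) =ᶠ[𝓝 s]
      fun s' ↦ fderiv ℝ ψ (extChartAt (𝓡 n) (γ s) (γ s')) (chartCoord (γ s) (γ s') (μ s')) := by
    filter_upwards [eventually_mem_chart_source hγ hs, eventually_mem_chart_source hγ hp]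
      with s' hs' hs''
    exact (fderiv_transition hs' hs'' (μ s')).symm
  rw [curveDeriv_congr h4, h3, map_add, ← chartChristoffel_transition g hs hp,
    fderiv_transition hs hp, fderiv_transition hs hp]
  simp
  abel

/-- Needed to differentiate the acceleration; near `s` everything is written in the chart at `γ s`.
-/
theorem smoothFieldAt_covDeriv (g : RMetric n M) (hγ : ContMDiff 𝓘(ℝ, ℝ) (𝓡 n) ∞ γ)
    {e : ∀ s : N, TangentSpace 𝓘(ℝ, ℝ) s}
    (he : ContMDiff 𝓘(ℝ, ℝ) 𝓘(ℝ, ℝ).tangent ∞ fun s ↦ (⟨s, e s⟩ : TangentBundle 𝓘(ℝ, ℝ) N))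
    (hμ : ∀ s, SmoothFieldAt γ μ s) (s : N) :
    SmoothFieldAt γ (fun s ↦ covDeriv g γ μ s (e s)) s := by
  have hs := mem_chart_source (Euc n) (γ s)
  rw [smoothFieldAt_iff hγ hs]
  have h1 := (smoothFieldAt_iff hγ hs).1 (hμ s)
  have h2 := (smoothFieldAt_iff hγ hs).1 (smoothFieldAt_velocity hγ he s)
  have h3 := contMDiffAt_extChartAt_comp hγ hs
  have hco : ∀ {f : N → Euc n}, ContMDiffAt 𝓘(ℝ, ℝ) 𝓘(ℝ, Euc n) ∞ f s → ∀ k,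
      ContMDiffAt 𝓘(ℝ, ℝ) 𝓘(ℝ, ℝ) ∞ (fun s' ↦ f s' k) s := fun hf k ↦
    ((EuclideanSpace.proj k : Euc n →L[ℝ] ℝ).contMDiff.contMDiffAt).comp s hf
  have h4 : ContMDiffAt 𝓘(ℝ, ℝ) 𝓘(ℝ, Euc n) ∞ (fun s' ↦
      chartChristoffel g (γ s) (extChartAt (𝓡 n) (γ s) (γ s'))
        (chartCoord (γ s) (γ s') (velocity γ s' (e s'))) (chartCoord (γ s) (γ s') (μ s'))) s := by
    have h5 : ∀ k, ContMDiffAt 𝓘(ℝ, ℝ) 𝓘(ℝ, ℝ) ∞ (fun s' ↦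
      (chartChristoffel g (γ s) (extChartAt (𝓡 n) (γ s) (γ s'))
        (chartCoord (γ s) (γ s') (velocity γ s' (e s'))) (chartCoord (γ s) (γ s') (μ s'))) k)
        s := by
      intro k
      simp only [chartChristoffel]
      refine contMDiffAt_finsetSum fun i _ ↦ ?_
      refine contMDiffAt_finsetSum fun j _ ↦ ?_
      refine ContMDiffAt.mul (ContMDiffAt.mul ?_ (hco h2 i)) (hco h1 j)
      exact ContMDiffAt.comp (g := christoffel g (γ s) k i j) s (contDiffAt_christoffel g
        (extChartAt_mem_target hs) k i j).contMDiffAt h3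
    have h6 : ContMDiffAt 𝓘(ℝ, ℝ) 𝓘(ℝ, Fin n → ℝ) ∞ (fun s' ↦
      WithLp.ofLp (chartChristoffel g (γ s) (extChartAt (𝓡 n) (γ s) (γ s'))
        (chartCoord (γ s) (γ s') (velocity γ s' (e s'))) (chartCoord (γ s) (γ s') (μ s')))) s :=
      contMDiffAt_pi_space.2 h5
    have h7 : ContMDiff 𝓘(ℝ, Fin n → ℝ) 𝓘(ℝ, Euc n) ∞ (fun v ↦ (WithLp.toLp 2 v : Euc n)) :=
      ((EuclideanSpace.equiv (Fin n) ℝ).symm : (Fin n → ℝ) →L[ℝ] Euc n).contMDiff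
    exact h7.contMDiffAt.comp s h6
  refine ((contMDiffAt_curveDeriv he h1).add h4).congr_of_eventuallyEq ?_
  filter_upwards [eventually_mem_chart_source hγ hs] with s' hs'
  exact chartCoord_covDeriv g hγ (hμ s') hs' (e s')

end FieldsAlong

section Connection

set_option linter.unusedSectionVars false

/-! ### The Levi-Civita and tractor connections along a curve -/

variable {n : ℕ} {M : Type*} [TopologicalSpace M] [ChartedSpace (Euc n) M]
  [IsManifold (𝓡 n) ∞ M]
  {N : Type*} [TopologicalSpace N] [ChartedSpace ℝ N] [IsManifold 𝓘(ℝ, ℝ) ∞ N]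
  {γ : N → M} {μ ν : ∀ s, TangentSpace (𝓡 n) (γ s)} {s : N} {r : N → ℝ}

theorem velocity_smul (γ : N → M) (s : N) (c : ℝ) (v : TangentSpace 𝓘(ℝ, ℝ) s) :
    (velocity γ s (c • v) : TangentSpace (𝓡 n) (γ s)) = c • velocity γ s v :=
  map_smul (mfderiv 𝓘(ℝ, ℝ) (𝓡 n) γ s) c v

theorem dirDeriv_smul_dir (f : N → ℝ) (s : N) (c : ℝ) (v : TangentSpace 𝓘(ℝ, ℝ) s) :
    dirDeriv f s (c • v) = c * dirDeriv f s v :=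
  curveDeriv_smul_dir f s c v

theorem covDeriv_add (g : RMetric n M) (hγ : ContMDiff 𝓘(ℝ, ℝ) (𝓡 n) ∞ γ)
    (hμ : SmoothFieldAt γ μ s) (hν : SmoothFieldAt γ ν s) (v : TangentSpace 𝓘(ℝ, ℝ) s) :
    covDeriv g γ (fun s ↦ μ s + ν s) s v = covDeriv g γ μ s v + covDeriv g γ ν s v := by
  have hs := mem_chart_source (Euc n) (γ s)
  rw [covDeriv_eq_chartFrame g hγ (hμ.add hγ hν), covDeriv_eq_chartFrame g hγ hμ,
    covDeriv_eq_chartFrame g hγ hν, ← map_add]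
  congr 1
  simp only [chartCov, map_add, chartChristoffel_add_right]
  rw [curveDeriv_add (hμ.mdifferentiableAt hγ hs) (hν.mdifferentiableAt hγ hs)]
  abel

theorem covDeriv_smul (g : RMetric n M) (hγ : ContMDiff 𝓘(ℝ, ℝ) (𝓡 n) ∞ γ)
    (hr : ContMDiffAt 𝓘(ℝ, ℝ) 𝓘(ℝ, ℝ) ∞ r s) (hμ : SmoothFieldAt γ μ s)
    (v : TangentSpace 𝓘(ℝ, ℝ) s) :
    covDeriv g γ (fun s ↦ r s • μ s) s v = dirDeriv r s v • μ s + r s • covDeriv g γ μ s v := by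
  have hs := mem_chart_source (Euc n) (γ s)
  have h : dirDeriv r s v • μ s + r s • chartFrame (γ s) (γ s) (chartCov g γ (γ s) μ s v) =
      chartFrame (γ s) (γ s) (dirDeriv r s v • chartCoord (γ s) (γ s) (μ s) +
        r s • chartCov g γ (γ s) μ s v) := by
    rw [map_add, map_smul, map_smul, chartFrame_chartCoord hs]
  rw [covDeriv_eq_chartFrame g hγ (hμ.smul hγ hr), covDeriv_eq_chartFrame g hγ hμ, h]
  congr 1
  simp only [chartCov, map_smul, chartChristoffel_smul_right]
  rw [curveDeriv_smul (hr.mdifferentiableAt (by simp)) (hμ.mdifferentiableAt hγ hs),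
    smul_add, add_assoc]
  rfl

theorem covDeriv_smul_dir (g : RMetric n M) (γ : N → M) (μ : ∀ s, TangentSpace (𝓡 n) (γ s))
    (s : N) (c : ℝ) (v : TangentSpace 𝓘(ℝ, ℝ) s) :
    covDeriv g γ μ s (c • v) = c • covDeriv g γ μ s v := by
  unfold covDeriv
  rw [← map_smul]
  congr 1
  ext k
  simp only [dirDeriv_smul_dir, velocity_smul, map_smul, PiLp.smul_apply, smul_eq_mul, mul_add,
    Finset.mul_sum]
  congr 1
  refine Finset.sum_congr rfl fun i _ ↦ Finset.sum_congr rfl fun j _ ↦ ?_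
  ring

theorem covDeriv_congr (g : RMetric n M) (h : ∀ᶠ s' in 𝓝 s, μ s' = ν s')
    (v : TangentSpace 𝓘(ℝ, ℝ) s) : covDeriv g γ μ s v = covDeriv g γ ν s v := by
  unfold covDeriv
  congr 1
  ext k
  simp only [h.self_of_nhds]
  congr 1
  refine curveDeriv_congr ?_ v
  filter_upwards [h] with s' hs'
  rw [hs']

theorem covDeriv_zero (g : RMetric n M) (hγ : ContMDiff 𝓘(ℝ, ℝ) (𝓡 n) ∞ γ)
    (s : N) (v : TangentSpace 𝓘(ℝ, ℝ) s) : covDeriv g γ (fun _ ↦ 0) s v = 0 := by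
  have h := covDeriv_add g hγ (smoothFieldAt_zero hγ s) (smoothFieldAt_zero hγ s) v
  simpa using h

/-- The Levi-Civita connection preserves the metric. -/
theorem dirDeriv_inner (g : RMetric n M) (hγ : ContMDiff 𝓘(ℝ, ℝ) (𝓡 n) ∞ γ)
    (hμ : SmoothFieldAt γ μ s) (hν : SmoothFieldAt γ ν s) (v : TangentSpace 𝓘(ℝ, ℝ) s) :
    dirDeriv (fun s ↦ g.inner (γ s) (μ s) (ν s)) s v =
      g.inner (γ s) (covDeriv g γ μ s v) (ν s) + g.inner (γ s) (μ s) (covDeriv g γ ν s v) := by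
  have hs := mem_chart_source (Euc n) (γ s)
  have hy := contMDiffAt_extChartAt_comp hγ hs |>.mdifferentiableAt (by simp)
  have hdμ := hμ.mdifferentiableAt hγ hs
  have hdν := hν.mdifferentiableAt hγ hs
  have h1 : (fun s ↦ g.inner (γ s) (μ s) (ν s)) =ᶠ[𝓝 s] fun s' ↦
      chartMetric g (γ s) (extChartAt (𝓡 n) (γ s) (γ s')) (chartCoord (γ s) (γ s') (μ s'))
        (chartCoord (γ s) (γ s') (ν s')) := by
    filter_upwards [eventually_mem_chart_source hγ hs] with s' hs'
    exact (chartMetric_chartCoord g hs' _ _).symm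
  obtain ⟨L, hL, hLe⟩ := hasFDerivAt_chartMetric g (extChartAt_mem_target hs)
    (chartCoord (γ s) (γ s) (μ s)) (chartCoord (γ s) (γ s) (ν s))
  have h2 := (hasMFDerivAt_prodMk_space hdμ hdν).mdifferentiableAt
  have h3 := curveDeriv_comp (f := fun s' ↦ (extChartAt (𝓡 n) (γ s) (γ s'),
    chartCoord (γ s) (γ s') (μ s'), chartCoord (γ s) (γ s') (ν s'))) hL
    (hasMFDerivAt_prodMk_space hy h2).mdifferentiableAt v
  rw [dirDeriv_eq_curveDeriv, curveDeriv_congr h1, h3, curveDeriv_prodMk hy h2,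
    curveDeriv_prodMk hdμ hdν, hLe, ← chartMetric_chartCoord g hs, ← chartMetric_chartCoord g hs,
    chartCoord_covDeriv g hγ hμ hs, chartCoord_covDeriv g hγ hν hs, chartCov, chartCov,
    chartCoord_velocity hγ hs]

/-! ### The Schouten tensor as a form and as an operator -/

theorem schouten_add_right (g : RMetric n M) (x : M) (v w w' : TangentSpace (𝓡 n) x) :
    schouten g x v (w + w') = schouten g x v w + schouten g x v w' := by
  simp [schouten, mul_add, Finset.sum_add_distrib]

theorem schouten_smul_right (g : RMetric n M) (x : M) (c : ℝ) (v w : TangentSpace (𝓡 n) x) :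
    schouten g x v (c • w) = c * schouten g x v w := by
  simp only [schouten, map_smul, PiLp.smul_apply, smul_eq_mul, Finset.mul_sum]
  refine Finset.sum_congr rfl fun i _ ↦ Finset.sum_congr rfl fun j _ ↦ ?_
  ring

theorem schouten_smul_left (g : RMetric n M) (x : M) (c : ℝ) (v w : TangentSpace (𝓡 n) x) :
    schouten g x (c • v) w = c * schouten g x v w := by
  simp only [schouten, map_smul, PiLp.smul_apply, smul_eq_mul, Finset.mul_sum]
  refine Finset.sum_congr rfl fun i _ ↦ Finset.sum_congr rfl fun j _ ↦ ?_
  ring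

theorem schouten_zero_right (g : RMetric n M) (x : M) (v : TangentSpace (𝓡 n) x) :
    schouten g x v 0 = 0 := by
  simp [schouten]

theorem schoutenSharp_smul (g : RMetric n M) (x : M) (c : ℝ) (v : TangentSpace (𝓡 n) x) :
    schoutenSharp g x (c • v) = c • schoutenSharp g x v := by
  unfold schoutenSharp
  rw [← map_smul]
  congr 1
  ext k
  simp only [map_smul, PiLp.smul_apply, smul_eq_mul, Finset.mul_sum]
  refine Finset.sum_congr rfl fun i _ ↦ Finset.sum_congr rfl fun j _ ↦ ?_
  ring

/-- Raising an index with the inverse metric and lowering it again is the identity. -/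
theorem inner_schoutenSharp (g : RMetric n M) (x : M) (v w : TangentSpace (𝓡 n) x) :
    g.inner x (schoutenSharp g x v) w = schouten g x v w := by
  have hx := mem_chart_source (Euc n) x
  have hy := extChartAt_mem_target (n := n) hx
  rw [← chartMetric_chartCoord g hx, schoutenSharp, chartCoord_chartFrame hx]
  set y := extChartAt (𝓡 n) x x
  set a := chartCoord x x v
  set b := chartCoord x x w
  have h1 : ∀ c j, ∑ i, (metricCoeff g x y)⁻¹ c i * metricCoeff g x y i j =
      (1 : Matrix (Fin n) (Fin n) ℝ) c j := fun c j ↦ by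
    rw [← Matrix.nonsing_inv_mul _ (isUnit_det_metricCoeff g hy), Matrix.mul_apply]
  have h2 : ∀ j, ∑ i, metricCoeff g x y i j *
      (∑ k, ∑ c, a k * schoutenCoeff g x y k c * (metricCoeff g x y)⁻¹ c i) =
      ∑ k, a k * schoutenCoeff g x y k j := by
    intro j
    simp only [Finset.mul_sum]
    rw [Finset.sum_comm]
    refine Finset.sum_congr rfl fun k _ ↦ ?_
    rw [Finset.sum_comm]
    have : ∀ c, ∑ i, metricCoeff g x y i j *
        (a k * schoutenCoeff g x y k c * (metricCoeff g x y)⁻¹ c i) =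
        a k * schoutenCoeff g x y k c * (1 : Matrix (Fin n) (Fin n) ℝ) c j := by
      intro c
      rw [← h1, Finset.mul_sum]
      exact Finset.sum_congr rfl fun i _ ↦ by ring
    simp only [this, Matrix.one_apply, mul_ite, mul_one, mul_zero, Finset.sum_ite_eq',
      Finset.mem_univ, if_true]
  unfold chartMetric schouten
  rw [Finset.sum_comm]
  conv_rhs => rw [Finset.sum_comm]
  refine Finset.sum_congr rfl fun j _ ↦ ?_
  rw [← Finset.sum_mul, h2, Finset.sum_mul]
  exact Finset.sum_congr rfl fun k _ ↦ by ring

/-! ### Calculus of tractor fields along a curve -/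

variable {τ τ' : ∀ s, Tractor (TangentSpace (𝓡 n) (γ s))}

theorem SmoothTractorAt.add (hγ : ContMDiff 𝓘(ℝ, ℝ) (𝓡 n) ∞ γ) (hτ : SmoothTractorAt γ τ s)
    (hτ' : SmoothTractorAt γ τ' s) : SmoothTractorAt γ (fun s ↦ τ s + τ' s) s :=
  ⟨hτ.1.add hτ'.1, hτ.2.1.add hγ hτ'.2.1, hτ.2.2.add hτ'.2.2⟩

theorem SmoothTractorAt.smul (hγ : ContMDiff 𝓘(ℝ, ℝ) (𝓡 n) ∞ γ)
    (hr : ContMDiffAt 𝓘(ℝ, ℝ) 𝓘(ℝ, ℝ) ∞ r s) (hτ : SmoothTractorAt γ τ s) :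
    SmoothTractorAt γ (fun s ↦ r s • τ s) s :=
  ⟨hr.smul hτ.1, hτ.2.1.smul hγ hr, hr.smul hτ.2.2⟩

theorem SmoothTractorAt.sub (hγ : ContMDiff 𝓘(ℝ, ℝ) (𝓡 n) ∞ γ) (hτ : SmoothTractorAt γ τ s)
    (hτ' : SmoothTractorAt γ τ' s) : SmoothTractorAt γ (fun s ↦ τ s - τ' s) s := by
  have h := hτ.add hγ (hτ'.smul hγ (contMDiffAt_const (c := (-1 : ℝ))))
  simpa only [neg_smul, one_smul, ← sub_eq_add_neg] using h

theorem smoothTractorAt_zero (hγ : ContMDiff 𝓘(ℝ, ℝ) (𝓡 n) ∞ γ) (s : N) :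
    SmoothTractorAt (n := n) γ (fun _ ↦ 0) s :=
  ⟨contMDiffAt_const, smoothFieldAt_zero hγ s, contMDiffAt_const⟩

theorem SmoothTractorAt.sum (hγ : ContMDiff 𝓘(ℝ, ℝ) (𝓡 n) ∞ γ) {ι : Type*} (t : Finset ι)
    {σ : ι → ∀ s, Tractor (TangentSpace (𝓡 n) (γ s))}
    (hσ : ∀ i ∈ t, SmoothTractorAt γ (σ i) s) : SmoothTractorAt γ (fun s ↦ ∑ i ∈ t, σ i s) s := by
  classical
  induction t using Finset.induction_on with
  | empty => simpa using smoothTractorAt_zero hγ s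
  | insert i t hi ih =>
    simp only [Finset.sum_insert hi]
    exact (hσ i (by simp)).add hγ (ih fun j hj ↦ hσ j (by simp [hj]))

theorem SmoothTractorAt.bilin (g : RMetric n M) (hτ : SmoothTractorAt γ τ s)
    (hτ' : SmoothTractorAt γ τ' s) : ContMDiffAt 𝓘(ℝ, ℝ) 𝓘(ℝ, ℝ) ∞
      (fun s ↦ tractorBilin (metricForm g (γ s)) (τ s) (τ' s)) s :=
  ((hτ.1.mul hτ'.2.2).add (hτ.2.1.inner g hτ'.2.1)).add (hτ.2.2.mul hτ'.1)

theorem SmoothTractorAt.wedge (g : RMetric n M) (hγ : ContMDiff 𝓘(ℝ, ℝ) (𝓡 n) ∞ γ)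
    (hτ : SmoothTractorAt γ τ s) (hτ' : SmoothTractorAt γ τ' s) :
    SmoothEndAt γ (fun s ↦ wedge (metricForm g (γ s)) (τ s) (τ' s)) s := fun _ hσ ↦
  (hτ.smul hγ (hτ'.bilin g hσ)).sub hγ (hτ'.smul hγ (hτ.bilin g hσ))

theorem tractorDeriv_congr (g : RMetric n M) (h : ∀ᶠ s' in 𝓝 s, τ s' = τ' s')
    (v : TangentSpace 𝓘(ℝ, ℝ) s) : tractorDeriv g γ τ s v = tractorDeriv g γ τ' s v := by
  have h1 : (fun s' ↦ (τ s').1) =ᶠ[𝓝 s] fun s' ↦ (τ' s').1 := by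
    filter_upwards [h] with s' hs' using by rw [hs']
  have h2 : ∀ᶠ s' in 𝓝 s, (τ s').2.1 = (τ' s').2.1 := by
    filter_upwards [h] with s' hs' using by rw [hs']
  have h3 : (fun s' ↦ (τ s').2.2) =ᶠ[𝓝 s] fun s' ↦ (τ' s').2.2 := by
    filter_upwards [h] with s' hs' using by rw [hs']
  simp only [tractorDeriv, dirDeriv_eq_curveDeriv]
  rw [curveDeriv_congr h1, curveDeriv_congr h3, covDeriv_congr g h2, h.self_of_nhds]

theorem tractorDeriv_smul_dir (g : RMetric n M) (γ : N → M)
    (τ : ∀ s, Tractor (TangentSpace (𝓡 n) (γ s))) (s : N) (c : ℝ) (v : TangentSpace 𝓘(ℝ, ℝ) s) :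
    tractorDeriv g γ τ s (c • v) = c • tractorDeriv g γ τ s v := by
  simp only [tractorDeriv, dirDeriv_smul_dir, velocity_smul, covDeriv_smul_dir,
    schoutenSharp_smul, schouten_smul_left, map_smul, smul_apply, smul_eq_mul]
  refine Prod.ext ?_ (Prod.ext ?_ ?_)
  · simp; ring
  · simp only [Prod.smul_snd, Prod.smul_fst]; module
  · simp; ring

theorem tractorDeriv_add (g : RMetric n M) (hγ : ContMDiff 𝓘(ℝ, ℝ) (𝓡 n) ∞ γ)
    (hτ : SmoothTractorAt γ τ s) (hτ' : SmoothTractorAt γ τ' s) (v : TangentSpace 𝓘(ℝ, ℝ) s) :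
    tractorDeriv g γ (fun s ↦ τ s + τ' s) s v =
      tractorDeriv g γ τ s v + tractorDeriv g γ τ' s v := by
  simp only [tractorDeriv, Prod.fst_add, Prod.snd_add, dirDeriv_eq_curveDeriv]
  rw [curveDeriv_add (hτ.1.mdifferentiableAt (by simp)) (hτ'.1.mdifferentiableAt (by simp)),
    curveDeriv_add (hτ.2.2.mdifferentiableAt (by simp)) (hτ'.2.2.mdifferentiableAt (by simp)),
    covDeriv_add g hγ hτ.2.1 hτ'.2.1, map_add, schouten_add_right]
  refine Prod.ext ?_ (Prod.ext ?_ ?_)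
  · simp only [Prod.fst_add]; ring
  · simp only [Prod.fst_add, Prod.snd_add]; module
  · simp only [Prod.snd_add]; ring

theorem tractorDeriv_smul (g : RMetric n M) (hγ : ContMDiff 𝓘(ℝ, ℝ) (𝓡 n) ∞ γ)
    (hr : ContMDiffAt 𝓘(ℝ, ℝ) 𝓘(ℝ, ℝ) ∞ r s) (hτ : SmoothTractorAt γ τ s)
    (v : TangentSpace 𝓘(ℝ, ℝ) s) :
    tractorDeriv g γ (fun s ↦ r s • τ s) s v =
      dirDeriv r s v • τ s + r s • tractorDeriv g γ τ s v := by
  simp only [tractorDeriv, Prod.smul_fst, Prod.smul_snd, dirDeriv_eq_curveDeriv]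
  rw [curveDeriv_smul (hr.mdifferentiableAt (by simp)) (hτ.1.mdifferentiableAt (by simp)),
    curveDeriv_smul (hr.mdifferentiableAt (by simp)) (hτ.2.2.mdifferentiableAt (by simp)),
    covDeriv_smul g hγ hr hτ.2.1, map_smul, schouten_smul_right]
  refine Prod.ext ?_ (Prod.ext ?_ ?_)
  · simp; ring
  · simp only [Prod.fst_add, Prod.snd_add, Prod.smul_fst, Prod.smul_snd, smul_eq_mul,
      dirDeriv_eq_curveDeriv]
    module
  · simp; ring

theorem tractorDeriv_sub (g : RMetric n M) (hγ : ContMDiff 𝓘(ℝ, ℝ) (𝓡 n) ∞ γ)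
    (hτ : SmoothTractorAt γ τ s) (hτ' : SmoothTractorAt γ τ' s) (v : TangentSpace 𝓘(ℝ, ℝ) s) :
    tractorDeriv g γ (fun s ↦ τ s - τ' s) s v =
      tractorDeriv g γ τ s v - tractorDeriv g γ τ' s v := by
  have h := tractorDeriv_add g hγ (hτ.sub hγ hτ') hτ' v
  simp only [sub_add_cancel] at h
  rw [h, add_sub_cancel_right]

theorem tractorDeriv_zero (g : RMetric n M) (hγ : ContMDiff 𝓘(ℝ, ℝ) (𝓡 n) ∞ γ) (s : N)
    (v : TangentSpace 𝓘(ℝ, ℝ) s) : tractorDeriv g γ (fun _ ↦ 0) s v = 0 := by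
  have h := tractorDeriv_sub g hγ (smoothTractorAt_zero hγ s) (smoothTractorAt_zero hγ s) v
  simpa using h

theorem tractorDeriv_sum (g : RMetric n M) (hγ : ContMDiff 𝓘(ℝ, ℝ) (𝓡 n) ∞ γ) {ι : Type*}
    (t : Finset ι) {σ : ι → ∀ s, Tractor (TangentSpace (𝓡 n) (γ s))}
    (hσ : ∀ i ∈ t, SmoothTractorAt γ (σ i) s) (v : TangentSpace 𝓘(ℝ, ℝ) s) :
    tractorDeriv g γ (fun s ↦ ∑ i ∈ t, σ i s) s v = ∑ i ∈ t, tractorDeriv g γ (σ i) s v := by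
  classical
  induction t using Finset.induction_on with
  | empty => simpa using tractorDeriv_zero g hγ s v
  | insert i t hi ih =>
    simp only [Finset.sum_insert hi]
    rw [tractorDeriv_add g hγ (hσ i (by simp)) (SmoothTractorAt.sum hγ t fun j hj ↦
      hσ j (by simp [hj])), ih fun j hj ↦ hσ j (by simp [hj])]

/-- The tractor connection preserves the tractor form. -/
theorem dirDeriv_tractorBilin (g : RMetric n M) (hγ : ContMDiff 𝓘(ℝ, ℝ) (𝓡 n) ∞ γ)
    (hτ : SmoothTractorAt γ τ s) (hτ' : SmoothTractorAt γ τ' s) (v : TangentSpace 𝓘(ℝ, ℝ) s) :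
    dirDeriv (fun s ↦ tractorBilin (metricForm g (γ s)) (τ s) (τ' s)) s v =
      tractorBilin (metricForm g (γ s)) (tractorDeriv g γ τ s v) (τ' s) +
        tractorBilin (metricForm g (γ s)) (τ s) (tractorDeriv g γ τ' s v) := by
  have d1 := hτ.1.mdifferentiableAt (n := ∞) (by simp)
  have d1' := hτ'.1.mdifferentiableAt (n := ∞) (by simp)
  have d2 := (hτ.2.1.inner g hτ'.2.1).mdifferentiableAt (n := ∞) (by simp)
  have d3 := hτ.2.2.mdifferentiableAt (n := ∞) (by simp)
  have d3' := hτ'.2.2.mdifferentiableAt (n := ∞) (by simp)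
  have c1 := hτ.1.mul hτ'.2.2 |>.mdifferentiableAt (n := ∞) (by simp)
  have c3 := hτ.2.2.mul hτ'.1 |>.mdifferentiableAt (n := ∞) (by simp)
  have c12 := (hτ.1.mul hτ'.2.2).add (hτ.2.1.inner g hτ'.2.1)
    |>.mdifferentiableAt (n := ∞) (by simp)
  have h0 : dirDeriv (fun s ↦ tractorBilin (metricForm g (γ s)) (τ s) (τ' s)) s v = curveDeriv
      (fun s ↦ (τ s).1 * (τ' s).2.2 + g.inner (γ s) (τ s).2.1 (τ' s).2.1 + (τ s).2.2 * (τ' s).1)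
        s v := rfl
  have h1 := curveDeriv_add c12 c3 v
  have h2 := curveDeriv_add c1 d2 v
  have h3 := curveDeriv_smul d1 d3' v
  have h4 := curveDeriv_smul d3 d1' v
  have h5 := dirDeriv_inner g hγ hτ.2.1 hτ'.2.1 v
  rw [dirDeriv_eq_curveDeriv] at h5
  simp only [smul_eq_mul] at h3 h4
  refine h0.trans (h1.trans ?_)
  refine (congrArg₂ (· + ·) (h2.trans (congrArg₂ (· + ·) h3 h5)) h4).trans ?_
  -- The terms with `U` and with the Schouten tensor come in pairs of opposite sign from different
  -- slots and cancel.
  simp only [tractorBilin_apply, metricForm_apply, tractorDeriv, map_add, map_smul,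
    LinearMap.add_apply, LinearMap.smul_apply, smul_eq_mul, dirDeriv_eq_curveDeriv,
    inner_schoutenSharp]
  rw [g.symm _ (τ s).2.1 (schoutenSharp _ _ _), inner_schoutenSharp,
    g.symm _ (τ s).2.1 (velocity γ s v)]
  ring

end Connection

section Necessity

set_option linter.unusedSectionVars false

/-! ### Distinguished curves satisfy the conformal circle equation -/

variable {n : ℕ} {M : Type*} [TopologicalSpace M] [ChartedSpace (Euc n) M]
  [IsManifold (𝓡 n) ∞ M]
  {N : Type*} [TopologicalSpace N] [ChartedSpace ℝ N] [IsManifold 𝓘(ℝ, ℝ) ∞ N]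
  {γ : N → M} {s : N}

theorem dirDeriv_const (c : ℝ) (s : N) (v : TangentSpace 𝓘(ℝ, ℝ) s) :
    dirDeriv (fun _ ↦ c) s v = 0 :=
  curveDeriv_const c s v

theorem smoothTractorAt_canonical (hγ : ContMDiff 𝓘(ℝ, ℝ) (𝓡 n) ∞ γ) (s : N) :
    SmoothTractorAt (n := n) γ (fun _ ↦ (0, 0, 1)) s :=
  ⟨contMDiffAt_const, smoothFieldAt_zero hγ s, contMDiffAt_const⟩

/-- The derivative of the canonical tractor is the velocity. -/
theorem tractorDeriv_canonical (g : RMetric n M) (hγ : ContMDiff 𝓘(ℝ, ℝ) (𝓡 n) ∞ γ) (s : N)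
    (v : TangentSpace 𝓘(ℝ, ℝ) s) :
    tractorDeriv g γ (fun _ ↦ (0, 0, 1)) s v = (0, velocity γ s v, 0) := by
  simp only [tractorDeriv, dirDeriv_const, covDeriv_zero g hγ, schouten_zero_right, map_zero,
    sub_zero, one_smul, zero_smul, zero_add, add_zero]

theorem SmoothFieldAt.tractor {μ : ∀ s, TangentSpace (𝓡 n) (γ s)} (hμ : SmoothFieldAt γ μ s)
    (a b : ℝ) : SmoothTractorAt γ (fun s ↦ (a, μ s, b)) s :=
  ⟨contMDiffAt_const, hμ, contMDiffAt_const⟩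

theorem canonical_mem_circleSpace {V : Type*} [AddCommGroup V] [Module ℝ V] (a b : V) :
    ((0, 0, 1) : Tractor V) ∈ circleSpace a b := ⟨0, by simp⟩

variable {S : ∀ s, Submodule ℝ (Module.End ℝ (Tractor (TangentSpace (𝓡 n) (γ s))))}

/-- If `W` is preserved by a parallel `S` and contains the canonical tractor, and the `wedge` of
the canonical tractor with `Y` is a section of `S`, then `W` contains the derivative of `Y` up to
terms of lower order. -/
theorem mem_of_wedge_mem (g : RMetric n M) (hγ : ContMDiff 𝓘(ℝ, ℝ) (𝓡 n) ∞ γ)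
    (hS : IsTractorParallel g γ S) {W : Submodule ℝ (Tractor (TangentSpace (𝓡 n) (γ s)))}
    (hW : ∀ A ∈ S s, ∀ w ∈ W, A w ∈ W) (hX : (0, 0, 1) ∈ W)
    {Y τ : ∀ s, Tractor (TangentSpace (𝓡 n) (γ s))}
    (hY : ∀ᶠ s' in 𝓝 s, SmoothTractorAt γ Y s' ∧
      wedge (metricForm g (γ s')) (0, 0, 1) (Y s') ∈ S s')
    (hτ : SmoothTractorAt γ τ s) (hτW : τ s ∈ W) (v : TangentSpace 𝓘(ℝ, ℝ) s) :
    tractorBilin (metricForm g (γ s)) (Y s) (τ s) • (0, velocity γ s v, 0) -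
      (τ s).1 • tractorDeriv g γ Y s v - g.inner (γ s) (velocity γ s v) (τ s).2.1 • Y s ∈ W := by
  obtain ⟨Ψ, hΨ, hL⟩ := hS s (fun s ↦ wedge (metricForm g (γ s)) (0, 0, 1) (Y s))
    (hY.mono fun s' hs' ↦ ⟨(smoothTractorAt_canonical hγ s').wedge g hγ hs'.1, hs'.2⟩) v
  have h1 := hL τ hτ
  have hYs := hY.self_of_nhds.1
  have hXs := smoothTractorAt_canonical hγ s
  have e1 : ∀ s' (w : Tractor (TangentSpace (𝓡 n) (γ s'))),
      wedge (metricForm g (γ s')) (0, 0, 1) (Y s') w =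
        tractorBilin (metricForm g (γ s')) (Y s') w • (0, 0, 1) - w.1 • Y s' := fun s' w ↦ by
    rw [wedge_apply]
    congr 2
    simp [tractorBilin_apply]
  have hXW := hW Ψ hΨ (τ s) hτW
  simp only [e1] at h1
  rw [tractorDeriv_sub g hγ (hXs.smul hγ (hYs.bilin g hτ)) (hYs.smul hγ hτ.1),
    tractorDeriv_smul g hγ (hYs.bilin g hτ) hXs, tractorDeriv_smul g hγ hτ.1 hYs,
    tractorDeriv_canonical g hγ] at h1
  have e2 : (tractorDeriv g γ τ s v).1 =
    dirDeriv (fun s' ↦ (τ s').1) s v - g.inner (γ s) (velocity γ s v) (τ s).2.1 := rfl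
  rw [e2] at h1
  -- In the Leibniz identity the derivative of the first slot of `τ` occurs on both sides and
  -- cancels. All that remains besides the displayed combination is `Ψ (τ s)` and a multiple of the
  -- canonical tractor.
  have h2 : tractorBilin (metricForm g (γ s)) (Y s) (τ s) •
      ((0, velocity γ s v, 0) : Tractor (TangentSpace (𝓡 n) (γ s))) -
      (τ s).1 • tractorDeriv g γ Y s v - g.inner (γ s) (velocity γ s v) (τ s).2.1 • Y s =
      Ψ (τ s) + (tractorBilin (metricForm g (γ s)) (Y s) (tractorDeriv g γ τ s v) -
        dirDeriv (fun s ↦ tractorBilin (metricForm g (γ s)) (Y s) (τ s)) s v) •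
          ((0, 0, 1) : Tractor (TangentSpace (𝓡 n) (γ s))) := by
    rw [← sub_eq_iff_eq_add] at h1
    rw [← h1]
    module
  rw [h2]
  exact W.add_mem hXW (W.smul_mem _ hX)

theorem circleSpace_smul_left {V : Type*} [AddCommGroup V] [Module ℝ V] (a b : V) {c : ℝ}
    (hc : c ≠ 0) : circleSpace (c • a) b = circleSpace a b := by
  ext w
  rw [mem_circleSpace, mem_circleSpace]
  constructor
  · rintro ⟨r, hr⟩
    exact ⟨r * c, by rw [hr, smul_smul]⟩
  · rintro ⟨r, hr⟩
    exact ⟨r * c⁻¹, by rw [hr, smul_smul, mul_assoc, inv_mul_cancel₀ hc, mul_one]⟩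

variable {e : ∀ s : N, TangentSpace 𝓘(ℝ, ℝ) s}

theorem inner_velocity_acceleration (g : RMetric n M) (hγ : ContMDiff 𝓘(ℝ, ℝ) (𝓡 n) ∞ γ)
    (he : ContMDiff 𝓘(ℝ, ℝ) 𝓘(ℝ, ℝ).tangent ∞ fun s ↦ (⟨s, e s⟩ : TangentBundle 𝓘(ℝ, ℝ) N))
    (he_unit : ∀ s, g.inner (γ s) (velocity γ s (e s)) (velocity γ s (e s)) = 1) (s : N) :
    g.inner (γ s) (velocity γ s (e s)) (covDeriv g γ (fun s ↦ velocity γ s (e s)) s (e s)) = 0 := by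
  have hU := smoothFieldAt_velocity hγ he s
  have h1 := dirDeriv_inner g hγ hU hU (e s)
  simp only [he_unit, dirDeriv_const] at h1
  rw [g.symm (γ s) _ (velocity γ s (e s))] at h1
  linarith

/-- Differentiate `⟨U, C⟩ = 0`. This fixes the coefficient of `U` in the conformal circle equation.
-/
theorem inner_velocity_jerk (g : RMetric n M) (hγ : ContMDiff 𝓘(ℝ, ℝ) (𝓡 n) ∞ γ)
    (he : ContMDiff 𝓘(ℝ, ℝ) 𝓘(ℝ, ℝ).tangent ∞ fun s ↦ (⟨s, e s⟩ : TangentBundle 𝓘(ℝ, ℝ) N))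
    (he_unit : ∀ s, g.inner (γ s) (velocity γ s (e s)) (velocity γ s (e s)) = 1) (s : N) :
    g.inner (γ s) (covDeriv g γ (fun s ↦ covDeriv g γ (fun s ↦ velocity γ s (e s)) s (e s)) s (e s))
      (velocity γ s (e s)) =
      -g.inner (γ s) (covDeriv g γ (fun s ↦ velocity γ s (e s)) s (e s))
        (covDeriv g γ (fun s ↦ velocity γ s (e s)) s (e s)) := by
  have hU := smoothFieldAt_velocity hγ he
  have h1 := dirDeriv_inner g hγ (hU s) (smoothFieldAt_covDeriv g hγ he hU s) (e s)
  simp only [inner_velocity_acceleration g hγ he he_unit, dirDeriv_const] at h1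
  rw [g.symm (γ s) (velocity γ s (e s))] at h1
  linarith

/-- The stabilised space is `circleSpace a b` at each point, with `a` and `b` chosen pointwise and
perhaps discontinuously. Three uses of `mem_of_wedge_mem` identify it: `a` is proportional to `U`,
then `(-1, C, 0)` lies in the space, and finally `∂C - P♯U` is a multiple of `U`. -/
theorem conformalCircleEq_of_isDistinguished (g : RMetric n M)
    (hγ : ContMDiff 𝓘(ℝ, ℝ) (𝓡 n) ∞ γ)
    (he : ContMDiff 𝓘(ℝ, ℝ) 𝓘(ℝ, ℝ).tangent ∞ fun s ↦ (⟨s, e s⟩ : TangentBundle 𝓘(ℝ, ℝ) N))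
    (he_unit : ∀ s, g.inner (γ s) (velocity γ s (e s)) (velocity γ s (e s)) = 1)
    {U₀ C₀ : Euc n} (hU₀ : ‖U₀‖ = 1) (hUC₀ : inner ℝ U₀ C₀ = (0 : ℝ))
    (h : IsDistinguished g (circle U₀ C₀) γ) : ConformalCircleEq g γ e := by
  obtain ⟨S, hsub, hfib, hpar⟩ := h
  set U : ∀ s, TangentSpace (𝓡 n) (γ s) := fun s ↦ velocity γ s (e s) with hUdef
  set C : ∀ s, TangentSpace (𝓡 n) (γ s) := fun s ↦ covDeriv g γ U s (e s) with hCdef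
  have hUs : ∀ s, SmoothFieldAt γ U s := smoothFieldAt_velocity hγ he
  have hCs : ∀ s, SmoothFieldAt γ C s := smoothFieldAt_covDeriv g hγ he hUs
  have hsymm : ∀ s (v w : TangentSpace (𝓡 n) (γ s)),
      metricForm g (γ s) v w = metricForm g (γ s) w v := fun s ↦ g.symm (γ s)
  have hUne : ∀ s, U s ≠ 0 := fun s h0 ↦ by
    have := he_unit s
    rw [show velocity γ s (e s) = 0 from h0, map_zero] at this
    simp at this
  have hab : ∀ s, ∃ a b : TangentSpace (𝓡 n) (γ s), a ≠ 0 ∧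
      S s = skewStab (metricForm g (γ s)) (circleSpace a b) := by
    intro s
    obtain ⟨u, ⟨hu, r, hr⟩, hSs⟩ := hfib s
    obtain ⟨a, b, ha, hmap⟩ := exists_map_circleSpace (C := C₀) hU₀ (B := metricForm g (γ s)) u hu hr
    exact ⟨a, b, ha, by rw [hSs, symAlgebra_circle hU₀ hUC₀, map_conj_skewStab (B := metricForm g (γ s)) u hu, hmap]⟩
  have hUb : ∀ s, ∃ b : TangentSpace (𝓡 n) (γ s),
      S s = skewStab (metricForm g (γ s)) (circleSpace (U s) b) := by
    intro s₀
    obtain ⟨a, b, ha, hSs⟩ := hab s₀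
    obtain ⟨k, Φ, hΦ⟩ := hsub s₀
    -- Otherwise every element of the fibre would send the canonical tractor to one with zero middle
    -- slot, yet the `wedge` of `(0, a, 0)` and `(1, b, 0)` sends it to `(0, a, 0)`.
    obtain ⟨i, hi⟩ : ∃ i, (Φ i s₀ (0, 0, 1)).2.1 ≠ 0 := by
      by_contra! hcon
      have hmem : wedge (metricForm g (γ s₀)) (0, a, 0) (1, b, 0) ∈ S s₀ := by
        rw [hSs]
        exact wedge_mem_skewStab (hsymm s₀) ⟨1, by simp⟩ ⟨0, by simp⟩
      rw [← hΦ.self_of_nhds.2.2] at hmem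
      have hle : Submodule.span ℝ (Set.range fun i ↦ Φ i s₀) ≤
          LinearMap.ker ((LinearMap.fst ℝ (TangentSpace (𝓡 n) (γ s₀)) ℝ ∘ₗ
            LinearMap.snd ℝ ℝ (TangentSpace (𝓡 n) (γ s₀) × ℝ)) ∘ₗ
              LinearMap.applyₗ (R := ℝ) ((0, 0, 1) : Tractor (TangentSpace (𝓡 n) (γ s₀)))) := by
        rw [Submodule.span_le]
        rintro _ ⟨i, rfl⟩
        exact hcon i
      have h0 : (wedge (metricForm g (γ s₀)) (0, a, 0) (1, b, 0) (0, 0, 1)).2.1 = 0 := hle hmem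
      refine ha ?_
      simpa [wedge_apply, tractorBilin_apply] using h0
    -- A smooth substitute for the pointwise choice of `a`: near `s₀` it is a multiple of `a`,
    -- nonzero at `s₀`.
    set μ : ∀ s, TangentSpace (𝓡 n) (γ s) := fun s ↦ (Φ i s (0, 0, 1)).2.1 with hμ
    have hmem : ∀ {s : N} {a b : TangentSpace (𝓡 n) (γ s)},
        S s = skewStab (metricForm g (γ s)) (circleSpace a b) → Φ i s ∈ S s → ∃ r : ℝ,
          μ s = r • a := by
      intro s a b hS hΦs
      rw [hS] at hΦs
      obtain ⟨r, hr⟩ := hΦs.2 _ (canonical_mem_circleSpace a b)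
      have h1 := hΦs.1 (0, 0, 1) (0, 0, 1)
      rw [tractorBilin_comm (hsymm s) (0, 0, 1)] at h1
      have h2 : (Φ i s (0, 0, 1)).1 = 0 := by
        simp only [tractorBilin_apply, map_zero, mul_zero, mul_one, add_zero] at h1
        linarith
      exact ⟨r, by rw [hμ]; simp [hr, h2]⟩
    have hY : ∀ᶠ s' in 𝓝 s₀, SmoothTractorAt γ (fun s ↦ (0, μ s, 0)) s' ∧
        wedge (metricForm g (γ s')) (0, 0, 1) (0, μ s', 0) ∈ S s' := by
      filter_upwards [hΦ] with s' hs'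
      refine ⟨((hs'.1 i) _ (smoothTractorAt_canonical hγ s')).2.1.tractor 0 0, ?_⟩
      obtain ⟨a', b', -, hS'⟩ := hab s'
      obtain ⟨r, hr⟩ := hmem hS' (by rw [← hs'.2.2]; exact Submodule.subset_span ⟨i, rfl⟩)
      rw [hS']
      exact wedge_mem_skewStab (hsymm s') (canonical_mem_circleSpace _ _) ⟨r, by simp [hr]⟩
    obtain ⟨r, hr⟩ := hmem hSs
      (by rw [← hΦ.self_of_nhds.2.2]; exact Submodule.subset_span ⟨i, rfl⟩)
    have hr0 : r ≠ 0 := by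
      rintro rfl
      exact hi (by simpa using hr)
    have hWS : ∀ A ∈ S s₀, ∀ w ∈ circleSpace a b, A w ∈ circleSpace a b := by
      intro A hA
      rw [hSs] at hA
      exact hA.2
    -- With `τ = Y = (0, μ, 0)` the first slot is zero, so the derivative of `Y` drops out and only
    -- `U` and `μ` remain.
    have h1 := mem_of_wedge_mem g hγ hpar hWS (canonical_mem_circleSpace a b) hY
      hY.self_of_nhds.1 ⟨r, by simp [hr]⟩ (e s₀)
    obtain ⟨t, ht⟩ := h1
    set q := tractorBilin (metricForm g (γ s₀)) (0, μ s₀, 0) (0, μ s₀, 0) with hq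
    have hq0 : q ≠ 0 := by
      have : q = g.inner (γ s₀) (μ s₀) (μ s₀) := by
        simp [hq, tractorBilin_apply, metricForm_apply]
      rw [this]
      exact (g.pos _ _ hi).ne'
    simp only [zero_smul, sub_zero, Prod.snd_sub, Prod.fst_sub, Prod.smul_snd, Prod.smul_fst,
      smul_zero, sub_self, add_zero, hr] at ht
    set z := g.inner (γ s₀) (velocity γ s₀ (e s₀)) (r • a)
    have hUa : U s₀ = (q⁻¹ * (t + z * r)) • a := by
      have : q • U s₀ = (t + z * r) • a := by
        rw [sub_eq_iff_eq_add] at ht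
        rw [hUdef]
        rw [ht]
        module
      rw [mul_smul, ← this, smul_smul, inv_mul_cancel₀ hq0, one_smul]
    have hc : q⁻¹ * (t + z * r) ≠ 0 := by
      intro h0
      rw [h0, zero_smul] at hUa
      exact hUne s₀ hUa
    exact ⟨b, by rw [hSs, hUa, circleSpace_smul_left _ _ hc]⟩
  have hV : ∀ s, ∃ b : TangentSpace (𝓡 n) (γ s),
      S s = skewStab (metricForm g (γ s)) (circleSpace (U s) b) ∧
        (-1, C s, 0) ∈ circleSpace (U s) b := by
    intro s
    obtain ⟨b, hSs⟩ := hUb s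
    refine ⟨b, hSs, ?_⟩
    have hs := mem_chart_source (Euc n) (γ s)
    have hWS : ∀ A ∈ S s, ∀ w ∈ circleSpace (U s) b, A w ∈ circleSpace (U s) b := by
      intro A hA
      rw [hSs] at hA
      exact hA.2
    have hY : ∀ᶠ s' in 𝓝 s, SmoothTractorAt γ (fun s ↦ (0, U s, 0)) s' ∧
        wedge (metricForm g (γ s')) (0, 0, 1) (0, U s', 0) ∈ S s' := by
      refine Filter.Eventually.of_forall fun s' ↦ ⟨(hUs s').tractor 0 0, ?_⟩
      obtain ⟨b', hS'⟩ := hUb s'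
      rw [hS']
      exact wedge_mem_skewStab (hsymm s') (canonical_mem_circleSpace _ _) ⟨1, by simp⟩
    have hext := chartFrame_chartCoord hs b
    -- Now `τ` extends `(1, b, 0)`, with `b` frozen in the chart; the first slot `1` keeps the
    -- derivative of `(0, U, 0)`, whose middle slot is `C`.
    have h1 := mem_of_wedge_mem g hγ hpar hWS (canonical_mem_circleSpace _ b) hY
      (τ := fun s' ↦ (1, chartFrame (γ s) (γ s') (chartCoord (γ s) (γ s) b), 0))
      ((smoothFieldAt_chartFrame hγ hs _).tractor 1 0) ⟨0, by simp [hext]⟩ (e s)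
    obtain ⟨t, ht⟩ := h1
    simp only [hext, one_smul, Prod.snd_sub, Prod.fst_sub, Prod.smul_snd, Prod.smul_fst,
      tractorDeriv, dirDeriv_const, zero_smul, add_zero, smul_zero, zero_sub, sub_zero,
      sub_neg_eq_add, he_unit, hUdef] at ht
    set q := tractorBilin (metricForm g (γ s)) (0, velocity γ s (e s), 0) (1, b, 0)
    set z := g.inner (γ s) (velocity γ s (e s)) b
    refine ⟨q - z - t, ?_⟩
    change covDeriv g γ U s (e s) = (q - z - t) • velocity γ s (e s) + (-1 : ℝ) • b
    have h2 : ∀ c u : TangentSpace (𝓡 n) (γ s), q • u - c - z • u = t • u + (0 + 1 : ℝ) • b →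
        c = (q - z - t) • u + (-1 : ℝ) • b := fun c u h ↦ by
      have h3 : c = q • u - z • u - (q • u - c - z • u) := by abel
      rw [h3, h]
      module
    exact h2 _ _ ht
  intro s w
  obtain ⟨b, hSs, hVs⟩ := hV s
  have hWS : ∀ A ∈ S s, ∀ w ∈ circleSpace (U s) b, A w ∈ circleSpace (U s) b := by
    intro A hA
    rw [hSs] at hA
    exact hA.2
  have hY : ∀ᶠ s' in 𝓝 s, SmoothTractorAt γ (fun s ↦ (-1, C s, 0)) s' ∧
      wedge (metricForm g (γ s')) (0, 0, 1) (-1, C s', 0) ∈ S s' := by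
    refine Filter.Eventually.of_forall fun s' ↦ ⟨(hCs s').tractor (-1) 0, ?_⟩
    obtain ⟨b', hS', hV'⟩ := hV s'
    rw [hS']
    exact wedge_mem_skewStab (hsymm s') (canonical_mem_circleSpace _ _) hV'
  -- Here `τ = Y = (-1, C, 0)`. The derivative of `Y` has zero first slot because `⟨U, C⟩ = 0`, so
  -- membership makes its middle slot a multiple of `U`.
  have h1 := mem_of_wedge_mem g hγ hpar hWS (canonical_mem_circleSpace _ b) hY
      (hY.self_of_nhds.1) hVs (e s)
  have hUC : g.inner (γ s) (velocity γ s (e s)) (C s) = 0 :=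
    inner_velocity_acceleration g hγ he he_unit s
  have hUJ : g.inner (γ s) (covDeriv g γ C s (e s)) (U s) = -g.inner (γ s) (C s) (C s) :=
    inner_velocity_jerk g hγ he he_unit s
  obtain ⟨t, ht⟩ := h1
  simp only [neg_smul, one_smul, Prod.snd_add, Prod.fst_add, Prod.smul_snd, Prod.smul_fst,
    tractorDeriv, dirDeriv_const, hUC, zero_smul, add_zero, smul_zero,
    sub_zero, sub_neg_eq_add] at ht
  set q := tractorBilin (metricForm g (γ s)) (-1, C s, 0) (-1, C s, 0)
  have hJ : covDeriv g γ C s (e s) = (t - q) • U s + schoutenSharp g (γ s) (U s) := by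
    have h2 : ∀ c u p : TangentSpace (𝓡 n) (γ s), q • u + (c + -p) = t • u →
        c = (t - q) • u + p := fun c u p h ↦ by
      have h3 : c = q • u + (c + -p) - q • u + p := by abel
      rw [h3, h]
      module
    exact h2 _ _ _ ht
  have hJw : ∀ w, g.inner (γ s) (covDeriv g γ C s (e s)) w =
      (t - q) * g.inner (γ s) (U s) w + schouten g (γ s) (U s) w := by
    intro w
    rw [hJ, ← inner_schoutenSharp]
    simp
  have h2 := hJw (U s)
  rw [hUJ, show g.inner (γ s) (U s) (U s) = 1 from he_unit s] at h2
  have h3 : t - q = -(g.inner (γ s) (C s) (C s) + schouten g (γ s) (U s) (U s)) := by linarith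
  change g.inner (γ s) (covDeriv g γ C s (e s)) w = schouten g (γ s) (U s) w -
    (g.inner (γ s) (C s) (C s) + schouten g (γ s) (U s) (U s)) * g.inner (γ s) (U s) w
  rw [hJw, h3]
  ring

end Necessity

section CircleProjection

/-! ### The projection onto a circle space -/

variable {V : Type*} [AddCommGroup V] [Module ℝ V] {B : LinearMap.BilinForm ℝ V} {U C : V}

/-- A null vector of `circleSpace U (-C)` that is dual to `(0, 0, 1)` and orthogonal to
`(0, U, 0)`. -/
def circleDual (B : LinearMap.BilinForm ℝ V) (C : V) : Tractor V := (1, -C, -(1 / 2) * B C C)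

/-- The orthogonal projection onto `circleSpace U (-C)`. -/
def circleProj (B : LinearMap.BilinForm ℝ V) (U C : V) : Module.End ℝ (Tractor V) :=
  (tractorBilin B (circleDual B C)).smulRight (0, 0, 1) +
    (tractorBilin B (0, U, 0)).smulRight (0, U, 0) +
    (tractorBilin B (0, 0, 1)).smulRight (circleDual B C)

theorem circleProj_apply (B : LinearMap.BilinForm ℝ V) (U C : V) (τ : Tractor V) :
    circleProj B U C τ = tractorBilin B (circleDual B C) τ • (0, 0, 1) +
      tractorBilin B (0, U, 0) τ • (0, U, 0) +
        tractorBilin B (0, 0, 1) τ • circleDual B C := rfl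

theorem circleProj_mem (B : LinearMap.BilinForm ℝ V) (U C : V) (τ : Tractor V) :
    circleProj B U C τ ∈ circleSpace U (-C) := by
  rw [circleProj_apply]
  refine Submodule.add_mem _ (Submodule.add_mem _ (Submodule.smul_mem _ _ ?_)
    (Submodule.smul_mem _ _ ?_)) (Submodule.smul_mem _ _ ?_)
  · exact canonical_mem_circleSpace _ _
  · exact ⟨1, by simp⟩
  · exact ⟨0, by simp [circleDual]⟩

/-- Under these normalisations `(0, 0, 1)` and `circleDual` are null and dual to each other, and
both are orthogonal to the unit vector `(0, U, 0)`; the projection is the expansion in this basis.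
-/
theorem circleProj_of_mem (hB : ∀ v w, B v w = B w v) (hU : B U U = 1) (hUC : B U C = 0)
    {w : Tractor V} (hw : w ∈ circleSpace U (-C)) : circleProj B U C w = w := by
  obtain ⟨r, hr⟩ := hw
  have hCU : B C U = 0 := by rw [hB, hUC]
  rw [circleProj_apply]
  refine Prod.ext ?_ (Prod.ext ?_ ?_)
  · simp [tractorBilin_apply, circleDual]
  · simp [tractorBilin_apply, circleDual, hr, hU, hUC]
  · simp [tractorBilin_apply, circleDual, hr, hCU]
    ring

theorem circleProj_adjoint (hB : ∀ v w, B v w = B w v) (U C : V) (a b : Tractor V) :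
    tractorBilin B (circleProj B U C a) b = tractorBilin B a (circleProj B U C b) := by
  simp only [circleProj_apply, map_add, map_smul, LinearMap.add_apply, LinearMap.smul_apply,
    smul_eq_mul, tractorBilin_comm hB a]
  ring

end CircleProjection

section Sufficiency

set_option linter.unusedSectionVars false

/-! ### Tractor fields in a chart -/

variable {n : ℕ} {M : Type*} [TopologicalSpace M] [ChartedSpace (Euc n) M]
  [IsManifold (𝓡 n) ∞ M]
  {N : Type*} [TopologicalSpace N] [ChartedSpace ℝ N] [IsManifold 𝓘(ℝ, ℝ) ∞ N]
  {γ : N → M} {s : N} {p x : M}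

/-- The components of a tractor in the chart at `p`. -/
def chartTractor (p x : M) : Tractor (TangentSpace (𝓡 n) x) →ₗ[ℝ] Tractor (Euc n) :=
  LinearMap.prodMap LinearMap.id
    (LinearMap.prodMap (chartCoord (n := n) p x : TangentSpace (𝓡 n) x →L[ℝ] Euc n).toLinearMap LinearMap.id)

theorem chartTractor_apply (p x : M) (a : Tractor (TangentSpace (𝓡 n) x)) :
    chartTractor p x a = (a.1, chartCoord p x a.2.1, a.2.2) := rfl

/-- The tractor with given components in the chart at `p`. -/
def ofChartTractor (p x : M) : Tractor (Euc n) →ₗ[ℝ] Tractor (TangentSpace (𝓡 n) x) :=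
  LinearMap.prodMap LinearMap.id
    (LinearMap.prodMap (chartFrame (n := n) p x : Euc n →L[ℝ] TangentSpace (𝓡 n) x).toLinearMap LinearMap.id)

theorem ofChartTractor_apply (p x : M) (a : Tractor (Euc n)) :
    (ofChartTractor p x a : Tractor (TangentSpace (𝓡 n) x)) = (a.1, chartFrame p x a.2.1, a.2.2) :=
  rfl

/-- The components of tractors in the chart at `p`, as an equivalence. -/
def chartTractorEquiv (hx : x ∈ (chartAt (Euc n) p).source) :
    Tractor (Euc n) ≃ₗ[ℝ] Tractor (TangentSpace (𝓡 n) x) :=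
  LinearEquiv.ofLinearMap (ofChartTractor p x) (chartTractor p x)
    (LinearMap.ext fun a ↦ by
      simp [chartTractor_apply, ofChartTractor_apply, chartFrame_chartCoord hx])
    (LinearMap.ext fun a ↦ by
      simp [chartTractor_apply, ofChartTractor_apply, chartCoord_chartFrame hx])

theorem smoothTractorAt_ofChartTractor (hγ : ContMDiff 𝓘(ℝ, ℝ) (𝓡 n) ∞ γ)
    (hp : γ s ∈ (chartAt (Euc n) p).source) (a : Tractor (Euc n)) :
    SmoothTractorAt γ (fun s' ↦ ofChartTractor p (γ s') a) s :=
  (smoothFieldAt_chartFrame hγ hp a.2.1).tractor a.1 a.2.2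

theorem SmoothTractorAt.chartTractor (hγ : ContMDiff 𝓘(ℝ, ℝ) (𝓡 n) ∞ γ)
    (hp : γ s ∈ (chartAt (Euc n) p).source) {τ : ∀ s, Tractor (TangentSpace (𝓡 n) (γ s))}
    (hτ : SmoothTractorAt γ τ s) :
    ContMDiffAt 𝓘(ℝ, ℝ) 𝓘(ℝ, Tractor (Euc n)) ∞ (fun s' ↦ chartTractor p (γ s') (τ s')) s :=
  hτ.1.prodMk_space (((smoothFieldAt_iff hγ hp).1 hτ.2.1).prodMk_space hτ.2.2)

theorem exists_smoothTractorAt_eq (hγ : ContMDiff 𝓘(ℝ, ℝ) (𝓡 n) ∞ γ) (s : N)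
    (a : Tractor (TangentSpace (𝓡 n) (γ s))) :
    ∃ τ, SmoothTractorAt γ τ s ∧ τ s = a := by
  have hp := mem_chart_source (Euc n) (γ s)
  refine ⟨_, smoothTractorAt_ofChartTractor hγ hp (ConformalCircles.chartTractor (γ s) (γ s) a), ?_⟩
  simp [chartTractor_apply, ofChartTractor_apply, chartFrame_chartCoord hp]

/-- A smooth field of tractor endomorphisms has a derivative. -/
theorem exists_isTractorEndDeriv (g : RMetric n M) (hγ : ContMDiff 𝓘(ℝ, ℝ) (𝓡 n) ∞ γ)
    {Φ : ∀ s, Module.End ℝ (Tractor (TangentSpace (𝓡 n) (γ s)))} (hΦ : SmoothEndAt γ Φ s)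
    (v : TangentSpace 𝓘(ℝ, ℝ) s) : ∃ Ψ, IsTractorEndDeriv g γ Φ s v Ψ := by
  have hp := mem_chart_source (Euc n) (γ s)
  let f := Module.finBasis ℝ (Tractor (Euc n))
  let F : ∀ (_ : Fin _) (s' : N), Tractor (TangentSpace (𝓡 n) (γ s')) :=
    fun j s' ↦ ofChartTractor (γ s) (γ s') (f j)
  have hF : ∀ j, SmoothTractorAt γ (F j) s := fun j ↦ smoothTractorAt_ofChartTractor hγ hp (f j)
  let b := f.map (chartTractorEquiv hp)
  -- The Leibniz rule on a local frame dictates the values; for general `τ` it follows by expanding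
  -- in the frame with smooth coefficients.
  let Ψ : Module.End ℝ (Tractor (TangentSpace (𝓡 n) (γ s))) := b.constr ℝ fun j ↦
    tractorDeriv g γ (fun s' ↦ Φ s' (F j s')) s v - Φ s (tractorDeriv g γ (F j) s v)
  have hΨ : ∀ j, Ψ (F j s) =
      tractorDeriv g γ (fun s' ↦ Φ s' (F j s')) s v - Φ s (tractorDeriv g γ (F j) s v) :=
    fun j ↦ b.constr_basis ℝ _ j
  refine ⟨Ψ, fun τ hτ ↦ ?_⟩
  let c : ∀ (_ : Fin _) (_ : N), ℝ := fun j s' ↦ f.coord j (chartTractor (γ s) (γ s') (τ s'))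
  have hc : ∀ j, ContMDiffAt 𝓘(ℝ, ℝ) 𝓘(ℝ, ℝ) ∞ (c j) s := fun j ↦
    ((LinearMap.toContinuousLinearMap (f.coord j)).contMDiff.contMDiffAt).comp s
      (hτ.chartTractor hγ hp)
  have hdec : ∀ᶠ s' in 𝓝 s, τ s' = ∑ j, c j s' • F j s' := by
    filter_upwards [eventually_mem_chart_source hγ hp] with s' hs'
    have h1 := f.sum_repr (chartTractor (γ s) (γ s') (τ s'))
    have h2 := congrArg (ofChartTractor (γ s) (γ s')) h1
    rw [map_sum] at h2
    simp only [map_smul] at h2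
    have h3 : ofChartTractor (γ s) (γ s') (chartTractor (γ s) (γ s') (τ s')) = τ s' :=
      (chartTractorEquiv hs').apply_symm_apply (τ s')
    rw [h3] at h2
    exact h2.symm
  have hdecΦ : ∀ᶠ s' in 𝓝 s, Φ s' (τ s') = ∑ j, c j s' • Φ s' (F j s') := by
    filter_upwards [hdec] with s' hs'
    rw [hs', map_sum]
    simp only [map_smul]
  have hcF := fun j ↦ (hF j).smul hγ (hc j)
  have hcΦ := fun j ↦ (hΦ _ (hF j)).smul hγ (hc j)
  rw [tractorDeriv_congr g hdecΦ, tractorDeriv_congr g hdec,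
    tractorDeriv_sum g hγ _ fun j _ ↦ hcΦ j, tractorDeriv_sum g hγ _ fun j _ ↦ hcF j,
    hdec.self_of_nhds, map_sum, map_sum, ← Finset.sum_add_distrib]
  refine Finset.sum_congr rfl fun j _ ↦ ?_
  rw [tractorDeriv_smul g hγ (hc j) (hΦ _ (hF j)), tractorDeriv_smul g hγ (hc j) (hF j), map_smul,
    map_add, map_smul, map_smul, hΨ]
  module

/-- Smooth sections that span subspaces of constant dimension span a smooth subbundle. -/
theorem isSmoothSubbundle_of_span (hγ : ContMDiff 𝓘(ℝ, ℝ) (𝓡 n) ∞ γ)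
    {S : ∀ s, Submodule ℝ (Module.End ℝ (Tractor (TangentSpace (𝓡 n) (γ s))))} {k : ℕ}
    (hk : ∀ s, Module.finrank ℝ (S s) = k)
    (hS : ∀ s₀ : N, ∃ (ι : Type) (Ξ : ι → ∀ s,
      Module.End ℝ (Tractor (TangentSpace (𝓡 n) (γ s)))), ∀ᶠ s in 𝓝 s₀,
        (∀ i, SmoothEndAt γ (Ξ i) s) ∧ Submodule.span ℝ (Set.range fun i ↦ Ξ i s) = S s) :
    IsSmoothSubbundle γ S := by
  intro s₀
  obtain ⟨ι, Ξ, hΞ⟩ := hS s₀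
  have hp := mem_chart_source (Euc n) (γ s₀)
  have hfd : ∀ x : M, FiniteDimensional ℝ (TangentSpace (𝓡 n) x) := fun x ↦
    inferInstanceAs (FiniteDimensional ℝ (Euc n))
  obtain ⟨φ, hφ, hφs, hφli⟩ :=
    Submodule.exists_fun_fin_finrank_span_eq ℝ (Set.range fun i ↦ Ξ i s₀)
  choose i hi using hφ
  have hli : LinearIndependent ℝ fun j ↦ Ξ (i j) s₀ := by
    have : (fun j ↦ Ξ (i j) s₀) = φ := funext hi
    rwa [this]
  let f := Module.finBasis ℝ (Tractor (Euc n))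
  -- Matrix entries in the chart at `γ s₀`, which place the endomorphisms at different points in one
  -- fixed space, where linear independence is an open condition. The constant dimension then
  -- upgrades independence to spanning.
  let T : ∀ s, Module.End ℝ (Tractor (TangentSpace (𝓡 n) (γ s))) →ₗ[ℝ]
      (Fin (Module.finrank ℝ (Tractor (Euc n))) → Tractor (Euc n)) := fun s ↦
    LinearMap.pi fun j ↦ chartTractor (γ s₀) (γ s) ∘ₗ
      LinearMap.applyₗ (ofChartTractor (γ s₀) (γ s) (f j))
  have hT : ∀ s A j, T s A j = chartTractor (γ s₀) (γ s) (A (ofChartTractor (γ s₀) (γ s) (f j))) :=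
    fun s A j ↦ rfl
  have hTker : LinearMap.ker (T s₀) = ⊥ := by
    rw [LinearMap.ker_eq_bot']
    intro A hA
    refine (f.map (chartTractorEquiv hp)).ext fun j ↦ ?_
    have h1 := congrFun hA j
    rw [hT] at h1
    exact (chartTractorEquiv hp).symm.map_eq_zero_iff.1 h1
  have hcont : ContinuousAt (fun s ↦ fun j ↦ T s (Ξ (i j) s)) s₀ := by
    refine continuousAt_pi.2 fun j ↦ continuousAt_pi.2 fun l ↦ ?_
    exact ((hΞ.self_of_nhds.1 (i j) _
      (smoothTractorAt_ofChartTractor hγ hp (f l))).chartTractor hγ hp).continuousAt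
  have hopen : ∀ᶠ s in 𝓝 s₀, LinearIndependent ℝ fun j ↦ T s (Ξ (i j) s) :=
    hcont.eventually (isOpen_setOfPred_linearIndependent.mem_nhds (hli.map' (T s₀) hTker))
  refine ⟨_, fun j ↦ Ξ (i j), ?_⟩
  filter_upwards [hΞ, hopen] with s hs hlis
  have hli' : LinearIndependent ℝ fun j ↦ Ξ (i j) s := LinearIndependent.of_comp (T s) hlis
  refine ⟨fun j ↦ hs.1 _, hli', ?_⟩
  refine Submodule.eq_of_le_of_finrank_eq ?_ ?_
  · rw [← hs.2]
    refine Submodule.span_mono ?_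
    rintro _ ⟨j, rfl⟩
    exact ⟨i j, rfl⟩
  · rw [finrank_span_eq_card hli', Fintype.card_fin, hΞ.self_of_nhds.2, hk, hk]

/-! ### Solutions of the conformal circle equation are distinguished -/

variable {e : ∀ s : N, TangentSpace 𝓘(ℝ, ℝ) s}

/-- The equation between one-forms with the index raised, by nondegeneracy of the metric. -/
theorem ConformalCircleEq.covDeriv_acceleration {g : RMetric n M} (h : ConformalCircleEq g γ e)
    (s : N) :
    covDeriv g γ (fun s ↦ covDeriv g γ (fun s ↦ velocity γ s (e s)) s (e s)) s (e s) =
      schoutenSharp g (γ s) (velocity γ s (e s)) -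
        (g.inner (γ s) (covDeriv g γ (fun s ↦ velocity γ s (e s)) s (e s))
          (covDeriv g γ (fun s ↦ velocity γ s (e s)) s (e s)) +
            schouten g (γ s) (velocity γ s (e s)) (velocity γ s (e s))) •
              velocity γ s (e s) := by
  rw [← sub_eq_zero]
  by_contra hne
  refine (g.pos _ _ hne).ne' (DFunLike.congr_fun (g := 0) (ContinuousLinearMap.ext fun d ↦ ?_) _)
  have h1 := h s d
  simp only at h1
  simp only [map_sub, map_smul, sub_apply, smul_apply, smul_eq_mul, inner_schoutenSharp]
  rw [h1, sub_self]
  rfl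

/-- The space has the smooth frame `(0, 0, 1)`, `(0, U, 0)`, `(-1, C, 0)`, so it is enough to
differentiate the frame. Each derivative stays in the space. -/
theorem tractorDeriv_mem_circleSpace (g : RMetric n M) (hγ : ContMDiff 𝓘(ℝ, ℝ) (𝓡 n) ∞ γ)
    (he : ContMDiff 𝓘(ℝ, ℝ) 𝓘(ℝ, ℝ).tangent ∞ fun s ↦ (⟨s, e s⟩ : TangentBundle 𝓘(ℝ, ℝ) N))
    (he_unit : ∀ s, g.inner (γ s) (velocity γ s (e s)) (velocity γ s (e s)) = 1)
    (h : ConformalCircleEq g γ e) {τ : ∀ s, Tractor (TangentSpace (𝓡 n) (γ s))}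
    (hτ : SmoothTractorAt γ τ s)
    (hmem : ∀ᶠ s in 𝓝 s, τ s ∈ circleSpace (velocity γ s (e s))
      (-covDeriv g γ (fun s ↦ velocity γ s (e s)) s (e s))) :
    tractorDeriv g γ τ s (e s) ∈ circleSpace (velocity γ s (e s))
      (-covDeriv g γ (fun s ↦ velocity γ s (e s)) s (e s)) := by
  have hJ := h.covDeriv_acceleration s
  have hUC := inner_velocity_acceleration g hγ he he_unit
  set U : ∀ s, TangentSpace (𝓡 n) (γ s) := fun s ↦ velocity γ s (e s) with hUdef
  set C : ∀ s, TangentSpace (𝓡 n) (γ s) := fun s ↦ covDeriv g γ U s (e s) with hCdef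
  have hU : ∀ s, SmoothFieldAt γ U s := smoothFieldAt_velocity hγ he
  have hC : ∀ s, SmoothFieldAt γ C s := smoothFieldAt_covDeriv g hγ he hU
  have hX := smoothTractorAt_canonical hγ s
  have hUt := (hU s).tractor 0 0
  have hVt := (hC s).tractor (-1) 0
  have hr := hτ.2.1.inner g (hU s)
  have hneg := hτ.1.neg
  -- The unspecified coefficient in the definition of `circleSpace` equals the pairing with `U`,
  -- which shows that it is smooth.
  have hdec : ∀ᶠ s in 𝓝 s, τ s = g.inner (γ s) (τ s).2.1 (U s) • (0, U s, 0) +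
      (-(τ s).1) • (-1, C s, 0) + (τ s).2.2 • (0, 0, 1) := by
    filter_upwards [hmem] with s' hs'
    obtain ⟨r, hr⟩ := hs'
    have h1 : g.inner (γ s') (τ s').2.1 (U s') = r := by
      rw [hr, g.symm]
      simp only [map_add, map_smul, map_neg, smul_eq_mul, hUdef, he_unit]
      rw [hUC]
      ring
    rw [h1]
    refine Prod.ext ?_ (Prod.ext ?_ ?_)
    · simp
    · simp [hr, hCdef, hUdef]
    · simp
  rw [tractorDeriv_congr g hdec,
    tractorDeriv_add g hγ ((hUt.smul hγ hr).add hγ (hVt.smul hγ hneg)) (hX.smul hγ hτ.2.2),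
    tractorDeriv_add g hγ (hUt.smul hγ hr) (hVt.smul hγ hneg), tractorDeriv_smul g hγ hr hUt,
    tractorDeriv_smul g hγ hneg hVt, tractorDeriv_smul g hγ hτ.2.2 hX, tractorDeriv_canonical g hγ]
  have mX : ((0, 0, 1) : Tractor (TangentSpace (𝓡 n) (γ s))) ∈ circleSpace (U s) (-C s) :=
    canonical_mem_circleSpace _ _
  have mU : ((0, U s, 0) : Tractor (TangentSpace (𝓡 n) (γ s))) ∈ circleSpace (U s) (-C s) :=
    ⟨1, by simp⟩
  have mV : ((-1, C s, 0) : Tractor (TangentSpace (𝓡 n) (γ s))) ∈ circleSpace (U s) (-C s) :=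
    ⟨0, by simp⟩
  have mdU : tractorDeriv g γ (fun s ↦ (0, U s, 0)) s (e s) ∈ circleSpace (U s) (-C s) := by
    refine ⟨0, ?_⟩
    simp [tractorDeriv, dirDeriv_const, he_unit, hUdef, hCdef]
  -- This is where the conformal circle equation enters: the middle slot `∂C - P♯U` is a multiple of
  -- `U`.
  have mdV : tractorDeriv g γ (fun s ↦ (-1, C s, 0)) s (e s) ∈ circleSpace (U s) (-C s) := by
    refine ⟨-(g.inner (γ s) (C s) (C s) + schouten g (γ s) (U s) (U s)), ?_⟩
    have hmod : ∀ (P u c : TangentSpace (𝓡 n) (γ s)) (k : ℝ),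
        P - k • u + (0 : ℝ) • u + (-1 : ℝ) • P = -k • u + (0 - 0 : ℝ) • -c := fun P u c k ↦ by
      module
    simp only [tractorDeriv, dirDeriv_const]
    rw [hUC, hJ]
    exact hmod _ _ _ _
  exact Submodule.add_mem _ (Submodule.add_mem _
    (Submodule.add_mem _ (Submodule.smul_mem _ _ mU) (Submodule.smul_mem _ _ mdU))
    (Submodule.add_mem _ (Submodule.smul_mem _ _ mV) (Submodule.smul_mem _ _ mdV)))
    (Submodule.add_mem _ (Submodule.smul_mem _ _ mX) (Submodule.smul_mem _ _ mU))

/-- Differentiating skewness uses that the tractor form is parallel, and differentiating `Φ τ ∈ W`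
uses that `W` is. The hypothesis `hext` supplies enough sections to test the second condition on all
of `W s`. -/
theorem isTractorParallel_skewStab (g : RMetric n M) (hγ : ContMDiff 𝓘(ℝ, ℝ) (𝓡 n) ∞ γ)
    (he_unit : ∀ s, g.inner (γ s) (velocity γ s (e s)) (velocity γ s (e s)) = 1)
    {W : ∀ s, Submodule ℝ (Tractor (TangentSpace (𝓡 n) (γ s)))}
    (hext : ∀ s, ∀ w ∈ W s, ∃ τ, SmoothTractorAt γ τ s ∧ τ s = w ∧ ∀ᶠ s' in 𝓝 s, τ s' ∈ W s')
    (hW : ∀ s τ, SmoothTractorAt γ τ s → (∀ᶠ s' in 𝓝 s, τ s' ∈ W s') →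
      tractorDeriv g γ τ s (e s) ∈ W s) :
    IsTractorParallel g γ fun s ↦ skewStab (metricForm g (γ s)) (W s) := by
  intro s Φ hΦ v
  obtain ⟨Ψ, hΨ⟩ := exists_isTractorEndDeriv g hγ hΦ.self_of_nhds.1 (e s)
  have hΨmem : Ψ ∈ skewStab (metricForm g (γ s)) (W s) := by
    refine ⟨fun a b ↦ ?_, fun w hw ↦ ?_⟩
    · obtain ⟨τ, hτ, rfl⟩ := exists_smoothTractorAt_eq hγ s a
      obtain ⟨τ', hτ', rfl⟩ := exists_smoothTractorAt_eq hγ s b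
      have hΦs := hΦ.self_of_nhds
      have h1 := dirDeriv_tractorBilin g hγ (hΦs.1 τ hτ) hτ' (e s)
      have h2 := dirDeriv_tractorBilin g hγ hτ (hΦs.1 τ' hτ') (e s)
      have h3 : (fun s ↦ tractorBilin (metricForm g (γ s)) (Φ s (τ s)) (τ' s)) =ᶠ[𝓝 s]
          fun s ↦ (-1 : ℝ) • tractorBilin (metricForm g (γ s)) (τ s) (Φ s (τ' s)) := by
        filter_upwards [hΦ] with s' hs'
        have := hs'.2.1 (τ s') (τ' s')
        simp only [smul_eq_mul]
        linarith
      have h4 := curveDeriv_smul (r := fun _ ↦ (-1 : ℝ)) mdifferentiableAt_const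
        ((hτ.bilin g (hΦs.1 τ' hτ')).mdifferentiableAt (by simp)) (e s)
      rw [dirDeriv_eq_curveDeriv, curveDeriv_congr h3, h4, curveDeriv_const,
        ← dirDeriv_eq_curveDeriv, h2, hΨ τ hτ, hΨ τ' hτ'] at h1
      have h5 := hΦs.2.1 (tractorDeriv g γ τ s (e s)) (τ' s)
      have h6 := hΦs.2.1 (τ s) (tractorDeriv g γ τ' s (e s))
      simp only [map_add, LinearMap.add_apply, smul_eq_mul] at h1
      linarith
    · obtain ⟨τ, hτ, rfl, hτW⟩ := hext s w hw
      have h1 := hW s _ (hΦ.self_of_nhds.1 τ hτ) (by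
        filter_upwards [hΦ, hτW] with s' hs' hs'' using hs'.2.2 _ hs'')
      rw [hΨ τ hτ] at h1
      have h2 := hΦ.self_of_nhds.2.2 _ (hW s τ hτ hτW)
      simpa using (W s).sub_mem h1 h2
  -- The parameter manifold is one-dimensional, so a direction with unit velocity spans its tangent
  -- line, and every `v` is a multiple of it.
  have hes : (e s : ℝ) ≠ 0 := by
    intro h0
    have h1 := he_unit s
    rw [show e s = (0 : TangentSpace 𝓘(ℝ, ℝ) s) from h0] at h1
    rw [show velocity γ s (0 : TangentSpace 𝓘(ℝ, ℝ) s) = (0 : TangentSpace (𝓡 n) (γ s)) from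
      map_zero (mfderiv 𝓘(ℝ, ℝ) (𝓡 n) γ s)] at h1
    simp at h1
  have hdiv : ∀ a b : ℝ, a ≠ 0 → ∃ c : ℝ, b = c • a := fun a b h ↦
    ⟨b / a, (div_mul_cancel₀ b h).symm⟩
  obtain ⟨c, hc⟩ := hdiv (e s) v hes
  obtain rfl : v = c • e s := hc
  refine ⟨c • Ψ, Submodule.smul_mem _ _ hΨmem, fun τ hτ ↦ ?_⟩
  rw [tractorDeriv_smul_dir, tractorDeriv_smul_dir, hΨ τ hτ, smul_add, map_smul]
  rfl

/-- The subbundle is the skew stabiliser of `circleSpace U (-C)`. Conjugacy to the model makes its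
rank constant, and the wedges of the projected members of a chart frame span it smoothly. -/
theorem isDistinguished_of_conformalCircleEq (g : RMetric n M)
    (hγ : ContMDiff 𝓘(ℝ, ℝ) (𝓡 n) ∞ γ)
    (he : ContMDiff 𝓘(ℝ, ℝ) 𝓘(ℝ, ℝ).tangent ∞ fun s ↦ (⟨s, e s⟩ : TangentBundle 𝓘(ℝ, ℝ) N))
    (he_unit : ∀ s, g.inner (γ s) (velocity γ s (e s)) (velocity γ s (e s)) = 1)
    {U₀ C₀ : Euc n} (hU₀ : ‖U₀‖ = 1) (hUC₀ : inner ℝ U₀ C₀ = (0 : ℝ))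
    (h : ConformalCircleEq g γ e) : IsDistinguished g (circle U₀ C₀) γ := by
  have hUC := inner_velocity_acceleration g hγ he he_unit
  have hpar := fun s τ hτ ↦ tractorDeriv_mem_circleSpace (s := s) (τ := τ) g hγ he he_unit h hτ
  set U : ∀ s, TangentSpace (𝓡 n) (γ s) := fun s ↦ velocity γ s (e s) with hUdef
  set C : ∀ s, TangentSpace (𝓡 n) (γ s) := fun s ↦ covDeriv g γ U s (e s) with hCdef
  have hU : ∀ s, SmoothFieldAt γ U s := smoothFieldAt_velocity hγ he
  have hC : ∀ s, SmoothFieldAt γ C s := smoothFieldAt_covDeriv g hγ he hU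
  have hsymm : ∀ s (v w : TangentSpace (𝓡 n) (γ s)),
      metricForm g (γ s) v w = metricForm g (γ s) w v := fun s ↦ g.symm (γ s)
  have hpos : ∀ s (v : TangentSpace (𝓡 n) (γ s)), v ≠ 0 → 0 < metricForm g (γ s) v v :=
    fun s ↦ g.pos (γ s)
  have hfd : ∀ x : M, FiniteDimensional ℝ (TangentSpace (𝓡 n) x) := fun x ↦
    inferInstanceAs (FiniteDimensional ℝ (Euc n))
  have hdim : ∀ x : M, Module.finrank ℝ (TangentSpace (𝓡 n) x) = n := fun x ↦
    finrank_euclideanSpace_fin (𝕜 := ℝ)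
  have hconj : ∀ s, ∃ u, IsCartanFrame g (γ s) u ∧
      skewStab (metricForm g (γ s)) (circleSpace (U s) (-C s)) =
        (symAlgebra (circle U₀ C₀)).map (LinearEquiv.conj u).toLinearMap := by
    intro s
    obtain ⟨u, hu, hu1, hmap⟩ := exists_frame_circleSpace (C := C₀) (c := C s) (hdim (γ s))
      (hsymm s) (hpos s) hU₀ (he_unit s)
    refine ⟨u, ⟨hu, 1, hu1⟩, ?_⟩
    rw [symAlgebra_circle hU₀ hUC₀, map_conj_skewStab u hu, hmap]
  refine ⟨fun s ↦ skewStab (metricForm g (γ s)) (circleSpace (U s) (-C s)), ?_, hconj, ?_⟩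
  · refine isSmoothSubbundle_of_span hγ (k := Module.finrank ℝ (symAlgebra (circle U₀ C₀)))
      (fun s ↦ ?_) fun s₀ ↦ ?_
    · obtain ⟨u, -, hu⟩ := hconj s
      rw [hu]
      exact LinearEquiv.finrank_map_eq (LinearEquiv.conj u) _
    · have hp := mem_chart_source (Euc n) (γ s₀)
      let f := Module.finBasis ℝ (Tractor (Euc n))
      let F : ∀ (_ : Fin _) (s' : N), Tractor (TangentSpace (𝓡 n) (γ s')) :=
        fun j s' ↦ ofChartTractor (γ s₀) (γ s') (f j)
      let Q := fun s ↦ circleProj (metricForm g (γ s)) (U s) (C s)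
      refine ⟨_, fun (i : Fin _ × Fin _) s ↦
        wedge (metricForm g (γ s)) (Q s (F i.1 s)) (Q s (F i.2 s)) +
          wedge (metricForm g (γ s)) (F i.1 s - Q s (F i.1 s)) (F i.2 s - Q s (F i.2 s)), ?_⟩
      filter_upwards [eventually_mem_chart_source hγ hp] with s hs
      have hF : ∀ j, SmoothTractorAt γ (F j) s := fun j ↦
        smoothTractorAt_ofChartTractor hγ hs (f j)
      have hX := smoothTractorAt_canonical hγ s
      have hUt := (hU s).tractor 0 0
      have hZ : SmoothTractorAt γ (fun s ↦ circleDual (metricForm g (γ s)) (C s)) s := by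
        refine ⟨contMDiffAt_const, ?_, contMDiffAt_const.mul ((hC s).inner g (hC s))⟩
        have h1 := (hC s).smul hγ (contMDiffAt_const (c := (-1 : ℝ)))
        simp only [neg_smul, one_smul] at h1
        exact h1
      have hQ : ∀ j, SmoothTractorAt γ (fun s ↦ Q s (F j s)) s := fun j ↦
        ((hX.smul hγ (hZ.bilin g (hF j))).add hγ (hUt.smul hγ (hUt.bilin g (hF j)))).add hγ
          (hZ.smul hγ (hX.bilin g (hF j)))
      refine ⟨fun i τ hτ ↦ ?_, ?_⟩
      · exact (((hQ i.1).wedge g hγ (hQ i.2)) τ hτ).add hγ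
          ((((hF i.1).sub hγ (hQ i.1)).wedge g hγ ((hF i.2).sub hγ (hQ i.2))) τ hτ)
      · have hQW : ∀ w ∈ circleSpace (U s) (-C s), Q s w = w := fun w hw ↦
          circleProj_of_mem (hsymm s) (he_unit s) (hUC s) hw
        have hadj := circleProj_adjoint (hsymm s) (U s) (C s)
        refine le_antisymm ?_ (skewStab_le_span (hsymm s) (hpos s)
          (f.map (chartTractorEquiv hs)) (Q s) (circleProj_mem _ _ _) hQW hadj)
        rw [Submodule.span_le]
        rintro _ ⟨i, rfl⟩
        have horth : ∀ a, ∀ w ∈ circleSpace (U s) (-C s),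
            tractorBilin (metricForm g (γ s)) (a - Q s a) w = 0 := by
          intro a w hw
          have h1 := hadj a w
          rw [show circleProj (metricForm g (γ s)) (U s) (C s) w = w from hQW w hw] at h1
          rw [map_sub, LinearMap.sub_apply, sub_eq_zero]
          exact h1.symm
        exact Submodule.add_mem _
          (wedge_mem_skewStab (hsymm s) (circleProj_mem _ _ _ _) (circleProj_mem _ _ _ _))
          (wedge_mem_skewStab_of_orthogonal (hsymm s) (horth _) (horth _))
  · refine isTractorParallel_skewStab g hγ he_unit (fun s w hw ↦ ?_) hpar
    obtain ⟨r, hr⟩ := hw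
    have hX := smoothTractorAt_canonical hγ s
    have hUt := (hU s).tractor 0 0
    have hVt := (hC s).tractor (-1) 0
    -- Extension of `w` with constant coefficients in the smooth frame of the circle space.
    refine ⟨fun s ↦ r • (0, U s, 0) + (-w.1) • (-1, C s, 0) + w.2.2 • (0, 0, 1),
      ((hUt.smul hγ contMDiffAt_const).add hγ (hVt.smul hγ contMDiffAt_const)).add hγ
        (hX.smul hγ contMDiffAt_const), ?_, Filter.Eventually.of_forall fun s' ↦ ?_⟩
    · refine Prod.ext ?_ (Prod.ext ?_ ?_)
      · simp
      · simp [hr]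
      · simp
    · exact ⟨r, by simp⟩

end Sufficiency

end ConformalCircles

end

/-! ### The equivalence -/

theorem mainTheorem8 {n : ℕ} (hn : 3 ≤ n)
    {M : Type*} [TopologicalSpace M] [T2Space M] [ChartedSpace (EuclideanSpace ℝ (Fin n)) M]
    [IsManifold (𝓡 n) ∞ M] (g : ConformalCircles.RMetric n M)
    {N : Type*} [TopologicalSpace N] [ChartedSpace ℝ N] [IsManifold 𝓘(ℝ, ℝ) ∞ N]
    (γ : N → M) (hγ : Manifold.IsSmoothEmbedding 𝓘(ℝ, ℝ) (𝓡 n) ∞ γ)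
    -- the orientation of the curve, given through its unit tangent field `dγ(e)`
    (e : ∀ s : N, TangentSpace 𝓘(ℝ, ℝ) s)
    (he : ContMDiff 𝓘(ℝ, ℝ) 𝓘(ℝ, ℝ).tangent ∞ fun s ↦ (⟨s, e s⟩ : TangentBundle 𝓘(ℝ, ℝ) N))
    (he_unit : ∀ s, g.inner (γ s) (ConformalCircles.velocity γ s (e s))
      (ConformalCircles.velocity γ s (e s)) = 1)
    -- the model circle in `ℝⁿ`
    (U₀ C₀ : EuclideanSpace ℝ (Fin n)) (hU₀ : ‖U₀‖ = 1) (hUC₀ : inner ℝ U₀ C₀ = (0 : ℝ)) :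
    ConformalCircles.IsDistinguished g (ConformalCircles.circle U₀ C₀) γ ↔
      ConformalCircles.ConformalCircleEq g γ e := by
  have hsm := hγ.contMDiff
  exact ⟨ConformalCircles.conformalCircleEq_of_isDistinguished g hsm he he_unit hU₀ hUC₀,
    ConformalCircles.isDistinguished_of_conformalCircleEq g hsm he he_unit hU₀ hUC₀⟩
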